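/- Let $p(n)$ be the number of partitions of $n$ (with $p(0)=1$), let $f(x)=\sum_{n\ge 0}p(n)x^n$, and for an integer $r\ge 0$ let $p_r(n)$ be the coefficient of $x^n$ in $$f_r(x)=\frac{f(x)\,f(x^{2^r})}{f(x^2)}.$$ Write $(h,k)$ for $\gcd(h,k)$, and for integers $h\ge 0$, $k\ge 1$ put $$\omega(h,k)=\exp\Bigl(\pi i\sum_{m=1}^{k-1}\frac mk\Bigl(\frac{hm}{k}-\Bigl\lfloor\frac{hm}{k}\Bigr\rfloor-\frac12\Bigr)\Bigr).$$ (a) Let $r\in\{0,1,2,3,4\}$ and let $n$ be an integer with $n>(2^r-1)/24$ (equivalently, $n\ge 1$). Then $$ \begin{aligned} p_r(n)={}&\frac{2^{(r+1)/2}\sqrt3}{\pi}\sum_{\substack{k\ge 1\\ (k,2^{\max(r,1)})=1}}\sqrt k\sum_{\substack{0\le h<k\\ (h,k)=1}}e^{-2\pi i nh/k}\,\frac{\omega(h,k)\,\omega(2^rh,k)}{\omega(2h,k)}\;\frac{d}{dn}\left\{\frac{\sinh\left(\frac{\pi\sqrt{(24n-2^r+1)(1+2^{r-1})}}{2^{r/2}\cdot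 6k}\right)}{\sqrt{24n-2^r+1}}\right\}\\ &+\frac{\sqrt3}{\pi}\sum_{j=1+\lfloor r/2\rfloor}^{r}2^{(2-j+r)/2}\sum_{\substack{k\ge 1\\ (k,2^r)=2^j}}\sqrt k\sum_{\substack{0\le h<k\\ (h,k)=1}}e^{-2\pi i nh/k}\,\frac{\omega(h,k)\,\omega(2^{r-j}h,2^{-j}k)}{\omega(h,\frac k2)}\;\frac{d}{dn}\left\{\frac{\sinh\left(\frac{\pi\sqrt{(24n-2^r+1)(-1+2^{2j-r})}}{6k}\right)}{\sqrt{24n-2^r+1}}\right\}, \end{aligned} $$ where $d/dn$ is the derivative with respect to $n$ regarded as a real variable, and all series over $k$ converge absolutely. (b) For every $n\ge 0$, $p_0(n)=\overline p(n)$ is the number of overpartitions of $n$ (partitions of $n$ in which the last occurrence of each part size may or may not be overlined), $p_1(n)=p(n)$, and $p_2(n)=pod(n)$ is the number of partitions of $n$ in which no odd part appears more than once. (c) The cases $r=0,1,2$ of (a) give, for every $n\ge 1$, respectively Zuckerman's formula $$\overline p(n)=\frac1{2\pi}\sum_{\substack{k\ge1\\ 2\nmid k}}\sqrt k\sum_{\substack{0\le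 h<k\\ (h,k)=1}}\frac{\omega(h,k)^2}{\omega(2h,k)}e^{-2\pi i nh/k}\frac{d}{dn}\left(\frac{\sinh\left(\frac{\pi\sqrt n}{k}\right)}{\sqrt n}\right),$$ Rademacher's formula $$p(n)=\frac1{\pi\sqrt2}\sum_{k\ge1}\sqrt k\sum_{\substack{0\le h<k\\ (h,k)=1}}\omega(h,k)e^{-2\pi i nh/k}\frac{d}{dn}\left(\frac{\sinh\left(\frac\pi k\sqrt{\frac23\left(n-\frac1{24}\right)}\right)}{\sqrt{n-\frac1{24}}}\right),$$ and the formula $$pod(n)=\frac2\pi\sum_{k\ge1}\sqrt{k\left(1-(-1)^k+\left\lfloor\tfrac{(k,4)}4\right\rfloor\right)}\sum_{\substack{0\le h<k\\ (h,k)=1}}\frac{\omega(h,k)\,\omega\left(\frac{4h}{(k,4)},\frac k{(k,4)}\right)}{\omega\left(\frac{2h}{(k,2)},\frac k{(k,2)}\right)}e^{-2\pi i nh/k}\frac{d}{dn}\left(\frac{\sinh\left(\frac{\pi\sqrt{(k,4)(8n-1)}}{4k}\right)}{\sqrt{8n-1}}\right),$$ again with absolutely convergent series over $k$. -/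

import Mathlib

noncomputable section

namespace Rademacher

open Finset

/-- The number `p(n)` of partitions of `n`. -/
def numPartitions (n : ℕ) : ℕ := Fintype.card (Nat.Partition n)

/-- Overpartitions of `n`: a partition of `n` together with the set of those part sizes whose last
occurrence is overlined. -/
def overpartitions (n : ℕ) : Finset (Σ _ : Nat.Partition n, Finset ℕ) :=
  Finset.univ.sigma fun l => l.parts.toFinset.powerset

/-- The number of overpartitions of `n`. -/
def numOverpartitions (n : ℕ) : ℕ := (overpartitions n).card

/-- The number `pod(n)` of partitions of `n` in which no odd part appears more than once. -/
def pod (n : ℕ) : ℕ :=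
  (Finset.univ.filter fun l : Nat.Partition n => ∀ i ∈ l.parts, Odd i → l.parts.count i ≤ 1).card

/-- The generating function `f(x) = ∑ p(n) xⁿ` of the partition function. -/
def f : PowerSeries ℂ := PowerSeries.mk fun n => (numPartitions n : ℂ)

/-- `f_r(x) = f(x) f(x^(2^r)) / f(x^2)`; the power series `f(x^2)` has constant term `1`, so that
the inverse is a genuine one. -/
def fr (r : ℕ) : PowerSeries ℂ :=
  f * PowerSeries.expand (2 ^ r) (pow_ne_zero r two_ne_zero) f
    * (PowerSeries.expand 2 two_ne_zero f)⁻¹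

/-- `p_r(n)`, the coefficient of `xⁿ` in `f_r(x)`. -/
def pr (r n : ℕ) : ℂ := PowerSeries.coeff n (fr r)

/-- `ω(h,k) = exp(π i ∑_{m=1}^{k-1} (m/k) (hm/k - ⌊hm/k⌋ - 1/2))`. -/
def omega (h k : ℕ) : ℂ :=
  Complex.exp (Real.pi * Complex.I *
    ((∑ m ∈ Finset.Ico 1 k,
      ((m : ℝ) / k) * ((h * m : ℝ) / k - (⌊(h * m : ℝ) / k⌋ : ℝ) - 1 / 2) : ℝ) : ℂ))

/-- The `h` with `0 ≤ h < k` and `(h,k) = 1`. -/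
def reduced (k : ℕ) : Finset ℕ := (Finset.range k).filter fun h => Nat.gcd h k = 1

/-- `e^{-2π i n h/k}`. -/
def phase (n h k : ℕ) : ℂ := Complex.exp (-2 * Real.pi * Complex.I * n * h / k)

/-- The `k`-th term of the series over odd `k`. -/
def mainTerm (r n k : ℕ) : ℂ :=
  (Real.sqrt k : ℂ)
    * (∑ h ∈ reduced k, phase n h k * (omega h k * omega (2 ^ r * h) k / omega (2 * h) k))
    * ((deriv (fun x : ℝ =>
        Real.sinh (Real.pi * Real.sqrt ((24 * x - 2 ^ r + 1) * (1 + (2 : ℝ) ^ ((r : ℤ) - 1)))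
            / ((2 : ℝ) ^ ((r : ℝ) / 2) * (6 * k)))
          / Real.sqrt (24 * x - 2 ^ r + 1)) (n : ℝ) : ℝ) : ℂ)

/-- The `k`-th term of the series over the `k` with `(k, 2^r) = 2^j`. It is used only for such `k`
and `1 ≤ j ≤ r`, where the divisions `k / 2 ^ j` and `k / 2` are exact. -/
def extraTerm (r j n k : ℕ) : ℂ :=
  (Real.sqrt k : ℂ)
    * (∑ h ∈ reduced k,
        phase n h k * (omega h k * omega (2 ^ (r - j) * h) (k / 2 ^ j) / omega h (k / 2)))
    * ((deriv (fun x : ℝ =>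
        Real.sinh (Real.pi
            * Real.sqrt ((24 * x - 2 ^ r + 1) * (-1 + (2 : ℝ) ^ (2 * (j : ℤ) - (r : ℤ))))
            / (6 * k))
          / Real.sqrt (24 * x - 2 ^ r + 1)) (n : ℝ) : ℝ) : ℂ)

/-- The `k`-th term of the series for the number of overpartitions. -/
def overTerm (n k : ℕ) : ℂ :=
  (Real.sqrt k : ℂ)
    * (∑ h ∈ reduced k, (omega h k ^ 2 / omega (2 * h) k) * phase n h k)
    * ((deriv (fun x : ℝ =>
        Real.sinh (Real.pi * Real.sqrt x / k) / Real.sqrt x) (n : ℝ) : ℝ) : ℂ)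

/-- The `k`-th term of the series for the number of partitions. -/
def partTerm (n k : ℕ) : ℂ :=
  (Real.sqrt k : ℂ)
    * (∑ h ∈ reduced k, omega h k * phase n h k)
    * ((deriv (fun x : ℝ =>
        Real.sinh (Real.pi / k * Real.sqrt (2 / 3 * (x - 1 / 24)))
          / Real.sqrt (x - 1 / 24)) (n : ℝ) : ℝ) : ℂ)

/-- The `k`-th term of the series for `pod`; all divisions of natural numbers are exact, except
`(k,4) / 4`, which is the floor `⌊(k,4)/4⌋`. -/
def podTerm (n k : ℕ) : ℂ :=
  (Real.sqrt (k * (1 - (-1) ^ k + ((Nat.gcd k 4 / 4 : ℕ) : ℝ))) : ℂ)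
    * (∑ h ∈ reduced k,
        (omega h k * omega (4 * h / Nat.gcd k 4) (k / Nat.gcd k 4)
          / omega (2 * h / Nat.gcd k 2) (k / Nat.gcd k 2)) * phase n h k)
    * ((deriv (fun x : ℝ =>
        Real.sinh (Real.pi * Real.sqrt ((Nat.gcd k 4 : ℝ) * (8 * x - 1)) / (4 * k))
          / Real.sqrt (8 * x - 1)) (n : ℝ) : ℝ) : ℂ)

end Rademacher

end

/-! ### Dedekind sums and the reciprocity law. -/

noncomputable section

namespace Rademacher

open Finset

/-! The proof is Rademacher's circle method along Ford circles.

Since f = 1/∏(1-x^m) is essentially 1/η, its behaviour near every root of unity is known exactly: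
`eulerFn_transform` comes from η(τ+1) and η(-1/τ) by Euclid's algorithm, and Dedekind reciprocity
shows that the root of unity which accumulates is ω(h,k). Applied to x, x² and x^(2^r) it gives
`frFn_transform`: at τ = h/k + iw the function f_r is a constant times √w exp(πa/(12k²w) -
π(2^r-1)w/12), with a = `polarCoeff r k`, times Euler products at points that tend to 0 with w.

On the Ford disc Re(1/w) ≥ k², put y = Re(1/w)/k² ≥ 1. The leading term grows like e^(πay/12), and
the first correction is smaller by a factor e^(-2πcy), where c belongs to one of the three products.
The error is bounded as soon as a ≤ 24c for each of them (`polarCoeff_le`). The value of a reaches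
2^r - 1 while c = 1 occurs, and this is where r ≤ 4 enters. If a ≤ 0 the whole function is bounded
and the fraction contributes nothing; only odd k and the k with gcd(k,2^r) = 2^j, 2j > r, survive.

The coefficient p_r(n) is the increment over a period of a primitive Φ of f_r(e^(2πiτ)) e^(-2πinτ).
This increment telescopes over the points of tangency of the Ford circles of the Farey fractions of
order N (`sum_fordPoint_sub`), so that no integral over an arc is needed. Between two consecutive
points Φ is compared with a primitive of the leading term by the mean value inequality on a chord
(`ford_arc_estimate`). With w = 1/u the leading term becomes an integral of u^(-5/2) exp(au + b/u)
over part of the line Re u = k², which is completed to the full line. All errors together are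
O(N^(-1/2)).

The full line integral is a Bessel function of order 3/2, hence elementary: expansion of e^(b/u) and
the inverse Laplace transform of powers give the series of d/dX (sinh(γ√X)/√X)
(`kernelIntegral_eq_deriv_sinh`). It is O(k^(-3)), which yields absolute convergence. The
combinatorial identities for r = 0, 1, 2 are comparisons of infinite products factor by factor. -/

/-- The Dedekind sum `s(h,k)`. -/
def dedekindSum (h : ℤ) (k : ℕ) : ℝ :=
  ∑ m ∈ Ico 1 k, ((m : ℝ) / k) * (Int.fract ((h * m : ℝ) / k) - 1 / 2)

theorem omega_eq_exp_dedekindSum (h k : ℕ) :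
    omega h k = Complex.exp (Real.pi * Complex.I * (dedekindSum h k : ℝ)) := by
  simp only [omega, dedekindSum, Int.fract, Int.cast_natCast]

theorem dedekindSum_add_mul (h c : ℤ) (k : ℕ) : dedekindSum (h + c * k) k = dedekindSum h k := by
  rcases Nat.eq_zero_or_pos k with rfl | hk
  · simp
  refine sum_congr rfl fun m _ => ?_
  have hk' : (k : ℝ) ≠ 0 := by positivity
  have : (((h + c * k : ℤ) : ℝ) * m) / k = (h * m : ℝ) / k + ((c * m : ℤ) : ℝ) := by
    push_cast; field_simp
  rw [this, Int.fract_add_intCast]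

/-- Off the integers {-x} = 1 - {x}, so {x} - 1/2 is odd there; coprimality keeps hm/k off the
integers for 0 < m < k. -/
theorem dedekindSum_neg {h : ℤ} {k : ℕ} (hk : 0 < k) (hc : IsCoprime h k) :
    dedekindSum (-h) k = -dedekindSum h k := by
  rw [dedekindSum, dedekindSum, ← sum_neg_distrib]
  refine sum_congr rfl fun m hm => ?_
  have hk' : (k : ℝ) ≠ 0 := by positivity
  rw [mem_Ico] at hm
  have hne : Int.fract ((h * m : ℝ) / k) ≠ 0 := by
    intro h0
    rw [Int.fract_eq_iff] at h0
    obtain ⟨-, -, z, hz⟩ := h0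
    rw [sub_zero, div_eq_iff hk'] at hz
    have hz' : h * m = z * k := by exact_mod_cast hz
    have h1 : (k : ℤ) ∣ h * m := ⟨z, by rw [hz']; ring⟩
    have h2 := hc.symm.dvd_of_dvd_mul_left h1
    have h3 := Nat.le_of_dvd (by omega) (Int.natCast_dvd_natCast.mp h2)
    omega
  have : ((-h : ℤ) * m : ℝ) / k = -((h * m : ℝ) / k) := by push_cast; ring
  rw [this, Int.fract_neg hne]
  ring

theorem sum_mul_mod_of_coprime {h k : ℕ} (hc : Nat.Coprime h k) (g : ℕ → ℝ) :
    ∑ m ∈ range k, g (h * m % k) = ∑ m ∈ range k, g m := by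
  rcases Nat.eq_zero_or_pos k with rfl | hk
  · simp
  have hinj : Set.InjOn (fun m => h * m % k) (range k : Finset ℕ) := by
    intro a ha b hb hab
    simp only [coe_range, Set.mem_Iio] at ha hb
    have : h * a ≡ h * b [MOD k] := hab
    have := Nat.ModEq.cancel_left_of_coprime (by rwa [Nat.coprime_comm] at hc) this
    rwa [Nat.ModEq, Nat.mod_eq_of_lt ha, Nat.mod_eq_of_lt hb] at this
  have himg : (range k).image (fun m => h * m % k) = range k := by
    refine eq_of_subset_of_card_le ?_ ?_
    · intro x hx
      simp only [mem_image, mem_range] at hx ⊢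
      obtain ⟨a, _, rfl⟩ := hx
      exact Nat.mod_lt _ hk
    · rw [card_image_of_injOn hinj]
  conv_rhs => rw [← himg, sum_image hinj]

/-- A lattice point count: write q² as the sum of 2l - 1 for l ≤ q and interchange the sums. The
line has no lattice point with 0 < l < h, so exactly k - 1 - ⌊kl/h⌋ of the m lie beyond l. -/
theorem sum_sq_div_eq {h k : ℕ} (hh : 0 < h) (hk : 0 < k) (hc : Nat.Coprime h k) :
    ∑ m ∈ range k, ((h * m / k : ℕ) : ℝ) ^ 2
      = ∑ l ∈ Ico 1 h, (2 * (l : ℝ) - 1) * ((k : ℝ) - 1 - ((k * l / h : ℕ) : ℝ)) := by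
  have h1 : ∀ m ∈ range k, ((h * m / k : ℕ) : ℝ) ^ 2
      = ∑ l ∈ Ico 1 h, if k * l ≤ h * m then (2 * (l : ℝ) - 1) else 0 := by
    intro m hm
    rw [mem_range] at hm
    rw [← sum_filter]
    have hq : h * m / k < h := by
      rw [Nat.div_lt_iff_lt_mul hk]
      exact Nat.mul_lt_mul_of_pos_left hm hh
    have : (Ico 1 h).filter (fun l => k * l ≤ h * m) = Ico 1 (h * m / k + 1) := by
      ext l
      simp only [mem_filter, mem_Ico]
      have : l ≤ h * m / k ↔ k * l ≤ h * m := by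
        rw [Nat.le_div_iff_mul_le hk, mul_comm]
      constructor
      · rintro ⟨⟨a, b⟩, c⟩
        have := this.2 c
        omega
      · rintro ⟨a, b⟩
        exact ⟨⟨a, by omega⟩, this.1 (by omega)⟩
    rw [this]
    generalize h * m / k = q
    induction q with
    | zero => simp
    | succ q ih => rw [sum_Ico_succ_top (by omega), ← ih]; push_cast; ring
  rw [sum_congr rfl h1, sum_comm]
  refine sum_congr rfl fun l hl => ?_
  rw [mem_Ico] at hl
  rw [← sum_filter, sum_const, nsmul_eq_mul, mul_comm]
  congr 1
  have hlt : k * l / h < k := by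
    rw [Nat.div_lt_iff_lt_mul hh]
    exact Nat.mul_lt_mul_of_pos_left hl.2 hk
  have : (range k).filter (fun m => k * l ≤ h * m) = Ico (k * l / h + 1) k := by
    ext m
    simp only [mem_filter, mem_range, mem_Ico]
    have hne : k * l ≠ h * m := by
      intro e
      have : h ∣ k * l := ⟨m, e⟩
      have := Nat.le_of_dvd (by omega) (hc.dvd_of_dvd_mul_left this)
      omega
    have : k * l / h < m ↔ k * l < h * m := by
      rw [Nat.div_lt_iff_lt_mul hh, mul_comm m h]
    constructor
    · rintro ⟨a, b⟩
      exact ⟨this.2 (lt_of_le_of_ne b hne), a⟩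
    · rintro ⟨a, b⟩
      exact ⟨b, (this.1 a).le⟩
  rw [this, Nat.card_Ico, Nat.cast_sub (by omega)]
  push_cast
  ring

theorem sum_range_cast (k : ℕ) : ∑ m ∈ range k, (m : ℝ) = k * (k - 1) / 2 := by
  induction k with
  | zero => simp
  | succ k ih => rw [sum_range_succ, ih]; push_cast; ring

theorem sum_range_cast_sq (k : ℕ) :
    ∑ m ∈ range k, (m : ℝ) ^ 2 = k * (k - 1) * (2 * k - 1) / 6 := by
  induction k with
  | zero => simp
  | succ k ih => rw [sum_range_succ, ih]; push_cast; ring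

theorem sum_Ico_one_eq_sum_range {k : ℕ} (hk : 0 < k) {g : ℕ → ℝ} (hg : g 0 = 0) :
    ∑ m ∈ Ico 1 k, g m = ∑ m ∈ range k, g m := by
  rw [range_eq_Ico, sum_eq_sum_Ico_succ_bot hk, hg, zero_add]

/-- The Dedekind sum in terms of integer quotients. -/
theorem dedekindSum_natCast {h k : ℕ} (hk : 0 < k) :
    dedekindSum h k = h * (k - 1) * (2 * k - 1) / (6 * k)
      - (∑ m ∈ range k, (m : ℝ) * ((h * m / k : ℕ) : ℝ)) / k - (k - 1) / 4 := by
  have hk' : (k : ℝ) ≠ 0 := by positivity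
  rw [dedekindSum, sum_Ico_one_eq_sum_range hk (by simp)]
  have : ∀ m ∈ range k, ((m : ℝ) / k) * (Int.fract (((h : ℤ) * m : ℝ) / k) - 1 / 2)
      = h / k ^ 2 * (m : ℝ) ^ 2 - (m : ℝ) * ((h * m / k : ℕ) : ℝ) / k - m / (2 * k) := by
    intro m _
    have e : (((h : ℤ) : ℝ) * m) / k = ((h * m : ℕ) : ℝ) / (k : ℕ) := by push_cast; ring
    rw [e, Int.fract_div_natCast_eq_div_natCast_mod]
    have := Nat.div_add_mod (h * m) k
    have h2 : ((h * m % k : ℕ) : ℝ) = h * m - k * ((h * m / k : ℕ) : ℝ) := by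
      rw [eq_sub_iff_add_eq']; exact_mod_cast this
    rw [h2]
    field_simp
  rw [sum_congr rfl this, sum_sub_distrib, sum_sub_distrib, ← mul_sum, ← sum_div, ← sum_div,
    sum_range_cast, sum_range_cast_sq]
  field_simp
  ring

/-- Linear elimination. Since m ↦ hm mod k permutes the residues, the sum of squared residues
relates S and Q (`e1`), and the sum of the residues of km modulo h gives L (`e2`). The lattice point
count relates Q to S' and L (`e3`). Expressing S and S' through Q makes Q cancel in the sum. -/
theorem dedekindSum_reciprocity {h k : ℕ} (hh : 0 < h) (hk : 0 < k) (hc : Nat.Coprime h k) :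
    dedekindSum h k + dedekindSum k h
      = -1 / 4 + ((h : ℝ) / k + k / h + 1 / (h * k)) / 12 := by
  have hk' : (k : ℝ) ≠ 0 := by positivity
  have hh' : (h : ℝ) ≠ 0 := by positivity
  rw [dedekindSum_natCast hk, dedekindSum_natCast hh]
  set S := ∑ m ∈ range k, (m : ℝ) * ((h * m / k : ℕ) : ℝ) with hS
  set S' := ∑ m ∈ range h, (m : ℝ) * ((k * m / h : ℕ) : ℝ) with hS'
  set Q := ∑ m ∈ range k, ((h * m / k : ℕ) : ℝ) ^ 2 with hQ
  set L := ∑ m ∈ range h, ((k * m / h : ℕ) : ℝ) with hL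
  have hmod : ∀ a b : ℕ, ((a % b : ℕ) : ℝ) = a - b * ((a / b : ℕ) : ℝ) := by
    intro a b
    rw [eq_sub_iff_add_eq']; exact_mod_cast Nat.div_add_mod a b
  have e1 : (h : ℝ) ^ 2 * (k * (k - 1) * (2 * k - 1) / 6) - 2 * h * k * S + k ^ 2 * Q
      = k * (k - 1) * (2 * k - 1) / 6 := by
    have := sum_mul_mod_of_coprime hc (fun x => (x : ℝ) ^ 2)
    simp only [hmod, sum_range_cast_sq] at this
    refine Eq.trans ?_ this
    rw [← sum_range_cast_sq, hS, hQ, mul_sum, mul_sum, mul_sum, ← sum_sub_distrib,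
      ← sum_add_distrib]
    refine sum_congr rfl fun m _ => ?_
    push_cast; ring
  have e2 : (k : ℝ) * (h * (h - 1) / 2) - h * L = h * (h - 1) / 2 := by
    have := sum_mul_mod_of_coprime hc.symm (fun x => (x : ℝ))
    simp only [hmod, sum_range_cast] at this
    refine Eq.trans ?_ this
    rw [← sum_range_cast, hL, mul_sum, mul_sum, ← sum_sub_distrib]
    refine sum_congr rfl fun m _ => ?_
    push_cast; ring
  have e3 : Q = (k - 1) * (h * (h - 1) - (h - 1)) - 2 * S' + L := by
    have hI : ∀ g : ℕ → ℝ, g 0 = 0 → ∑ m ∈ Ico 1 h, g m = ∑ m ∈ range h, g m :=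
      fun g hg => sum_Ico_one_eq_sum_range hh hg
    rw [hQ, sum_sq_div_eq hh hk hc, hS', hL, ← hI _ (by simp), ← hI _ (by simp)]
    have : (k - 1 : ℝ) * (h * (h - 1) - (h - 1)) = ∑ l ∈ Ico 1 h, (k - 1 : ℝ) * (2 * l - 1) := by
      rw [← mul_sum, sum_sub_distrib, ← mul_sum, sum_Ico_one_eq_sum_range hh (by simp),
        sum_range_cast]
      simp [Nat.cast_sub (show 1 ≤ h from hh)]
      left; ring
    rw [this, mul_sum, ← sum_sub_distrib, ← sum_add_distrib]
    refine sum_congr rfl fun l _ => ?_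
    ring
  have hL' : L = (k - 1) * (h - 1) / 2 := by
    have : (h : ℝ) * L = h * ((k - 1) * (h - 1) / 2) := by linarith
    exact mul_left_cancel₀ hh' this
  have hS2 : S' = ((k - 1) * (h * (h - 1) - (h - 1)) + (k - 1) * (h - 1) / 2 - Q) / 2 := by
    rw [e3, hL']; ring
  have hS1 : S = ((h : ℝ) ^ 2 * (k * (k - 1) * (2 * k - 1) / 6)
      - k * (k - 1) * (2 * k - 1) / 6 + k ^ 2 * Q) / (2 * h * k) := by
    rw [eq_div_iff (by positivity)]; linarith
  rw [hS1, hS2]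
  field_simp
  ring

end Rademacher

end

/-! ### Transformation of η and of the Euler product under the modular group. -/

noncomputable section

namespace Rademacher

open Complex Real

/-- The principal power is multiplicative while the arguments add up inside (-π, π]. The square
roots below concern points of the right half plane, or such points times ±i, so no branch is ever
crossed. -/
theorem mul_cpow_of_arg {x y : ℂ} (hx : x ≠ 0) (hy : y ≠ 0) (h1 : -π < x.arg + y.arg)
    (h2 : x.arg + y.arg ≤ π) (s : ℂ) : (x * y) ^ s = x ^ s * y ^ s := by
  rw [cpow_def_of_ne_zero (mul_ne_zero hx hy), cpow_def_of_ne_zero hx, cpow_def_of_ne_zero hy,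
    (log_mul_eq_add_log_iff hx hy).2 ⟨h1, h2⟩, add_mul, Complex.exp_add]

theorem abs_arg_lt_of_re_pos {z : ℂ} (hz : 0 < z.re) : |z.arg| < π / 2 :=
  abs_arg_lt_pi_div_two_iff.2 (Or.inl hz)

theorem ne_zero_of_re_pos' {z : ℂ} (hz : 0 < z.re) : z ≠ 0 := by
  rintro rfl; simp at hz

theorem mul_cpow_of_re_pos {x y : ℂ} (hx : 0 < x.re) (hy : 0 < y.re) (s : ℂ) :
    (x * y) ^ s = x ^ s * y ^ s := by
  have h1 := abs_lt.1 (abs_arg_lt_of_re_pos hx)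
  have h2 := abs_lt.1 (abs_arg_lt_of_re_pos hy)
  exact mul_cpow_of_arg (ne_zero_of_re_pos' hx) (ne_zero_of_re_pos' hy) (by linarith [h1.1, h2.1])
    (by linarith [h1.2, h2.2]) s

theorem I_mul_cpow {z : ℂ} (hz : 0 < z.re) (s : ℂ) : (I * z) ^ s = I ^ s * z ^ s := by
  have h1 := abs_lt.1 (abs_arg_lt_of_re_pos hz)
  have := Real.pi_pos
  exact mul_cpow_of_arg I_ne_zero (ne_zero_of_re_pos' hz) (by rw [arg_I]; linarith [h1.1])
    (by rw [arg_I]; linarith [h1.2]) s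

theorem neg_I_mul_cpow {z : ℂ} (hz : 0 < z.re) (s : ℂ) : (-I * z) ^ s = (-I) ^ s * z ^ s := by
  have h1 := abs_lt.1 (abs_arg_lt_of_re_pos hz)
  have := Real.pi_pos
  exact mul_cpow_of_arg (neg_ne_zero.2 I_ne_zero) (ne_zero_of_re_pos' hz)
    (by rw [arg_neg_I]; linarith [h1.1]) (by rw [arg_neg_I]; linarith [h1.2]) s

theorem sqrt_neg_I : Complex.sqrt (-I) = cexp (-(π * I / 4)) := by
  rw [Complex.sqrt, cpow_def_of_ne_zero (neg_ne_zero.2 I_ne_zero), log_neg_I]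
  congr 1; ring

/-- The Euler function `∏ (1 - x^n)`. -/
def eulerFn (x : ℂ) : ℂ := ∏' n : ℕ, (1 - x ^ (n + 1))

theorem eta_eq_eulerFn (τ : ℂ) :
    ModularForm.eta τ = cexp (π * I * τ / 12) * eulerFn (cexp (2 * π * I * τ)) := by
  rw [ModularForm.eta, eulerFn]
  congr 1
  · rw [Function.Periodic.qParam]; congr 1; push_cast; ring
  · refine tprod_congr fun n => ?_
    rw [ModularForm.eta_q_eq_pow]

theorem eta_add_int (τ : ℂ) (c : ℤ) :
    ModularForm.eta (τ + c) = cexp (π * I * c / 12) * ModularForm.eta τ := by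
  rw [eta_eq_eulerFn, eta_eq_eulerFn, ← mul_assoc, ← Complex.exp_add]
  congr 2
  · ring
  · rw [Complex.exp_eq_exp_iff_exists_int]
    exact ⟨c, by ring⟩

/-- `η(i/z) = √z η(iz)`. -/
theorem eta_I_div {z : ℂ} (hz : 0 < z.re) :
    ModularForm.eta (I / z) = Complex.sqrt z * ModularForm.eta (I * z) := by
  have hz0 := ne_zero_of_re_pos' hz
  have h := ModularForm.eta_comp_eq_csqrt_I_inv (show I * z ∈ UpperHalfPlane.upperHalfPlaneSet by
    simpa [UpperHalfPlane.upperHalfPlaneSet] using hz)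
  simp only [Function.comp_apply, Pi.smul_apply, Pi.mul_apply, smul_eq_mul] at h
  have e : -1 / (I * z) = I / z := by
    field_simp; rw [I_sq]
  rw [e] at h
  rw [h]
  simp only [Complex.sqrt]
  rw [I_mul_cpow hz]
  have : I ^ (2⁻¹ : ℂ) ≠ 0 := by rw [cpow_ne_zero_iff]; simp
  field_simp

/-- The transformation of `η` attached to `(h, h', k)` at the point `z`. -/
def EtaTransform (h h' : ℤ) (k : ℕ) (z : ℂ) : Prop :=
  ModularForm.eta ((h' + I / z) / k)
    = Complex.sqrt z * cexp (π * I * (dedekindSum h k + (h' - h) / (12 * k)))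
      * ModularForm.eta ((h + I * z) / k)

/-- Both arguments of η move by integers; the factors e^(πic/12) and e^(πid/12) are exactly the
change of (h'-h)/(12k), as s(h,k) depends only on h modulo k. -/
theorem EtaTransform.shift {h h' : ℤ} {k : ℕ} (hk : 0 < k) {z : ℂ} (H : EtaTransform h h' k z)
    (c d : ℤ) : EtaTransform (h + c * k) (h' + d * k) k z := by
  have hk' : (k : ℂ) ≠ 0 := by exact_mod_cast hk.ne'
  rw [EtaTransform] at H ⊢
  have e1 : (((h' + d * k : ℤ) : ℂ) + I / z) / k = (h' + I / z) / k + d := by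
    push_cast; rw [div_add' _ _ _ hk']; ring
  have e2 : (((h + c * k : ℤ) : ℂ) + I * z) / k = (h + I * z) / k + c := by
    push_cast; rw [div_add' _ _ _ hk']; ring
  rw [e1, e2, eta_add_int, eta_add_int, H, dedekindSum_add_mul]
  have : cexp (π * I * ((dedekindSum h k : ℝ) + (((h' + d * k : ℤ) : ℂ) - (h + c * k : ℤ)) / (12 * k)))
      = cexp (π * I * d / 12) * cexp (π * I * ((dedekindSum h k : ℝ) + (h' - h) / (12 * k)))
        * cexp (-(π * I * c / 12)) := by
    rw [← Complex.exp_add, ← Complex.exp_add]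
    congr 1
    push_cast
    field_simp
    ring
  rw [this, Complex.exp_neg]
  have := Complex.exp_ne_zero (π * I * c / 12)
  field_simp

/-- The inversion of Euclid's algorithm: applying η(i/v) = √v η(iv) with iv = (h+iz)/k replaces the
pair (h,k) by (-k,h), with w = kz/(h+iz) in the role of z. Reciprocity is what reconciles the two
exponents. -/
theorem EtaTransform.step {h k : ℕ} {h' c : ℤ} (hh : 0 < h) (hk : 0 < k)
    (hc : h * h' + 1 = k * c) {z : ℂ} (hz : 0 < z.re)
    (H : EtaTransform (-k) c h (k * z / (h + I * z))) : EtaTransform h h' k z := by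
  have hz0 := ne_zero_of_re_pos' hz
  have hk' : (k : ℂ) ≠ 0 := by exact_mod_cast hk.ne'
  have hh' : (h : ℂ) ≠ 0 := by exact_mod_cast hh.ne'
  have hkR : (0 : ℝ) < k := by exact_mod_cast hk
  have hhR : (0 : ℝ) < h := by exact_mod_cast hh
  have hu : (z - I * h).re > 0 := by simpa using hz
  have hu0 := ne_zero_of_re_pos' hu
  have hA : (h : ℂ) + I * z = I * (z - I * h) := by
    ring_nf; rw [I_sq]; ring
  have hA0 : (h : ℂ) + I * z ≠ 0 := by rw [hA]; exact mul_ne_zero I_ne_zero hu0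
  have hcop : IsCoprime (h : ℤ) k := ⟨-h', c, by linarith⟩
  have hcop' : Nat.Coprime h k := by exact_mod_cast Int.isCoprime_iff_gcd_eq_one.1 hcop
  set w : ℂ := k * z / (h + I * z) with hw
  have hw0 : w ≠ 0 := div_ne_zero (mul_ne_zero hk' hz0) hA0
  have hwinv : w⁻¹ = (I / k) + h / k * z⁻¹ := by
    rw [hw, inv_div]; field_simp; ring
  -- The right half plane is stable under inversion, and the real part of 1/w = i/k + (h/k)/z can be
  -- read off.
  have hwre : 0 < w.re := by
    have : 0 < (w⁻¹).re := by
      have h1 : ((I : ℂ) / k).re = 0 := by simp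
      have h2 : ((h : ℂ) / k * z⁻¹).re = h / k * (z⁻¹).re := by
        rw [show (h : ℂ) / k = ((h / k : ℝ) : ℂ) by push_cast; rfl, re_ofReal_mul]
      rw [hwinv, add_re, h1, h2, zero_add, inv_re]
      have := normSq_pos.2 hz0
      positivity
    rw [inv_re] at this
    exact (div_pos_iff_of_pos_right (normSq_pos.2 hw0)).1 this
  -- the points at which `η` is evaluated
  have hcC : (h : ℂ) * h' + 1 = k * c := by exact_mod_cast hc
  have p1 : ((c : ℂ) + I / w) / h = (h' + I / z) / k := by
    rw [div_eq_mul_inv I w, hwinv]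
    have : (c : ℂ) = (h * h' + 1) / k := by rw [hcC]; field_simp
    rw [this]
    field_simp
    ring_nf
    rw [I_sq]; ring
  have p2 : (((-k : ℤ) : ℂ) + I * w) / h = I / ((z - I * h) / k) := by
    rw [hw, hA]
    push_cast
    field_simp
    ring_nf
  have p3 : I * ((z - I * h) / k) = ((h : ℤ) + I * z) / k := by
    push_cast; rw [hA]; ring
  have hure : 0 < ((z - I * h) / k).re := by
    rw [div_natCast_re]; positivity
  rw [EtaTransform] at H ⊢
  rw [p1, p2, eta_I_div hure, p3] at H
  rw [H]
  -- The radicands multiply to -iz. The resulting e^(-πi/4) is absorbed by the constant -1/4 of the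
  -- reciprocity law.
  have hs : Complex.sqrt w * Complex.sqrt ((z - I * h) / k)
      = cexp (-(π * I / 4)) * Complex.sqrt z := by
    rw [← sqrt_neg_I]
    simp only [Complex.sqrt]
    rw [← mul_cpow_of_re_pos hwre hure, ← neg_I_mul_cpow hz]
    congr 1
    rw [hw, hA]
    field_simp
    rw [I_sq]; ring
  have hd : dedekindSum (-k) h = -dedekindSum k h :=
    dedekindSum_neg hh (by exact_mod_cast hcop.symm)
  have hrec := dedekindSum_reciprocity hh hk hcop'
  have hexp : cexp (π * I * ((dedekindSum (-k) h : ℝ) + ((c : ℂ) - (-k : ℤ)) / (12 * h)))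
      * cexp (-(π * I / 4))
      = cexp (π * I * ((dedekindSum h k : ℝ) + ((h' : ℂ) - (h : ℤ)) / (12 * k))) := by
    rw [← Complex.exp_add, hd]
    congr 1
    have hrec' : (dedekindSum h k : ℂ) = -1 / 4 + ((h : ℂ) / k + k / h + 1 / (h * k)) / 12
        - (dedekindSum k h : ℝ) := by
      have := congrArg (fun x : ℝ => (x : ℂ)) hrec
      push_cast at this
      rw [eq_sub_iff_add_eq, this]
    rw [hrec']
    have : (c : ℂ) = (h * h' + 1) / k := by rw [hcC]; field_simp
    rw [this]
    push_cast
    field_simp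
    ring
  rw [← hexp]
  linear_combination (cexp (π * I * ((dedekindSum (-k) h : ℝ) + ((c : ℂ) - (-k : ℤ)) / (12 * h)))
    * ModularForm.eta (((h : ℤ) + I * z) / k)) * hs

/-- Euclid's algorithm: reduce h modulo k to m by a shift, then exchange (m,k) for (-k,m), whose
modulus m is smaller. For k = 1 the claim is the inversion formula. -/
theorem etaTransform (k : ℕ) (hk : 0 < k) (h h' : ℤ) (hd : (k : ℤ) ∣ h * h' + 1) {z : ℂ}
    (hz : 0 < z.re) : EtaTransform h h' k z := by
  induction k using Nat.strong_induction_on generalizing h h' z with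
  | _ k ih =>
    rcases eq_or_ne k 1 with rfl | hk1
    · have h0 : EtaTransform 0 0 1 z := by
        rw [EtaTransform]
        simp [dedekindSum, eta_I_div hz]
      simpa using h0.shift one_pos h h'
    · obtain ⟨c, hc⟩ := hd
      have hkpos : (0 : ℤ) < k := by exact_mod_cast hk
      obtain ⟨m, hm⟩ := Int.eq_ofNat_of_zero_le (Int.emod_nonneg h hkpos.ne')
      have hmk : m < k := by
        have := Int.emod_lt_of_pos h hkpos
        omega
      have hdm := Int.emod_add_mul_ediv h k
      have hc' : (m : ℤ) * h' + 1 = k * (c - h / k * h') := by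
        rw [← hm]
        linear_combination hc + h' * hdm
      have hm0 : 0 < m := by
        rcases Nat.eq_zero_or_pos m with rfl | h0
        · exfalso
          have : (k : ℤ) ∣ 1 := ⟨_, by simpa using hc'⟩
          have := Int.le_of_dvd one_pos this
          omega
        · exact h0
      have hw : 0 < ((k : ℂ) * z / (m + I * z)).re := by
        have hz0 := ne_zero_of_re_pos' hz
        have hne : (m : ℂ) + I * z ≠ 0 := by
          intro h0
          have := congrArg Complex.im h0
          simp at this
          exact hz.ne' this
        rw [div_re]
        have : 0 < normSq ((m : ℂ) + I * z) := normSq_pos.2 hne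
        rw [← add_div]
        refine div_pos ?_ this
        simp
        have : (0 : ℝ) < k * z.re * m := by positivity
        nlinarith
      have key := EtaTransform.step hm0 hk hc' hz
        (ih m hmk hm0 (-k) (c - h / k * h') ⟨-h', by linarith⟩ hw)
      have := key.shift hk (h / k) 0
      rw [zero_mul, add_zero, ← hm] at this
      rwa [show h % k + h / k * k = h by linarith] at this

/-- The transformation formula of the generating function `1/∏(1-x^n)` of partitions. -/
theorem eulerFn_transform {k : ℕ} (hk : 0 < k) {h : ℕ} {h' : ℤ} (hd : (k : ℤ) ∣ h * h' + 1) {z : ℂ}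
    (hz : 0 < z.re) :
    eulerFn (cexp (2 * π * I * ((h' + I / z) / k)))
      = omega h k * Complex.sqrt z * cexp (π / (12 * k) * (1 / z - z))
        * eulerFn (cexp (2 * π * I * ((h + I * z) / k))) := by
  have H := etaTransform k hk h h' hd hz
  have hz0 := ne_zero_of_re_pos' hz
  have hk' : (k : ℂ) ≠ 0 := by exact_mod_cast hk.ne'
  rw [EtaTransform, eta_eq_eulerFn, eta_eq_eulerFn] at H
  have hne := Complex.exp_ne_zero (π * I * ((h' + I / z) / k) / 12)
  rw [omega_eq_exp_dedekindSum]
  refine mul_left_cancel₀ hne (H.trans ?_)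
  have : cexp (π * I * ((dedekindSum h k : ℝ) + ((h' : ℂ) - (h : ℤ)) / (12 * k)))
      * cexp (π * I * (((h : ℤ) + I * z) / k) / 12)
      = cexp (π * I * ((h' + I / z) / k) / 12)
        * (cexp (π * I * (dedekindSum h k : ℝ)) * cexp (π / (12 * k) * (1 / z - z))) := by
    rw [← Complex.exp_add, ← Complex.exp_add, ← Complex.exp_add]
    congr 1
    push_cast
    field_simp
    ring_nf
    rw [I_sq]
    ring
  push_cast at this ⊢
  linear_combination (Complex.sqrt z * eulerFn (cexp (2 * π * I * ((h + I * z) / k)))) * this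

end Rademacher

end

/-! ### Formal power series as functions on the unit disc. -/

noncomputable section

namespace Rademacher

open Complex Filter Topology

/-- `g` is the sum of the power series `a` in the open unit disc. -/
def IsSumOnDisc (a : PowerSeries ℂ) (g : ℂ → ℂ) : Prop :=
  ∀ x : ℂ, ‖x‖ < 1 → HasSum (fun n => PowerSeries.coeff n a * x ^ n) (g x)

namespace IsSumOnDisc

variable {a b : PowerSeries ℂ} {g g₁ : ℂ → ℂ}

theorem mul (ha : IsSumOnDisc a g) (hb : IsSumOnDisc b g₁) :
    IsSumOnDisc (a * b) (fun x => g x * g₁ x) := by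
  intro x hx
  have h1 := (ha x hx).summable.norm
  have h2 := (hb x hx).summable.norm
  have h3 := summable_norm_sum_mul_antidiagonal_of_summable_norm h1 h2
  have h4 := tsum_mul_tsum_eq_tsum_sum_antidiagonal_of_summable_norm h1 h2
  rw [(ha x hx).tsum_eq, (hb x hx).tsum_eq] at h4
  have e : ∀ n, ∑ kl ∈ Finset.HasAntidiagonal.antidiagonal n, PowerSeries.coeff kl.1 a * x ^ kl.1
      * (PowerSeries.coeff kl.2 b * x ^ kl.2) = PowerSeries.coeff n (a * b) * x ^ n := by
    intro n
    rw [PowerSeries.coeff_mul, Finset.sum_mul]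
    refine Finset.sum_congr rfl fun p hp => ?_
    rw [← Finset.HasAntidiagonal.mem_antidiagonal.1 hp, pow_add]; ring
  simp only [e] at h3 h4
  simp only [h4]
  exact h3.of_norm.hasSum

theorem expand (ha : IsSumOnDisc a g) {p : ℕ} (hp : p ≠ 0) :
    IsSumOnDisc (PowerSeries.expand p hp a) (fun x => g (x ^ p)) := by
  intro x hx
  have h := ha (x ^ p) (by rw [norm_pow]; exact pow_lt_one₀ (norm_nonneg _) hx hp)
  have hinj : Function.Injective (fun n : ℕ => p * n) := fun m n e =>
    Nat.eq_of_mul_eq_mul_left (Nat.pos_of_ne_zero hp) e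
  rw [← hinj.hasSum_iff]
  · refine h.congr_fun ?_
    intro n
    simp [PowerSeries.coeff_expand_mul, pow_mul]
  · intro n hn
    rw [PowerSeries.coeff_expand_of_not_dvd, zero_mul]
    rintro ⟨m, rfl⟩
    exact hn ⟨m, rfl⟩

theorem hasFPowerSeriesOnBall (ha : IsSumOnDisc a g) :
    HasFPowerSeriesOnBall g
      (FormalMultilinearSeries.ofScalars ℂ (fun n => PowerSeries.coeff n a)) 0 1 where
  r_le := by
    refine ENNReal.le_of_forall_nnreal_lt fun r hr => ?_
    refine FormalMultilinearSeries.le_radius_of_summable _ ?_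
    have hr' : (r : ℝ) < 1 := by exact_mod_cast hr
    have := (ha (r : ℂ) (by simpa using hr')).summable.norm
    refine this.congr fun n => ?_
    rw [FormalMultilinearSeries.ofScalars_norm]
    simp
  r_pos := one_pos
  hasSum := by
    intro y hy
    have hy' : ‖y‖ < 1 := by simpa [← ofReal_norm] using hy
    have := ha y hy'
    simpa [FormalMultilinearSeries.ofScalars_apply_eq, mul_comm] using this

theorem unique (ha : IsSumOnDisc a g) (hb : IsSumOnDisc b g) : a = b := by
  have h := ha.hasFPowerSeriesOnBall.hasFPowerSeriesAt.eq_formalMultilinearSeries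
    hb.hasFPowerSeriesOnBall.hasFPowerSeriesAt
  have h := FormalMultilinearSeries.ofScalars_series_injective (𝕜 := ℂ) ℂ h
  ext n
  exact congrFun h n

theorem congr (ha : IsSumOnDisc a g) (h : ∀ x, ‖x‖ < 1 → g x = g₁ x) : IsSumOnDisc a g₁ :=
  fun x hx => h x hx ▸ ha x hx

theorem differentiableOn (ha : IsSumOnDisc a g) : DifferentiableOn ℂ g (Metric.ball 0 1) := by
  have := ha.hasFPowerSeriesOnBall.differentiableOn
  rwa [← ENNReal.ofReal_one, Metric.eball_ofReal] at this

theorem one : IsSumOnDisc 1 (fun _ => 1) := by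
  intro x _
  have := hasSum_single (f := fun n => PowerSeries.coeff n (1 : PowerSeries ℂ) * x ^ n) 0
    (fun n hn => by simp [PowerSeries.coeff_one, hn])
  simpa using this

theorem one_sub_X_pow (m : ℕ) :
    IsSumOnDisc (1 - PowerSeries.X ^ m) (fun x => 1 - x ^ m) := by
  intro x hx
  have h1 := one x hx
  have h2 := hasSum_single (f := fun n => PowerSeries.coeff n
    (PowerSeries.X ^ m : PowerSeries ℂ) * x ^ n) m
    (fun n hn => by simp [PowerSeries.coeff_X_pow, hn])
  have := h1.sub h2
  simpa [PowerSeries.coeff_X_pow, sub_mul] using this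

theorem prod_one_sub_X_pow (s : Finset ℕ) :
    IsSumOnDisc (∏ n ∈ s, (1 - PowerSeries.X ^ (n + 1))) (fun x => ∏ n ∈ s, (1 - x ^ (n + 1))) := by
  classical
  induction s using Finset.induction_on with
  | empty => simpa using one
  | insert m s hm ih =>
    simp only [Finset.prod_insert hm]
    exact (one_sub_X_pow (m + 1)).mul ih

end IsSumOnDisc

theorem isSumOnDisc_taylor {g : ℂ → ℂ} (hg : DifferentiableOn ℂ g (Metric.ball 0 1)) :
    IsSumOnDisc (PowerSeries.mk fun n => (n.factorial : ℂ)⁻¹ * iteratedDeriv n g 0) g := by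
  intro x hx
  have := hasSum_taylorSeries_on_ball hg (z := x) (by simpa using hx)
  refine this.congr_fun ?_
  intro n
  simp
  ring

theorem IsSumOnDisc.coeff_eq {a : PowerSeries ℂ} {g : ℂ → ℂ} (ha : IsSumOnDisc a g) (n : ℕ) :
    PowerSeries.coeff n a = (n.factorial : ℂ)⁻¹ * iteratedDeriv n g 0 := by
  rw [ha.unique (isSumOnDisc_taylor ha.differentiableOn), PowerSeries.coeff_mk]

theorem tendstoLocallyUniformlyOn_iteratedDeriv {ι : Type*} {φ : Filter ι} {F : ι → ℂ → ℂ}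
    {g : ℂ → ℂ} {U : Set ℂ} (hU : IsOpen U) (hF : ∀ i, DifferentiableOn ℂ (F i) U)
    (h : TendstoLocallyUniformlyOn F g φ U) (n : ℕ) :
    TendstoLocallyUniformlyOn (fun i => iteratedDeriv n (F i)) (iteratedDeriv n g) φ U := by
  have hd : ∀ (n : ℕ) (i : ι), DifferentiableOn ℂ (iteratedDeriv n (F i)) U := by
    intro n i
    induction n with
    | zero => simpa using hF i
    | succ n ih => rw [iteratedDeriv_succ]; exact ih.deriv hU
  induction n with
  | zero => simpa using h
  | succ n ih =>
    have := ih.deriv (Eventually.of_forall (hd n)) hU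
    simp only [iteratedDeriv_succ]
    exact this

/-- `pentagonalSeries` serves only as the formal product of the 1 - X^(n+1). The n-th coefficient of
the finite products is eventually constant formally, and converges to the Taylor coefficient of
`eulerFn` because locally uniform limits commute with derivatives. -/
theorem isSumOnDisc_eulerFn : IsSumOnDisc (PowerSeries.pentagonalSeries ℂ) eulerFn := by
  have hdiff : DifferentiableOn ℂ eulerFn (Metric.ball 0 1) :=
    ModularForm.differentiableOn_tprod_one_sub_pow
  have h := ModularForm.multipliableLocallyUniformlyOn_one_sub_pow.hasProdLocallyUniformlyOn
  rw [hasProdLocallyUniformlyOn_iff_tendstoLocallyUniformlyOn] at h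
  have hT := isSumOnDisc_taylor hdiff
  convert hT using 1
  ext n
  rw [PowerSeries.coeff_mk]
  have hn := tendstoLocallyUniformlyOn_iteratedDeriv Metric.isOpen_ball (fun s => by
    have := (IsSumOnDisc.prod_one_sub_X_pow s).differentiableOn
    exact this) h n
  have h0 := (hn.tendsto_at (Metric.mem_ball_self one_pos)).const_mul ((n.factorial : ℂ)⁻¹)
  have e := PowerSeries.coeff_prod_one_sub_X_pow_eventually_eq ℂ n
  refine tendsto_nhds_unique (tendsto_const_nhds.congr' ?_) h0
  filter_upwards [e] with s hs
  rw [← hs, (IsSumOnDisc.prod_one_sub_X_pow s).coeff_eq n]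

theorem eulerFn_ne_zero {x : ℂ} (hx : ‖x‖ < 1) : eulerFn x ≠ 0 := by
  have hs : Summable fun n : ℕ => ‖-x ^ (n + 1)‖ := by
    simpa [summable_nat_add_iff] using summable_geometric_of_lt_one (norm_nonneg x) hx
  have := tprod_one_add_ne_zero_of_summable (f := fun n : ℕ => -x ^ (n + 1)) (fun n h0 => ?_) hs
  · simpa [eulerFn, sub_eq_add_neg] using this
  · have h1 : x ^ (n + 1) = 1 := by linear_combination -h0
    have h2 := congrArg norm h1
    rw [norm_pow, norm_one] at h2
    exact absurd h2 (pow_lt_one₀ (norm_nonneg _) hx (Nat.succ_ne_zero n)).ne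

/-! ### Product identities behind p_0, p_1 and p_2. -/

section formal

open PowerSeries PowerSeries.WithPiTopology

theorem hasProd_expand {ι : Type*} {F : ι → PowerSeries ℂ} {a : PowerSeries ℂ}
    (h : HasProd F a) {p : ℕ} (hp : p ≠ 0) :
    HasProd (fun i => PowerSeries.expand p hp (F i)) (PowerSeries.expand p hp a) := by
  rw [HasProd, tendsto_iff_coeff_tendsto] at h ⊢
  intro d
  simp only [← map_prod, PowerSeries.coeff_expand]
  split_ifs with hd
  · exact h _
  · exact tendsto_const_nhds

theorem tsum_X_pow_mul_one_sub {i : ℕ} (hi : i ≠ 0) :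
    (∑' j : ℕ, (X : PowerSeries ℂ) ^ (i * (j + 1))) * (1 - X ^ i) = X ^ i := by
  have h0 : constantCoeff ((X : PowerSeries ℂ) ^ i) = 0 := by simp [hi]
  have h := tsum_pow_mul_one_sub_of_constantCoeff_eq_zero h0
  have hs := summable_pow_of_constantCoeff_eq_zero h0
  have e : (∑' j : ℕ, (X : PowerSeries ℂ) ^ (i * (j + 1))) = X ^ i * ∑' j : ℕ, (X ^ i) ^ j := by
    rw [← hs.tsum_mul_left]
    refine tsum_congr fun j => ?_
    rw [← pow_mul, ← pow_add]; ring_nf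
  rw [e, mul_assoc, h, mul_one]

theorem f_eq_genFun : f = Nat.Partition.genFun (fun _ _ => (1 : ℂ)) := by
  ext n
  simp [f, numPartitions, Finsupp.prod]

/-- Euler's product, factor by factor: the geometric series in X^i times 1 - X^i is 1. -/
theorem f_mul_pentagonalSeries : f * pentagonalSeries ℂ = 1 := by
  have h := (Nat.Partition.hasProd_genFun (fun _ _ => (1 : ℂ))).mul (hasProd_one_sub_X_pow ℂ)
  rw [← f_eq_genFun] at h
  refine h.unique ?_
  have : (fun i : ℕ => (1 + ∑' j : ℕ, (1 : ℂ) • (X : PowerSeries ℂ) ^ ((i + 1) * (j + 1)))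
      * (1 - X ^ (i + 1))) = fun _ => 1 := by
    ext1 i
    simp only [one_smul]
    rw [add_mul, tsum_X_pow_mul_one_sub i.add_one_ne_zero]
    ring
  rw [this]
  exact hasProd_one

theorem fr_eq (r : ℕ) : fr r = f * PowerSeries.expand (2 ^ r) (pow_ne_zero r two_ne_zero) f
    * PowerSeries.expand 2 two_ne_zero (pentagonalSeries ℂ) := by
  have h : PowerSeries.expand 2 two_ne_zero f
      * PowerSeries.expand 2 two_ne_zero (pentagonalSeries ℂ) = 1 := by
    rw [← map_mul, f_mul_pentagonalSeries, map_one]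
  rw [fr]
  congr 1
  rw [PowerSeries.inv_eq_iff_mul_eq_one, mul_comm, h]
  intro h0
  have := congrArg constantCoeff h
  simp [h0] at this

theorem hasProd_genFun_one_sub (w : ℕ → ℕ → ℂ) :
    HasProd (fun i : ℕ => (1 + ∑' j : ℕ, w (i + 1) (j + 1) • (X : PowerSeries ℂ) ^ ((i + 1) * (j + 1)))
      * (1 - X ^ (i + 1))) (Nat.Partition.genFun w * pentagonalSeries ℂ) :=
  (Nat.Partition.hasProd_genFun w).mul (hasProd_one_sub_X_pow ℂ)

/-- A partition with d distinct part sizes has 2^d overlinings, so each part size present carries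
weight 2. -/
theorem numOverpartitions_eq (n : ℕ) :
    (numOverpartitions n : ℂ) = coeff n (Nat.Partition.genFun (fun _ _ => (2 : ℂ))) := by
  rw [Nat.Partition.coeff_genFun, numOverpartitions, overpartitions, Finset.card_sigma]
  push_cast
  refine Finset.sum_congr rfl fun l _ => ?_
  simp [Finset.card_powerset, Finsupp.prod]

/-- The factor of the generating function at i is (1+X^i)/(1-X^i); times (1-X^i)² it is 1 - X^(2i),
the factor of the product in X². -/
theorem pr_zero (n : ℕ) : pr 0 n = numOverpartitions n := by
  rw [numOverpartitions_eq, pr]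
  congr 1
  have h := (hasProd_genFun_one_sub (fun _ _ => 2)).mul (hasProd_one_sub_X_pow ℂ)
  have h2 := hasProd_expand (hasProd_one_sub_X_pow ℂ) two_ne_zero
  have e : Nat.Partition.genFun (fun _ _ => (2 : ℂ)) * pentagonalSeries ℂ * pentagonalSeries ℂ
      = PowerSeries.expand 2 two_ne_zero (pentagonalSeries ℂ) := by
    refine h.unique ?_
    convert h2 using 1
    ext1 i
    have hs := Nat.Partition.summable_genFun_term (fun _ _ => (1 : ℂ)) i
    simp only [one_smul] at hs
    have : ∑' j : ℕ, (2 : ℂ) • (X : PowerSeries ℂ) ^ ((i + 1) * (j + 1))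
        = 2 * ∑' j : ℕ, (X : PowerSeries ℂ) ^ ((i + 1) * (j + 1)) := by
      rw [← hs.tsum_mul_left]
      refine tsum_congr fun j => ?_
      rw [two_smul, two_mul]
    rw [this, add_mul, mul_assoc, tsum_X_pow_mul_one_sub i.add_one_ne_zero]
    simp only [map_sub, map_one, map_pow, PowerSeries.expand_X]
    ring
  have hone : PowerSeries.expand (2 ^ 0) (pow_ne_zero 0 two_ne_zero) f = f := by
    simp
  rw [fr_eq, hone, ← e]
  linear_combination (Nat.Partition.genFun (fun _ _ => (2 : ℂ))) *
    (f * pentagonalSeries ℂ + 1) * f_mul_pentagonalSeries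

theorem pr_one (n : ℕ) : pr 1 n = numPartitions n := by
  have : fr 1 = f := by
    rw [fr_eq]
    have h : PowerSeries.expand (2 ^ 1) (pow_ne_zero 1 two_ne_zero) f
        * PowerSeries.expand 2 two_ne_zero (pentagonalSeries ℂ) = 1 := by
      simp only [pow_one]
      rw [← map_mul, f_mul_pentagonalSeries, map_one]
    rw [mul_assoc, h, mul_one]
  rw [pr, this, f, coeff_mk]

open Classical in
theorem pod_eq (n : ℕ) : (pod n : ℂ)
    = coeff n (Nat.Partition.genFun (fun i c => if Odd i → c ≤ 1 then (1 : ℂ) else 0)) := by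
  rw [Nat.Partition.coeff_genFun, pod, Finset.card_filter]
  push_cast
  refine Finset.sum_congr rfl fun l _ => ?_
  rw [Finsupp.prod, Finset.prod_boole]
  simp

/-- The factor is 1 + X^i for odd i and 1/(1-X^i) for even i. After multiplication by 1 - X^i it is
1 - X^(2i) for odd i and 1 for even i; the product in X⁴ supplies the missing 1 - X^(2i) at even i.
-/
theorem pr_two (n : ℕ) : pr 2 n = pod n := by
  classical
  rw [pod_eq, pr]
  congr 1
  set G := Nat.Partition.genFun (fun i c => if Odd i → c ≤ 1 then (1 : ℂ) else 0) with hG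
  have h := hasProd_genFun_one_sub (fun i c => if Odd i → c ≤ 1 then (1 : ℂ) else 0)
  rw [← hG] at h
  have h2 := hasProd_expand (hasProd_one_sub_X_pow ℂ) two_ne_zero
  have h4 := hasProd_expand (hasProd_one_sub_X_pow ℂ) (show 2 ^ 2 ≠ 0 by norm_num)
  have ho : ∀ i : ℕ, (1 + ∑' j : ℕ, (if Odd (i + 1) → j + 1 ≤ 1 then (1 : ℂ) else 0)
      • (X : PowerSeries ℂ) ^ ((i + 1) * (j + 1))) * (1 - X ^ (i + 1))
      = if Odd (i + 1) then 1 - X ^ (2 * (i + 1)) else 1 := by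
    intro i
    by_cases hi : Odd (i + 1)
    · rw [tsum_eq_single 0]
      · simp [hi]; ring
      · intro j hj
        have : ¬ (j + 1 ≤ 1) := by omega
        simp [hi, hj]
    · simp only [hi, false_imp_iff, if_true, one_smul, if_false]
      rw [add_mul, tsum_X_pow_mul_one_sub i.add_one_ne_zero]
      ring
  simp only [ho] at h
  -- The index i stands for part size i + 1, so the even sizes sit at i = 2m + 1.
  have h4' : HasProd (fun i : ℕ => if Odd (i + 1) then (1 : PowerSeries ℂ)
      else 1 - X ^ (2 * (i + 1)))
      (PowerSeries.expand (2 ^ 2) (show 2 ^ 2 ≠ 0 by norm_num) (pentagonalSeries ℂ)) := by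
    have hinj : Function.Injective (fun m : ℕ => 2 * m + 1) := fun a b e => by
      simpa using e
    rw [← hinj.hasProd_iff]
    · convert h4 using 1
      ext1 m
      have : ¬ Odd (2 * m + 1 + 1) := by
        rw [Nat.not_odd_iff_even]; exact ⟨m + 1, by ring⟩
      simp only [Function.comp_apply, this, if_false, map_sub, map_one, map_pow,
        PowerSeries.expand_X]
      rw [← pow_mul]; ring_nf
    · intro i hi
      rw [if_pos]
      rcases Nat.even_or_odd i with he | he
      · exact he.add_one
      · obtain ⟨m, rfl⟩ := he
        exact absurd ⟨m, rfl⟩ hi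
  have e : G * pentagonalSeries ℂ
      * PowerSeries.expand (2 ^ 2) (show 2 ^ 2 ≠ 0 by norm_num) (pentagonalSeries ℂ)
      = PowerSeries.expand 2 two_ne_zero (pentagonalSeries ℂ) := by
    refine (h.mul h4').unique ?_
    convert h2 using 1
    ext1 i
    simp only [map_sub, map_one, map_pow, PowerSeries.expand_X]
    split_ifs <;> simp [pow_mul]
  have h3 : PowerSeries.expand (2 ^ 2) (show 2 ^ 2 ≠ 0 by norm_num) f
      * PowerSeries.expand (2 ^ 2) (show 2 ^ 2 ≠ 0 by norm_num) (pentagonalSeries ℂ) = 1 := by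
    rw [← map_mul, f_mul_pentagonalSeries, map_one]
  rw [fr_eq, ← e]
  linear_combination (G * f * pentagonalSeries ℂ) * h3 + G * f_mul_pentagonalSeries

end formal

/-- The Taylor series of 1/`eulerFn` and `f` are both formal inverses of `pentagonalSeries`, hence
equal. -/
theorem isSumOnDisc_f : IsSumOnDisc f (fun x => (eulerFn x)⁻¹) := by
  have hd : DifferentiableOn ℂ (fun x => (eulerFn x)⁻¹) (Metric.ball 0 1) :=
    isSumOnDisc_eulerFn.differentiableOn.inv fun x hx => eulerFn_ne_zero (by simpa using hx)
  have h1 := isSumOnDisc_taylor hd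
  set b := PowerSeries.mk fun n => (n.factorial : ℂ)⁻¹
    * iteratedDeriv n (fun x => (eulerFn x)⁻¹) 0 with hb
  have h2 : b * PowerSeries.pentagonalSeries ℂ = 1 :=
    ((h1.mul isSumOnDisc_eulerFn).congr fun x hx => inv_mul_cancel₀ (eulerFn_ne_zero hx)).unique
      IsSumOnDisc.one
  have : f = b := by
    linear_combination (-f) * h2 + b * f_mul_pentagonalSeries
  rwa [this]

/-- The analytic function `f_r` in the unit disc. -/
def frFn (r : ℕ) (x : ℂ) : ℂ := eulerFn (x ^ 2) / (eulerFn x * eulerFn (x ^ 2 ^ r))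

theorem isSumOnDisc_fr (r : ℕ) : IsSumOnDisc (fr r) (frFn r) := by
  rw [fr_eq]
  refine ((isSumOnDisc_f.mul (isSumOnDisc_f.expand _)).mul
    (isSumOnDisc_eulerFn.expand _)).congr fun x _ => ?_
  rw [frFn, div_eq_mul_inv, mul_inv, mul_comm]

end Rademacher

end

/-! ### The function f_r near a root of unity of order k. -/

noncomputable section

namespace Rademacher

open Complex Real

theorem exists_norm_sub_le_of_differentiableOn_disc {g : ℂ → ℂ}
    (hg : DifferentiableOn ℂ g (Metric.ball 0 1)) {ρ : ℝ} (hρ0 : 0 ≤ ρ) (hρ : ρ < 1) :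
    ∃ K, 0 ≤ K ∧ ∀ x, ‖x‖ ≤ ρ → ‖g x - g 0‖ ≤ K * ‖x‖ := by
  have hsub : Metric.closedBall (0 : ℂ) ρ ⊆ Metric.ball 0 1 := Metric.closedBall_subset_ball hρ
  have hc : ContinuousOn (deriv g) (Metric.closedBall 0 ρ) :=
    (hg.deriv Metric.isOpen_ball).continuousOn.mono hsub
  obtain ⟨K, hK⟩ := (isCompact_closedBall (0 : ℂ) ρ).exists_bound_of_continuousOn hc
  have h0 : (0 : ℂ) ∈ Metric.closedBall (0 : ℂ) ρ := Metric.mem_closedBall_self hρ0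
  refine ⟨K, (norm_nonneg _).trans (hK 0 h0), fun x hx => ?_⟩
  have := (convex_closedBall (0 : ℂ) ρ).norm_image_sub_le_of_norm_deriv_le (f := g) (C := K)
    (fun y hy => hg.differentiableAt (Metric.isOpen_ball.mem_nhds (hsub hy))) hK h0
    (by simpa using hx : x ∈ Metric.closedBall (0 : ℂ) ρ)
  simpa using this

theorem eulerFn_zero : eulerFn 0 = 1 := by simp [eulerFn]

theorem norm_omega (h k : ℕ) : ‖omega h k‖ = 1 := by
  rw [omega_eq_exp_dedekindSum, Complex.norm_exp]
  simp

theorem omega_ne_zero (h k : ℕ) : omega h k ≠ 0 := by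
  rw [← norm_ne_zero_iff, norm_omega]; exact one_ne_zero

theorem sqrt_ofReal_mul {c : ℝ} (hc : 0 < c) {z : ℂ} (hz : 0 < z.re) :
    Complex.sqrt (c * z) = (√c : ℝ) * Complex.sqrt z := by
  have : Complex.sqrt (c : ℂ) = (√c : ℝ) := by
    rw [Complex.sqrt, Real.sqrt_eq_rpow, ofReal_cpow hc.le]
    norm_num
  rw [← this, Complex.sqrt, Complex.sqrt, Complex.sqrt, mul_cpow_of_re_pos (by simpa using hc) hz]

theorem sqrt_ne_zero_of_re_pos {z : ℂ} (hz : 0 < z.re) : Complex.sqrt z ≠ 0 := by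
  rw [Complex.sqrt, cpow_ne_zero_iff]
  exact Or.inl (ne_zero_of_re_pos' hz)

theorem inv_re_pos {z : ℂ} (hz : 0 < z.re) : 0 < (z⁻¹).re := by
  rw [inv_re]; exact div_pos hz (normSq_pos.2 (ne_zero_of_re_pos' hz))

/-- Behaviour of `∏(1-x^(mn))` near a root of unity of order `k`. -/
theorem eulerFn_pow_transform {m k h : ℕ} (hm : 0 < m) (hk : 0 < k) (hc : Nat.Coprime h k) {z : ℂ}
    (hz : 0 < z.re) :
    ∃ x : ℂ, ‖x‖ = rexp (-(2 * π * ((Nat.gcd m k : ℝ) ^ 2 / m) * ((z⁻¹).re / k))) ∧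
      eulerFn x = omega (m / Nat.gcd m k * h) (k / Nat.gcd m k)
        * ((√(m / Nat.gcd m k) : ℝ) * Complex.sqrt z)
        * cexp (π / 12 * ((Nat.gcd m k : ℝ) ^ 2 / m * (z⁻¹ / k) - m * (z / k)))
        * eulerFn (cexp (2 * π * I * ((h + I * z) / k)) ^ m) := by
  obtain ⟨m', hm'⟩ := Nat.gcd_dvd_left m k
  obtain ⟨k', hk'⟩ := Nat.gcd_dvd_right m k
  have hg : 0 < Nat.gcd m k := Nat.gcd_pos_of_pos_left k hm
  set g := Nat.gcd m k with hgdef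
  have hcop : Nat.Coprime m' k' := by
    have := Nat.coprime_div_gcd_div_gcd hg
    rw [← hgdef] at this
    rwa [hm', hk', Nat.mul_div_cancel_left _ hg, Nat.mul_div_cancel_left _ hg] at this
  have hm'0 : 0 < m' := Nat.pos_of_ne_zero (by rintro rfl; omega)
  have hk'0 : 0 < k' := Nat.pos_of_ne_zero (by rintro rfl; omega)
  have hmd : m / g = m' := by rw [hm', Nat.mul_div_cancel_left _ hg]
  have hkd : k / g = k' := by rw [hk', Nat.mul_div_cancel_left _ hg]
  have hcop2 : Nat.Coprime (m' * h) k' := by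
    refine Nat.Coprime.mul_left hcop (Nat.Coprime.coprime_dvd_right ⟨g, ?_⟩ hc)
    rw [hk']; ring
  obtain ⟨u, v, huv⟩ := Nat.isCoprime_iff_coprime.2 hcop2
  have hd : (k' : ℤ) ∣ ((m' * h : ℕ) : ℤ) * (-u) + 1 := ⟨v, by push_cast at huv ⊢; linarith⟩
  have hz' : 0 < ((m' : ℂ) * z).re := by
    rw [← ofReal_natCast, re_ofReal_mul]; positivity
  have hz0 := ne_zero_of_re_pos' hz
  -- In lowest terms mh/k = m'h/k', so the m-th power of the point is near a root of unity of order
  -- k': the transformation is used for (m'h, k') at m'z.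
  have H := eulerFn_transform hk'0 hd hz'
  have hmC : (m : ℂ) = g * m' := by exact_mod_cast hm'
  have hkC : (k : ℂ) = g * k' := by exact_mod_cast hk'
  have hmR : (m : ℝ) = g * m' := by exact_mod_cast hm'
  have hkR : (k : ℝ) = g * k' := by exact_mod_cast hk'
  have hgC : (g : ℂ) ≠ 0 := by exact_mod_cast hg.ne'
  have hm'C : (m' : ℂ) ≠ 0 := by exact_mod_cast hm'0.ne'
  have hk'C : (k' : ℂ) ≠ 0 := by exact_mod_cast hk'0.ne'
  have hgR : (g : ℝ) ≠ 0 := by exact_mod_cast hg.ne'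
  have hm'R : (m' : ℝ) ≠ 0 := by exact_mod_cast hm'0.ne'
  have hk'R : (k' : ℝ) ≠ 0 := by exact_mod_cast hk'0.ne'
  refine ⟨_, ?_, H.trans ?_⟩
  · rw [Complex.norm_exp]
    congr 1
    have e : 2 * π * I * (((-u : ℤ) + I / (m' * z)) / k')
        = ((-(2 * π / (m' * k')) : ℝ) : ℂ) * z⁻¹ + ((-(2 * π * u / k') : ℝ) : ℂ) * I := by
      push_cast
      field_simp
      ring_nf
      rw [I_sq]
      ring
    rw [e, add_re, re_ofReal_mul, re_ofReal_mul, I_re, hmR, hkR]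
    field_simp
    ring
  · rw [hmd, hkd, ← Complex.exp_nat_mul]
    have e1 : Complex.sqrt (m' * z) = (√(m / g) : ℝ) * Complex.sqrt z := by
      have : (m : ℝ) / g = m' := by rw [hmR]; field_simp
      rw [this, ← sqrt_ofReal_mul (by positivity) hz, ofReal_natCast]
    have e2 : (m : ℂ) * (2 * π * I * ((h + I * z) / k))
        = 2 * π * I * (((m' * h : ℕ) + I * (m' * z)) / k') := by
      rw [hmC, hkC]; push_cast; field_simp
    have e3 : (π : ℂ) / 12 * ((g : ℝ) ^ 2 / m * (z⁻¹ / k) - m * (z / k))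
        = π / (12 * k') * (1 / (m' * z) - m' * z) := by
      rw [hmC, hkC]; push_cast; field_simp
    rw [e1, e2, e3]

/-- The exponent of the leading term of `f_r` at the fractions with denominator `k`. -/
def polarCoeff (r k : ℕ) : ℝ :=
  1 + (Nat.gcd (2 ^ r) k : ℝ) ^ 2 / 2 ^ r - (Nat.gcd 2 k : ℝ) ^ 2 / 2

/-- The absolute value of the leading coefficient of `f_r` at the fractions with denominator `k`. -/
def scaleFactor (r k : ℕ) : ℝ := √(2 ^ r / Nat.gcd (2 ^ r) k) / √(2 / Nat.gcd 2 k)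

/-- The root of unity occurring in the leading coefficient of `f_r` at `h/k`. -/
def multiplier (r h k : ℕ) : ℂ :=
  omega h k * omega (2 ^ r / Nat.gcd (2 ^ r) k * h) (k / Nat.gcd (2 ^ r) k)
    / omega (2 / Nat.gcd 2 k * h) (k / Nat.gcd 2 k)

theorem norm_multiplier (r h k : ℕ) : ‖multiplier r h k‖ = 1 := by
  simp [multiplier, norm_omega]

theorem gcd_two_pow_bounds (r k : ℕ) :
    (1 : ℝ) ≤ Nat.gcd (2 ^ r) k ∧ (Nat.gcd (2 ^ r) k : ℝ) ≤ 2 ^ r := by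
  constructor
  · exact_mod_cast Nat.gcd_pos_of_pos_left k (by positivity)
  · exact_mod_cast Nat.gcd_le_left k (show 0 < 2 ^ r by positivity)

theorem scaleFactor_nonneg (r k : ℕ) : 0 ≤ scaleFactor r k := by
  rw [scaleFactor]; positivity

theorem gcd_two_bounds (k : ℕ) : (1 : ℝ) ≤ Nat.gcd 2 k ∧ (Nat.gcd 2 k : ℝ) ≤ 2 := by
  simpa using gcd_two_pow_bounds 1 k

theorem scaleFactor_le {r : ℕ} (hr : r ≤ 4) (k : ℕ) : scaleFactor r k ≤ 4 := by
  obtain ⟨h1, -⟩ := gcd_two_pow_bounds r k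
  obtain ⟨h3, h4⟩ := gcd_two_bounds k
  have h5 : (2 : ℝ) ^ r ≤ 2 ^ 4 := pow_le_pow_right₀ (by norm_num) hr
  have h6 : √(2 ^ r / Nat.gcd (2 ^ r) k) ≤ 4 := by
    rw [Real.sqrt_le_left (by norm_num)]
    rw [div_le_iff₀ (by linarith)]
    nlinarith
  have h7 : 1 ≤ √(2 / (Nat.gcd 2 k : ℝ)) := by
    rw [Real.one_le_sqrt, le_div_iff₀ (by linarith)]; linarith
  rw [scaleFactor, div_le_iff₀ (by linarith)]
  nlinarith

/-- The three bounds by 24c let the first correction e^(-2πcy) of each Euler product beat the growth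
e^(πay/12) of the leading term. The bound by 24 is the critical one: for 2^r dividing k, with r ≥ 1,
the left side is 2^r - 1. The lower bounds 1/16 keep all points in one fixed disc. -/
theorem polarCoeff_le {r : ℕ} (hr : r ≤ 4) (k : ℕ) :
    polarCoeff r k ≤ 24 * 1 ∧ polarCoeff r k ≤ 24 * ((Nat.gcd 2 k : ℝ) ^ 2 / 2) ∧
      polarCoeff r k ≤ 24 * ((Nat.gcd (2 ^ r) k : ℝ) ^ 2 / 2 ^ r) ∧
      1 / 16 ≤ (Nat.gcd 2 k : ℝ) ^ 2 / 2 ∧ 1 / 16 ≤ (Nat.gcd (2 ^ r) k : ℝ) ^ 2 / 2 ^ r := by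
  obtain ⟨h1, h2⟩ := gcd_two_pow_bounds r k
  obtain ⟨h3, h4⟩ := gcd_two_bounds k
  have h5 : (2 : ℝ) ^ r ≤ 16 := by
    have : (2 : ℝ) ^ r ≤ 2 ^ 4 := pow_le_pow_right₀ (by norm_num) hr
    linarith
  have h6 : (0 : ℝ) < 2 ^ r := by positivity
  rw [polarCoeff]
  set s := (Nat.gcd (2 ^ r) k : ℝ) ^ 2 / 2 ^ r with hs
  have hs1 : 1 / 16 ≤ s := by
    rw [hs, le_div_iff₀ h6]; nlinarith
  have hs2 : s ≤ 16 := by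
    rw [hs, div_le_iff₀ h6]; nlinarith
  -- A large `s` needs even k, and then the second bound has the larger right side 48.
  have hs3 : Nat.gcd 2 k = 2 ∨ s ≤ 1 := by
    rcases Nat.even_or_odd k with he | ho
    · exact Or.inl (Nat.gcd_eq_left he.two_dvd)
    · right
      have : Nat.gcd (2 ^ r) k = 1 := (Nat.coprime_two_left.2 ho).pow_left r
      rw [hs, this, div_le_one h6]
      have := one_le_pow₀ (n := r) (one_le_two (α := ℝ))
      simpa using this
  refine ⟨by nlinarith, ?_, by nlinarith, by nlinarith, hs1⟩
  rcases hs3 with h | h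
  · rw [h]; push_cast; linarith
  · nlinarith

theorem norm_sqrt_complex (w : ℂ) : ‖Complex.sqrt w‖ = √‖w‖ := by
  rcases eq_or_ne w 0 with rfl | hw
  · simp [Complex.sqrt]
  have h : Complex.sqrt w ^ 2 = w := by
    rw [Complex.sqrt, ← Complex.cpow_nat_mul]; norm_num
  rw [eq_comm, Real.sqrt_eq_iff_mul_self_eq (norm_nonneg _) (norm_nonneg _), ← sq, ← norm_pow, h]

/-- The Euler products of x, x², x^(2^r) are transformed at z = kw. Two stand in the denominator of
f_r and one in the numerator, so a single √(kw) survives and the exponents combine with signs +, -,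
+. -/
theorem frFn_transform (r : ℕ) {k h : ℕ} (hk : 0 < k) (hc : Nat.Coprime h k) {w : ℂ}
    (hw : 0 < w.re) :
    ∃ x₁ x₂ x₃ : ℂ,
      ‖x₁‖ = rexp (-(2 * π * 1 * ((w⁻¹).re / k ^ 2))) ∧
      ‖x₂‖ = rexp (-(2 * π * ((Nat.gcd 2 k : ℝ) ^ 2 / 2) * ((w⁻¹).re / k ^ 2))) ∧
      ‖x₃‖ = rexp (-(2 * π * ((Nat.gcd (2 ^ r) k : ℝ) ^ 2 / 2 ^ r) * ((w⁻¹).re / k ^ 2))) ∧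
      frFn r (cexp (2 * π * I * (h / k + I * w)))
        = multiplier r h k * scaleFactor r k * √k * Complex.sqrt w
          * cexp (π * polarCoeff r k / 12 / k ^ 2 * w⁻¹ - π * (2 ^ r - 1) / 12 * w)
          * (eulerFn x₂ * ((eulerFn x₁)⁻¹ * (eulerFn x₃)⁻¹)) := by
  have hkR : (0 : ℝ) < k := by exact_mod_cast hk
  have hkC : (k : ℂ) ≠ 0 := by exact_mod_cast hk.ne'
  have hz : 0 < ((k : ℂ) * w).re := by rw [← ofReal_natCast, re_ofReal_mul]; positivity
  have hw0 := ne_zero_of_re_pos' hw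
  have hre : (((k : ℂ) * w)⁻¹).re / k = (w⁻¹).re / k ^ 2 := by
    rw [mul_inv, show ((k : ℂ))⁻¹ = ((k : ℝ)⁻¹ : ℝ) by push_cast; rfl, re_ofReal_mul]
    field_simp
  obtain ⟨x₁, n1, e1⟩ := eulerFn_pow_transform one_pos hk hc hz
  obtain ⟨x₂, n2, e2⟩ := eulerFn_pow_transform two_pos hk hc hz
  obtain ⟨x₃, n3, e3⟩ := eulerFn_pow_transform (show 0 < 2 ^ r by positivity) hk hc hz
  rw [hre] at n1 n2 n3
  have hq : cexp (2 * π * I * ((h + I * (k * w)) / k)) = cexp (2 * π * I * (h / k + I * w)) := by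
    congr 1; field_simp
  rw [hq] at e1 e2 e3
  have hlt : ∀ {c y : ℝ} (_ : 0 < c) (_ : 0 < y) {x : ℂ}, ‖x‖ = rexp (-(2 * π * c * y)) → ‖x‖ < 1 := by
    intro c y hc hy x hx
    rw [hx, Real.exp_lt_one_iff]
    have := Real.pi_pos
    have : 0 < 2 * π * c * y := by positivity
    linarith
  have hy : 0 < (w⁻¹).re / k ^ 2 := div_pos (inv_re_pos hw) (by positivity)
  obtain ⟨g1, -⟩ := gcd_two_pow_bounds r k
  obtain ⟨g2, -⟩ := gcd_two_bounds k
  have E1 := eulerFn_ne_zero (hlt (by simp) hy n1)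
  have E2 := eulerFn_ne_zero (hlt (by positivity) hy n2)
  have E3 := eulerFn_ne_zero (hlt (by positivity) hy n3)
  refine ⟨x₁, x₂, x₃, by simpa using n1, by simpa using n2, by simpa using n3, ?_⟩
  set q := cexp (2 * π * I * (h / k + I * w)) with hqdef
  have hsw := sqrt_ne_zero_of_re_pos hw
  have hskw : Complex.sqrt (k * w) = (√k : ℝ) * Complex.sqrt w := by
    rw [← sqrt_ofReal_mul hkR hw, ofReal_natCast]
  have hsk : ((√k : ℝ) : ℂ) ≠ 0 := by
    rw [ofReal_ne_zero]; exact (Real.sqrt_pos.2 hkR).ne'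
  have hc2 : ((√((2 : ℕ) / Nat.gcd 2 k) : ℝ) : ℂ) ≠ 0 := by
    rw [ofReal_ne_zero]; exact (Real.sqrt_pos.2 (by push_cast; positivity)).ne'
  have hexp : cexp (π * polarCoeff r k / 12 / k ^ 2 * w⁻¹ - π * (2 ^ r - 1) / 12 * w)
      = cexp (π / 12 * ((Nat.gcd 1 k : ℝ) ^ 2 / (1 : ℕ) * ((k * w)⁻¹ / k) - (1 : ℕ) * (k * w / k)))
        * cexp (π / 12 * ((Nat.gcd (2 ^ r) k : ℝ) ^ 2 / (2 ^ r : ℕ) * ((k * w)⁻¹ / k)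
          - (2 ^ r : ℕ) * (k * w / k)))
        / cexp (π / 12 * ((Nat.gcd 2 k : ℝ) ^ 2 / (2 : ℕ) * ((k * w)⁻¹ / k)
          - (2 : ℕ) * (k * w / k))) := by
    rw [← Complex.exp_add, ← Complex.exp_sub]
    congr 1
    simp only [polarCoeff, Nat.gcd_one_left]
    push_cast
    field_simp
    ring
  rw [frFn, hexp]
  rw [hskw] at e1 e2 e3
  rw [pow_one] at e1
  simp only [Nat.gcd_one_left, Nat.div_one, one_mul, Nat.cast_one, div_one, Real.sqrt_one,
    ofReal_one] at e1 ⊢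
  have hm : multiplier r h k * scaleFactor r k
      = omega h k * omega (2 ^ r / Nat.gcd (2 ^ r) k * h) (k / Nat.gcd (2 ^ r) k)
        * (√((2 ^ r : ℕ) / Nat.gcd (2 ^ r) k) : ℝ)
        / (omega (2 / Nat.gcd 2 k * h) (k / Nat.gcd 2 k) * (√((2 : ℕ) / Nat.gcd 2 k) : ℝ)) := by
    rw [multiplier, scaleFactor]
    push_cast
    ring
  rw [hm]
  have o1 := omega_ne_zero h k
  have o2 := omega_ne_zero (2 / Nat.gcd 2 k * h) (k / Nat.gcd 2 k)
  have o3 := omega_ne_zero (2 ^ r / Nat.gcd (2 ^ r) k * h) (k / Nat.gcd (2 ^ r) k)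
  have hne1 : eulerFn q ≠ 0 := by
    intro h0; rw [h0, mul_zero] at e1; exact E1 e1
  have hne3 : eulerFn (q ^ 2 ^ r) ≠ 0 := by
    intro h0; rw [h0, mul_zero] at e3; exact E3 e3
  have hc3 : ((√((2 ^ r : ℕ) / Nat.gcd (2 ^ r) k) : ℝ) : ℂ) ≠ 0 := by
    intro h0; rw [h0] at e3; simp at e3; exact E3 e3
  rw [e1, e2, e3]
  have x1 := Complex.exp_ne_zero (π / 12 * (((1 : ℝ) : ℂ) ^ 2 / 1 * ((k * w)⁻¹ / k) - 1 * (k * w / k)))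
  generalize cexp (π / 12 * ((Nat.gcd 2 k : ℝ) ^ 2 / (2 : ℕ) * ((k * w)⁻¹ / k)
          - (2 : ℕ) * (k * w / k))) = A at *
  generalize cexp (π / 12 * ((Nat.gcd (2 ^ r) k : ℝ) ^ 2 / (2 ^ r : ℕ) * ((k * w)⁻¹ / k)
          - (2 ^ r : ℕ) * (k * w / k))) = B at *
  generalize omega (2 ^ r / Nat.gcd (2 ^ r) k * h) (k / Nat.gcd (2 ^ r) k) = o3' at *
  generalize omega (2 / Nat.gcd 2 k * h) (k / Nat.gcd 2 k) = o2' at *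
  have hA : A ≠ 0 := by
    intro h0; rw [h0] at e2; simp at e2; exact E2 e2
  have hB : B ≠ 0 := by
    intro h0; rw [h0] at e3; simp at e3; exact E3 e3
  field_simp

end Rademacher

end

/-! ### Approximation of f_r by its leading term on a Ford disc. -/

noncomputable section

namespace Rademacher

open Complex Real

theorem exists_eulerFn_bound {ρ : ℝ} (hρ0 : 0 ≤ ρ) (hρ : ρ < 1) :
    ∃ K, 0 ≤ K ∧ ∀ x, ‖x‖ ≤ ρ → ‖eulerFn x - 1‖ ≤ K * ‖x‖ ∧ ‖(eulerFn x)⁻¹ - 1‖ ≤ K * ‖x‖ := by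
  obtain ⟨K₁, h1, H1⟩ := exists_norm_sub_le_of_differentiableOn_disc
    isSumOnDisc_eulerFn.differentiableOn hρ0 hρ
  obtain ⟨K₂, h2, H2⟩ := exists_norm_sub_le_of_differentiableOn_disc
    isSumOnDisc_f.differentiableOn hρ0 hρ
  refine ⟨max K₁ K₂, le_max_of_le_left h1, fun x hx => ⟨?_, ?_⟩⟩
  · have := H1 x hx
    rw [eulerFn_zero] at this
    exact this.trans (mul_le_mul_of_nonneg_right (le_max_left _ _) (norm_nonneg _))
  · have := H2 x hx
    rw [eulerFn_zero, inv_one] at this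
    exact this.trans (mul_le_mul_of_nonneg_right (le_max_right _ _) (norm_nonneg _))

theorem norm_mul_mul_sub_one_le {a b c : ℂ} {δ : ℝ} (ha : ‖a - 1‖ ≤ δ) (hb : ‖b - 1‖ ≤ δ)
    (hc : ‖c - 1‖ ≤ δ) : ‖a * (b * c) - 1‖ ≤ (1 + δ) ^ 3 - 1 := by
  have hδ : 0 ≤ δ := (norm_nonneg _).trans ha
  have e : a * (b * c) - 1 = (a - 1) + (b - 1) + (c - 1) + (a - 1) * (b - 1) + (a - 1) * (c - 1)
      + (b - 1) * (c - 1) + (a - 1) * ((b - 1) * (c - 1)) := by ring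
  have hp : ∀ {x y : ℂ} {p q : ℝ}, ‖x‖ ≤ p → ‖y‖ ≤ q → ‖x * y‖ ≤ p * q := fun hx hy => by
    rw [norm_mul]; exact mul_le_mul hx hy (norm_nonneg _) ((norm_nonneg _).trans hx)
  rw [e]
  refine (norm_add_le_of_le (norm_add_le_of_le (norm_add_le_of_le (norm_add_le_of_le
    (norm_add_le_of_le (norm_add_le_of_le ha hb) hc) (hp ha hb)) (hp ha hc)) (hp hb hc))
    (hp ha (hp hb hc))).trans (le_of_eq ?_)
  ring

theorem one_add_mul_pow_three_sub_one_le {K ε : ℝ} (hK : 0 ≤ K) (h0 : 0 ≤ ε) (h1 : ε ≤ 1) :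
    (1 + K * ε) ^ 3 - 1 ≤ (1 + K) ^ 3 * ε := by
  have e1 : K ^ 2 * ε ^ 2 ≤ K ^ 2 * ε := by gcongr; exact pow_le_of_le_one h0 h1 two_ne_zero
  have e2 : K ^ 3 * ε ^ 3 ≤ K ^ 3 * ε := by gcongr; exact pow_le_of_le_one h0 h1 three_ne_zero
  have e3 : (1 + K * ε) ^ 3 - 1 = 3 * (K * ε) + 3 * (K ^ 2 * ε ^ 2) + K ^ 3 * ε ^ 3 := by ring
  have e4 : (1 + K) ^ 3 * ε = ε + 3 * (K * ε) + 3 * (K ^ 2 * ε) + K ^ 3 * ε := by ring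
  linarith

open Classical in
/-- The leading term of `f_r` near `h/k`, at the point `h/k + iw`. -/
def leadingTerm (r h k : ℕ) (w : ℂ) : ℂ :=
  if 0 < polarCoeff r k then
    multiplier r h k * scaleFactor r k * √k * Complex.sqrt w
      * cexp (π * polarCoeff r k / 12 / k ^ 2 * w⁻¹ - π * (2 ^ r - 1) / 12 * w)
  else 0

/-- The condition Re(1/w) ≥ k² describes the Ford disc of diameter 1/k² at h/k, and there y =
Re(1/w)/k² ≥ 1. For a > 0 the leading term is O(√k √|w| e^(πay/12)) and the relative error is
O(e^(-πay/12)); for a ≤ 0 the function itself is O(√k √|w|). -/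
theorem exists_frFn_approx {r : ℕ} (hr : r ≤ 4) :
    ∃ K, 0 ≤ K ∧ ∀ (k h : ℕ) (w : ℂ), 0 < k → Nat.Coprime h k → 0 < w.re → (k : ℝ) ^ 2 ≤ (w⁻¹).re →
      ‖frFn r (cexp (2 * π * I * (h / k + I * w))) - leadingTerm r h k w‖ ≤ K * (√k * √‖w‖) := by
  have hρ : rexp (-(2 * π / 16)) < 1 := by
    rw [Real.exp_lt_one_iff]; have := Real.pi_pos; linarith
  obtain ⟨K, hK, HK⟩ := exists_eulerFn_bound (Real.exp_pos _).le hρ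
  refine ⟨4 * (1 + K) ^ 3, by positivity, fun k h w hk hc hw hwk => ?_⟩
  obtain ⟨x₁, x₂, x₃, n1, n2, n3, H⟩ := frFn_transform r hk hc hw
  obtain ⟨p1, p2, p3, q2, q3⟩ := polarCoeff_le hr k
  have hkR : (0 : ℝ) < k := by exact_mod_cast hk
  have hpi := Real.pi_pos
  set a := polarCoeff r k with ha
  set y := (w⁻¹).re / (k : ℝ) ^ 2 with hy
  have hy1 : 1 ≤ y := by rw [hy, one_le_div (by positivity)]; exact hwk
  have small : ∀ {c : ℝ} {x : ℂ}, 1 / 16 ≤ c → ‖x‖ = rexp (-(2 * π * c * y)) →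
      ‖x‖ ≤ rexp (-(2 * π / 16)) := by
    intro c x hc hx
    rw [hx, Real.exp_le_exp]
    have : 1 / 16 ≤ c * y := by nlinarith
    nlinarith
  have small' : ∀ {c : ℝ} {x : ℂ}, a ≤ 24 * c → ‖x‖ = rexp (-(2 * π * c * y)) →
      ‖x‖ ≤ rexp (-(π * a * y / 12)) := by
    intro c x hc hx
    rw [hx, Real.exp_le_exp]
    have : a * y ≤ 24 * c * y := by nlinarith
    nlinarith
  have b1 := HK x₁ (small (by norm_num) n1)
  have b2 := HK x₂ (small q2 n2)
  have b3 := HK x₃ (small q3 n3)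
  set P : ℂ := multiplier r h k * scaleFactor r k * √k * Complex.sqrt w
      * cexp (π * a / 12 / k ^ 2 * w⁻¹ - π * (2 ^ r - 1) / 12 * w) with hP
  have hPn : ‖P‖ ≤ 4 * (√k * √‖w‖) * rexp (π * a * y / 12) := by
    have e : (π : ℂ) * a / 12 / k ^ 2 * w⁻¹ - π * (2 ^ r - 1) / 12 * w
        = ((π * a / 12 / k ^ 2 : ℝ) : ℂ) * w⁻¹ - ((π * (2 ^ r - 1) / 12 : ℝ) : ℂ) * w := by
      push_cast; ring
    rw [hP, e, norm_mul, norm_mul, norm_mul, norm_mul, norm_multiplier, one_mul, Complex.norm_exp,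
      norm_sqrt_complex, Complex.norm_real, Complex.norm_real, Real.norm_of_nonneg
      (scaleFactor_nonneg r k), Real.norm_of_nonneg (Real.sqrt_nonneg _), sub_re, re_ofReal_mul,
      re_ofReal_mul]
    have h1 : rexp (π * a / 12 / k ^ 2 * (w⁻¹).re - π * (2 ^ r - 1) / 12 * w.re)
        ≤ rexp (π * a * y / 12) := by
      rw [Real.exp_le_exp]
      have h2 : π * a / 12 / k ^ 2 * (w⁻¹).re = π * a * y / 12 := by rw [hy]; field_simp
      have h3 : (1 : ℝ) ≤ 2 ^ r := one_le_pow₀ one_le_two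
      have h4 : 0 ≤ π * ((2 : ℝ) ^ r - 1) / 12 * w.re := by
        have : 0 ≤ (2 : ℝ) ^ r - 1 := by linarith
        positivity
      linarith
    rw [mul_assoc (scaleFactor r k)]
    exact mul_le_mul (mul_le_mul_of_nonneg_right (scaleFactor_le hr k) (by positivity)) h1
      (Real.exp_pos _).le (by positivity)
  rw [leadingTerm, ← ha, ← hP, H]
  split_ifs with hpos
  · set ε := rexp (-(π * a * y / 12)) with hε
    have hε1 : ε ≤ 1 := by
      rw [hε, Real.exp_le_one_iff]
      have : 0 < π * a * y / 12 := by positivity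
      linarith
    have hε0 : 0 ≤ ε := (Real.exp_pos _).le
    have c1 := b1.2.trans (mul_le_mul_of_nonneg_left (small' p1 n1) hK)
    have c2 := b2.1.trans (mul_le_mul_of_nonneg_left (small' p2 n2) hK)
    have c3 := b3.2.trans (mul_le_mul_of_nonneg_left (small' p3 n3) hK)
    have key := norm_mul_mul_sub_one_le c2 c1 c3
    have key2 := one_add_mul_pow_three_sub_one_le hK hε0 hε1
    have e : P * (eulerFn x₂ * ((eulerFn x₁)⁻¹ * (eulerFn x₃)⁻¹)) - P
        = P * (eulerFn x₂ * ((eulerFn x₁)⁻¹ * (eulerFn x₃)⁻¹) - 1) := by ring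
    rw [e, norm_mul]
    calc _ ≤ (4 * (√k * √‖w‖) * rexp (π * a * y / 12)) * ((1 + K) ^ 3 * ε) :=
          mul_le_mul hPn (key.trans key2) (norm_nonneg _) (by positivity)
      _ = 4 * (1 + K) ^ 3 * (√k * √‖w‖) * (rexp (π * a * y / 12) * ε) := by ring
      _ = _ := by rw [hε, ← Real.exp_add, add_neg_cancel, Real.exp_zero, mul_one]
  · rw [sub_zero, norm_mul]
    have le1 : ∀ {x : ℂ}, ‖x‖ ≤ rexp (-(2 * π / 16)) → K * ‖x‖ ≤ K := fun hx =>
      mul_le_of_le_one_right hK (hx.trans hρ.le)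
    have key := norm_mul_mul_sub_one_le (b2.1.trans (le1 (small q2 n2)))
      (b1.2.trans (le1 (small (by norm_num) n1))) (b3.2.trans (le1 (small q3 n3)))
    have key2 : ‖eulerFn x₂ * ((eulerFn x₁)⁻¹ * (eulerFn x₃)⁻¹)‖ ≤ (1 + K) ^ 3 := by
      have := norm_le_norm_add_norm_sub 1 (eulerFn x₂ * ((eulerFn x₁)⁻¹ * (eulerFn x₃)⁻¹))
      rw [norm_one, norm_sub_rev] at this
      linarith
    have hexp : rexp (π * a * y / 12) ≤ 1 := by
      rw [Real.exp_le_one_iff]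
      have h1 : a * y ≤ 0 := mul_nonpos_of_nonpos_of_nonneg (not_lt.1 hpos) (by linarith)
      nlinarith
    calc _ ≤ (4 * (√k * √‖w‖) * rexp (π * a * y / 12)) * (1 + K) ^ 3 :=
          mul_le_mul hPn key2 (norm_nonneg _) (by positivity)
      _ ≤ (4 * (√k * √‖w‖) * 1) * (1 + K) ^ 3 := by gcongr
      _ = _ := by ring

end Rademacher

end

/-! ### Farey fractions and the chain of Ford circles. -/

noncomputable section

namespace Rademacher

open Finset

/-- In every interval of `k` consecutive integers there is a solution of `h x ≡ c (mod k)`. -/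
theorem exists_mul_sub_dvd {h k N : ℕ} (hk : 0 < k) (hkN : k ≤ N) (hc : Nat.Coprime h k) (c : ℤ) :
    ∃ x : ℕ, N < x + k ∧ x ≤ N ∧ (k : ℤ) ∣ h * x - c := by
  obtain ⟨u, v, huv⟩ := Nat.isCoprime_iff_coprime.2 hc
  have hk' : (0 : ℤ) < k := by exact_mod_cast hk
  have h0 := Int.emod_nonneg (N - u * c) hk'.ne'
  have h1 := Int.emod_lt_of_pos (N - u * c) hk'
  have h2 := Int.emod_add_mul_ediv (N - u * c) k
  set e := (N - u * c) % k
  set d := (N - u * c) / k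
  obtain ⟨x, hx⟩ : ∃ x : ℕ, (x : ℤ) = N - e := ⟨(N - e).toNat, by
    rw [Int.toNat_of_nonneg]; have : (k : ℤ) ≤ N := by exact_mod_cast hkN
    omega⟩
  refine ⟨x, by omega, by omega, ⟨h * d - v * c, ?_⟩⟩
  have : (N : ℤ) - e = u * c + k * d := by linarith
  rw [hx, this]
  linear_combination c * huv

theorem eq_of_dvd_of_interval {h k N x y : ℕ} (hc : Nat.Coprime h k) {c : ℤ}
    (hx1 : N < x + k) (hx2 : x ≤ N) (hx : (k : ℤ) ∣ h * x - c)
    (hy1 : N < y + k) (hy2 : y ≤ N) (hy : (k : ℤ) ∣ h * y - c) : x = y := by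
  have h1 : (k : ℤ) ∣ h * (x - y) := by
    have := dvd_sub hx hy
    rwa [show (h : ℤ) * x - c - (h * y - c) = h * (x - y) by ring] at this
  have h2 : (k : ℤ) ∣ (x : ℤ) - y :=
    (Nat.isCoprime_iff_coprime.2 hc.symm).dvd_of_dvd_mul_left h1
  have h3 := Int.eq_zero_of_abs_lt_dvd h2 (by rw [abs_lt]; constructor <;> omega)
  omega

open Classical in
/-- For `c = -1` resp. `c = 1`, the denominator of the right resp. left neighbour of `h/k` in the
Farey sequence of order `N`. -/
def fareyNeighbour (N h k : ℕ) (c : ℤ) : ℕ :=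
  if H : ∃ x : ℕ, N < x + k ∧ x ≤ N ∧ (k : ℤ) ∣ h * x - c then H.choose else 0

theorem fareyNeighbour_spec {h k N : ℕ} (hk : 0 < k) (hkN : k ≤ N) (hc : Nat.Coprime h k) (c : ℤ) :
    N < fareyNeighbour N h k c + k ∧ fareyNeighbour N h k c ≤ N ∧
      (k : ℤ) ∣ h * fareyNeighbour N h k c - c := by
  have H := exists_mul_sub_dvd hk hkN hc c
  rw [fareyNeighbour, dif_pos H]
  exact H.choose_spec

theorem fareyNeighbour_eq {h k N x : ℕ} (hk : 0 < k) (hkN : k ≤ N) (hc : Nat.Coprime h k) {c : ℤ}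
    (h1 : N < x + k) (h2 : x ≤ N) (h3 : (k : ℤ) ∣ h * x - c) : fareyNeighbour N h k c = x := by
  obtain ⟨a, b, d⟩ := fareyNeighbour_spec hk hkN hc c
  exact eq_of_dvd_of_interval hc a b d h1 h2 h3

/-- The reduced fractions `h/k` in `[0,1)` with `k ≤ N`, as pairs `(k,h)`. -/
def fareyFractions (N : ℕ) : Finset (Σ _ : ℕ, ℕ) := (Icc 1 N).sigma reduced

theorem mem_fareyFractions {N : ℕ} {p : Σ _ : ℕ, ℕ} :
    p ∈ fareyFractions N ↔ (1 ≤ p.1 ∧ p.1 ≤ N) ∧ p.2 < p.1 ∧ Nat.Coprime p.2 p.1 := by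
  simp [fareyFractions, reduced, Nat.Coprime]

/-- The right neighbour of a Farey fraction, modulo `1`. -/
def fareyNext (N : ℕ) (p : Σ _ : ℕ, ℕ) : Σ _ : ℕ, ℕ :=
  let x := fareyNeighbour N p.2 p.1 (-1)
  ⟨x, ((p.2 * x + 1) / p.1) % x⟩

/-- If hx + 1 = ky, then y/x is the right neighbour of h/k, and k solves the congruence defining the
left neighbour of y/x. One has y < x unless x = 1; then k = N and h = N - 1, and the neighbour 1/1
is read as 0/1. -/
theorem fareyNext_spec {N : ℕ} {p : Σ _ : ℕ, ℕ} (hp : p ∈ fareyFractions N) :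
    fareyNext N p ∈ fareyFractions N ∧
      fareyNeighbour N (fareyNext N p).2 (fareyNext N p).1 1 = p.1 ∧
      (((fareyNext N p).1 ≠ 1 ∧ (fareyNext N p).2 * p.1 = p.2 * (fareyNext N p).1 + 1) ∨
        ((fareyNext N p).1 = 1 ∧ (fareyNext N p).2 = 0 ∧ p.1 = N ∧ p.2 + 1 = N)) := by
  obtain ⟨⟨hk1, hkN⟩, hlt, hc⟩ := mem_fareyFractions.1 hp
  obtain ⟨k, h⟩ := p
  simp only at hk1 hkN hlt hc
  obtain ⟨s1, s2, s3⟩ := fareyNeighbour_spec hk1 hkN hc (-1)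
  simp only [fareyNext]
  set x := fareyNeighbour N h k (-1) with hx
  have hd : k ∣ h * x + 1 := by
    have : (k : ℤ) ∣ ((h * x + 1 : ℕ) : ℤ) := by simpa using s3
    exact_mod_cast this
  obtain ⟨y, hy⟩ := hd
  have hx0 : 0 < x := by
    rcases Nat.eq_zero_or_pos x with h0 | h0
    · rw [h0] at hy
      have : k ∣ 1 := ⟨y, by simpa using hy⟩
      have := Nat.le_of_dvd one_pos this
      omega
    · exact h0
  rw [hy, Nat.mul_div_cancel_left _ hk1]
  have hcop : Nat.Coprime y x := by
    rw [← Nat.isCoprime_iff_coprime]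
    refine ⟨k, -h, ?_⟩
    have : (h : ℤ) * x + 1 = k * y := by exact_mod_cast hy
    linear_combination -this
  have hcop' : Nat.Coprime (y % x) x := by
    rw [Nat.Coprime, ← Nat.gcd_rec x y, Nat.gcd_comm]; exact hcop
  refine ⟨mem_fareyFractions.2 ⟨⟨hx0, s2⟩, Nat.mod_lt _ hx0, hcop'⟩, ?_, ?_⟩
  · refine fareyNeighbour_eq hx0 s2 hcop' (by omega) hkN ?_
    have h1 : (y : ℤ) = (y % x : ℕ) + x * (y / x : ℕ) := by exact_mod_cast (Nat.mod_add_div y x).symm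
    have h2 : (h : ℤ) * x + 1 = k * y := by exact_mod_cast hy
    refine ⟨h - k * (y / x : ℕ), ?_⟩
    rw [h1] at h2
    linear_combination -h2
  · rcases eq_or_ne x 1 with h1 | h1
    · right
      refine ⟨h1, ?_, by omega, ?_⟩
      · rw [h1, Nat.mod_one]
      · have hkeq : k = N := by omega
        have : k ∣ h + 1 := ⟨y, by rw [← hy, h1, mul_one]⟩
        have := Nat.le_of_dvd (by omega) this
        omega
    · left
      refine ⟨h1, ?_⟩
      have hyx : y < x := by
        by_contra hge
        have h2 : k * x ≤ k * y := Nat.mul_le_mul_left k (not_lt.1 hge)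
        have h3 : (h + 1) * x ≤ k * x := Nat.mul_le_mul_right x hlt
        rw [← hy] at h2
        have : (h + 1) * x = h * x + x := by ring
        omega
      rw [Nat.mod_eq_of_lt hyx, mul_comm, ← hy]

/-- The successor determines k as its left neighbour, and then h modulo k by hx ≡ -1, since x is a
unit modulo k. -/
theorem fareyNext_injOn (N : ℕ) : Set.InjOn (fareyNext N) (fareyFractions N) := by
  intro p hp q hq e
  have h1 := (fareyNext_spec hp).2.1
  have h2 := (fareyNext_spec hq).2.1
  have hk : p.1 = q.1 := by rw [← h1, ← h2, e]
  have hx : fareyNeighbour N p.2 p.1 (-1) = fareyNeighbour N q.2 q.1 (-1) := congrArg Sigma.fst e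
  obtain ⟨⟨hp1, hpN⟩, hplt, hpc⟩ := mem_fareyFractions.1 hp
  obtain ⟨⟨hq1, hqN⟩, hqlt, hqc⟩ := mem_fareyFractions.1 hq
  have sp := (fareyNeighbour_spec hp1 hpN hpc (-1)).2.2
  have sq := (fareyNeighbour_spec hq1 hqN hqc (-1)).2.2
  rw [← hx, ← hk] at sq
  set x := fareyNeighbour N p.2 p.1 (-1)
  have hd : (p.1 : ℤ) ∣ x * ((p.2 : ℤ) - q.2) := by
    have := dvd_sub sp sq
    rwa [show (p.2 : ℤ) * x - -1 - (q.2 * x - -1) = x * (p.2 - q.2) by ring] at this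
  have hcx : IsCoprime (p.1 : ℤ) x := by
    obtain ⟨y, hy⟩ := sp
    exact ⟨y, -p.2, by linear_combination -hy⟩
  have hd2 := hcx.dvd_of_dvd_mul_left hd
  have h3 := Int.eq_zero_of_abs_lt_dvd hd2 (by rw [abs_lt]; constructor <;> omega)
  refine Sigma.ext hk (heq_of_eq ?_)
  omega

/-- The point at which the Ford circle of `h/k` meets that of a neighbouring fraction with
denominator `|x|`, to the right for `x > 0` and to the left for `x < 0`. -/
def fordPoint (h k : ℕ) (x : ℤ) : ℂ :=
  h / k + Complex.I * ((k : ℂ) ^ 2 + Complex.I * (k * x))⁻¹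

theorem fordPoint_im_pos {h k : ℕ} (hk : 0 < k) (x : ℤ) : 0 < (fordPoint h k x).im := by
  have hkR : (0 : ℝ) < k := by exact_mod_cast hk
  have h1 : ((h : ℂ) / k).im = 0 := by
    rw [show (h : ℂ) / k = ((h / k : ℝ) : ℂ) by push_cast; rfl, Complex.ofReal_im]
  rw [fordPoint, Complex.add_im, h1, zero_add, Complex.I_mul_im, Complex.inv_re]
  have h2 : ((k : ℂ) ^ 2 + Complex.I * (k * x)).re = (k : ℝ) ^ 2 := by
    simp [← Complex.ofReal_natCast, ← Complex.ofReal_pow]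
  refine div_pos (by rw [h2]; positivity) (Complex.normSq_pos.2 fun h0 => ?_)
  rw [h0, Complex.zero_re] at h2
  exact (show (0 : ℝ) ≠ k ^ 2 by positivity) h2

/-- For determinant 1 the two Ford circles are tangent, and both sides are the point of tangency. -/
theorem fordPoint_eq {h k h' k' : ℕ} (hk : 0 < k) (hk' : 0 < k') (H : h' * k = h * k' + 1) :
    fordPoint h k k' = fordPoint h' k' (-k) := by
  have h1 : (k : ℂ) ≠ 0 := by exact_mod_cast hk.ne'
  have h2 : (k' : ℂ) ≠ 0 := by exact_mod_cast hk'.ne'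
  have hH : (h' : ℂ) * k = h * k' + 1 := by exact_mod_cast H
  have hkR : (0 : ℝ) < k := by exact_mod_cast hk
  have hk'R : (0 : ℝ) < k' := by exact_mod_cast hk'
  have h3 : (k : ℂ) + Complex.I * k' ≠ 0 := by
    intro h0; have := congrArg Complex.re h0; simp at this; exact hk.ne' this
  have h4 : (k' : ℂ) - Complex.I * k ≠ 0 := by
    intro h0; have := congrArg Complex.re h0; simp at this; exact hk'.ne' this
  rw [fordPoint, fordPoint]
  push_cast
  have e1 : (k : ℂ) ^ 2 + Complex.I * (k * k') = k * (k + Complex.I * k') := by ring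
  have e2 : (k' : ℂ) ^ 2 + Complex.I * (k' * -k) = k' * (k' - Complex.I * k) := by ring
  have e3 : (k : ℂ) + Complex.I * k' = Complex.I * (k' - Complex.I * k) := by
    linear_combination (k : ℂ) * Complex.I_sq
  have hh' : (h' : ℂ) = (h * k' + 1) / k := by rw [← hH]; field_simp
  rw [e1, e2, e3, hh']
  have hv : (k' - Complex.I * k) * (k' - Complex.I * k : ℂ)⁻¹ = 1 := mul_inv_cancel₀ h4
  rw [mul_inv, mul_inv, mul_inv, Complex.inv_I]
  generalize (k' - Complex.I * k : ℂ)⁻¹ = v at hv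
  field_simp
  linear_combination hv - v * k' * Complex.I_sq

/-- A function on the upper half plane which increases by `c` under `τ ↦ τ + 1` is telescoped along
the Ford circles of order `N`. -/
theorem sum_fordPoint_sub {Φ : ℂ → ℂ} {c : ℂ} (hΦ : ∀ τ : ℂ, 0 < τ.im → Φ (τ + 1) = Φ τ + c)
    {N : ℕ} (hN : 1 ≤ N) :
    ∑ k ∈ Icc 1 N, ∑ h ∈ reduced k, (Φ (fordPoint h k (fareyNeighbour N h k (-1)))
      - Φ (fordPoint h k (-(fareyNeighbour N h k 1 : ℤ)))) = c := by
  rw [← sum_sigma (Icc 1 N) reduced (fun p => Φ (fordPoint p.2 p.1 (fareyNeighbour N p.2 p.1 (-1)))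
      - Φ (fordPoint p.2 p.1 (-(fareyNeighbour N p.2 p.1 1 : ℤ))))]
  change ∑ p ∈ fareyFractions N, _ = c
  rw [sum_sub_distrib]
  set L : (Σ _ : ℕ, ℕ) → ℂ := fun p => Φ (fordPoint p.2 p.1 (-(fareyNeighbour N p.2 p.1 1 : ℤ)))
    with hL
  have hsurj : Set.SurjOn (fareyNext N) (fareyFractions N) (fareyFractions N) :=
    surjOn_of_injOn_of_card_le _ (fun p hp => (fareyNext_spec hp).1) (fareyNext_injOn N) le_rfl
  have h1 : ∑ p ∈ fareyFractions N, L (fareyNext N p) = ∑ p ∈ fareyFractions N, L p :=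
    sum_nbij (fareyNext N) (fun p hp => (fareyNext_spec hp).1) (fareyNext_injOn N) hsurj
      (fun _ _ => rfl)
  -- The right end of each arc is the left end of the next one. Only after (N-1)/N does the chain
  -- wrap round: it reaches the arc of 0/1 translated by 1, and this gives the one summand `c`.
  have h2 : ∀ p ∈ fareyFractions N, Φ (fordPoint p.2 p.1 (fareyNeighbour N p.2 p.1 (-1)))
      = L (fareyNext N p) + if p = ⟨N, N - 1⟩ then c else 0 := by
    intro p hp
    obtain ⟨hm, hb, hcase⟩ := fareyNext_spec hp
    obtain ⟨⟨hp1, hpN⟩, hplt, hpc⟩ := mem_fareyFractions.1 hp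
    have hm1 := (mem_fareyFractions.1 hm).1.1
    have hfst : fareyNeighbour N p.2 p.1 (-1) = (fareyNext N p).1 := rfl
    rw [hL, hfst]
    simp only [hb]
    rcases hcase with ⟨hne, heq⟩ | ⟨h1', h0, hpN', hpN1⟩
    · rw [if_neg, add_zero, fordPoint_eq hp1 hm1 heq]
      rintro rfl
      apply hne
      have : N - 1 < N := hplt
      refine fareyNeighbour_eq hp1 hpN hpc (by simp) (by omega) ⟨1, ?_⟩
      push_cast [Nat.cast_sub hN]
      ring
    · have hpeq : p = ⟨N, N - 1⟩ := Sigma.ext hpN' (heq_of_eq (by simp only; omega))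
      rw [if_pos hpeq, h1', h0, hpN']
      have e : fordPoint p.2 N (1 : ℕ) = fordPoint 0 1 (-N) + 1 := by
        have := fordPoint_eq (h := p.2) (k := N) (h' := 1) (k' := 1) hN one_pos (by omega)
        rw [this, fordPoint, fordPoint]
        push_cast
        ring
      rw [e, hΦ _ (fordPoint_im_pos one_pos _)]
  have hmem : (⟨N, N - 1⟩ : Σ _ : ℕ, ℕ) ∈ fareyFractions N := by
    refine mem_fareyFractions.2 ⟨⟨hN, le_rfl⟩, by simp only; omega, ?_⟩
    simp only
    rw [← Nat.isCoprime_iff_coprime]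
    refine ⟨-1, 1, ?_⟩
    push_cast [Nat.cast_sub hN]
    ring
  rw [sum_congr rfl h2, sum_add_distrib, h1, sum_ite_eq' (fareyFractions N), if_pos hmem]
  ring

end Rademacher

end

/-! ### Coefficients as increments of a primitive; bounds for the kernel integral. -/

noncomputable section

namespace Rademacher

open Complex Real

theorem IsSumOnDisc.shift {a : PowerSeries ℂ} {g : ℂ → ℂ} (ha : IsSumOnDisc a g) (N : ℕ) :
    IsSumOnDisc (PowerSeries.mk fun j => PowerSeries.coeff (j + N) a)
      (fun x => ∑' j, PowerSeries.coeff (j + N) a * x ^ j) := by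
  intro x hx
  simp only [PowerSeries.coeff_mk]
  refine Summable.hasSum ?_
  rcases eq_or_ne x 0 with rfl | hx0
  · refine summable_of_ne_finset_zero (s := {0}) fun j hj => ?_
    rw [zero_pow (by simpa using hj), mul_zero]
  · have h := ((summable_nat_add_iff N).2 (ha x hx).summable).mul_right ((x ^ N)⁻¹)
    refine h.congr fun j => ?_
    rw [pow_add]
    field_simp

theorem norm_exp_two_pi_I_mul_lt_one {τ : ℂ} (hτ : 0 < τ.im) : ‖cexp (2 * π * I * τ)‖ < 1 := by
  rw [Complex.norm_exp, Real.exp_lt_one_iff]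
  have : (2 * π * I * τ).re = -(2 * π * τ.im) := by simp
  rw [this]
  have := Real.pi_pos
  have : 0 < 2 * π * τ.im := by positivity
  linarith

/-- A primitive of `g(e^{2πiτ}) e^{-2πinτ}` in the upper half plane: its increment over a period is
the `n`-th coefficient of `g`. -/
theorem IsSumOnDisc.exists_primitive {a : PowerSeries ℂ} {g : ℂ → ℂ} (ha : IsSumOnDisc a g)
    (n : ℕ) : ∃ Φ : ℂ → ℂ,
      (∀ τ : ℂ, 0 < τ.im →
        HasDerivAt Φ (g (cexp (2 * π * I * τ)) * cexp (-(2 * π * I * n * τ))) τ) ∧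
      ∀ τ : ℂ, Φ (τ + 1) = Φ τ + PowerSeries.coeff n a := by
  have hs := ha.shift (n + 1)
  set g₂ : ℂ → ℂ := fun x => ∑' j, PowerSeries.coeff (j + (n + 1)) a * x ^ j with hg₂
  obtain ⟨G, hG⟩ := hs.differentiableOn.isExactOn_ball
  have hpi : (2 * π * I : ℂ) ≠ 0 := by simp [Real.pi_ne_zero]
  have hsplit : ∀ x : ℂ, ‖x‖ < 1 → g x = ∑ m ∈ Finset.range n, PowerSeries.coeff m a * x ^ m
      + PowerSeries.coeff n a * x ^ n + x ^ (n + 1) * g₂ x := by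
    intro x hx
    have h1 := (ha x hx).summable.sum_add_tsum_nat_add (n + 1)
    rw [(ha x hx).tsum_eq, Finset.sum_range_succ] at h1
    rw [← h1, hg₂, ← tsum_mul_left]
    congr 1
    refine tsum_congr fun j => ?_
    rw [pow_add]; ring
  -- Terms of index below n are integrated one by one, those above n together through a primitive
  -- `G` of the tail `g₂`; both are 1-periodic. The n-th term integrates to a linear function, the
  -- only source of the increment.
  refine ⟨fun τ => ∑ m ∈ Finset.range n, PowerSeries.coeff m a
      * (cexp (2 * π * I * ((m : ℂ) - n) * τ) / (2 * π * I * ((m : ℂ) - n)))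
      + PowerSeries.coeff n a * τ + G (cexp (2 * π * I * τ)) / (2 * π * I), ?_, ?_⟩
  · intro τ hτ
    have hq := norm_exp_two_pi_I_mul_lt_one hτ
    have hexp : ∀ c : ℂ, HasDerivAt (fun τ => cexp (c * τ)) (cexp (c * τ) * c) τ := by
      intro c
      have := ((hasDerivAt_id τ).const_mul c).cexp
      simpa using this
    have h1 : HasDerivAt (fun τ => ∑ m ∈ Finset.range n, PowerSeries.coeff m a
        * (cexp (2 * π * I * ((m : ℂ) - n) * τ) / (2 * π * I * ((m : ℂ) - n))))
        (∑ m ∈ Finset.range n, PowerSeries.coeff m a * cexp (2 * π * I * ((m : ℂ) - n) * τ)) τ := by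
      refine HasDerivAt.fun_sum fun m hm => ?_
      have hne : (m : ℂ) - n ≠ 0 := by
        rw [sub_ne_zero]
        exact_mod_cast (Finset.mem_range.1 hm).ne
      have := ((hexp (2 * π * I * ((m : ℂ) - n))).div_const (2 * π * I * ((m : ℂ) - n))).const_mul
        (PowerSeries.coeff m a)
      rwa [mul_div_assoc, div_self (mul_ne_zero hpi hne), mul_one] at this
    have h2 : HasDerivAt (fun τ => PowerSeries.coeff n a * τ) (PowerSeries.coeff n a) τ := by
      simpa using (hasDerivAt_id τ).const_mul (PowerSeries.coeff n a)
    have h3 : HasDerivAt (fun τ => G (cexp (2 * π * I * τ)) / (2 * π * I))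
        (g₂ (cexp (2 * π * I * τ)) * cexp (2 * π * I * τ)) τ := by
      have := ((hG _ (by simpa using hq)).comp τ (hexp (2 * π * I))).div_const (2 * π * I)
      rwa [← mul_assoc, mul_div_assoc, div_self hpi, mul_one] at this
    refine ((h1.add h2).add h3).congr_deriv (Eq.symm ?_)
    rw [hsplit _ hq, add_mul, add_mul, Finset.sum_mul]
    have e : ∀ m : ℕ, cexp (2 * π * I * τ) ^ m * cexp (-(2 * π * I * n * τ))
        = cexp (2 * π * I * ((m : ℂ) - n) * τ) := by
      intro m
      rw [← Complex.exp_nat_mul, ← Complex.exp_add]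
      congr 1; ring
    congr 1
    · congr 1
      · refine Finset.sum_congr rfl fun m _ => ?_
        rw [mul_assoc, e]
      · rw [mul_assoc, e, sub_self, mul_zero, zero_mul, Complex.exp_zero, mul_one]
    · rw [mul_right_comm, e]
      have : (2 * π * I * (((n + 1 : ℕ) : ℂ) - n) * τ) = 2 * π * I * τ := by push_cast; ring
      rw [this, mul_comm]
  · intro τ
    have e : ∀ c : ℤ, cexp (2 * π * I * c * (τ + 1)) = cexp (2 * π * I * c * τ) := by
      intro c
      rw [Complex.exp_eq_exp_iff_exists_int]
      exact ⟨c, by ring⟩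
    have e1 : cexp (2 * π * I * (τ + 1)) = cexp (2 * π * I * τ) := by simpa using e 1
    have e2 : ∀ m : ℕ, cexp (2 * π * I * ((m : ℂ) - n) * (τ + 1))
        = cexp (2 * π * I * ((m : ℂ) - n) * τ) := fun m => by simpa using e (m - n)
    simp only [e1, e2]
    ring

/-- The integrand `u^{-5/2} exp(a u + b/u)`. -/
def kernelFn (a b : ℝ) (u : ℂ) : ℂ :=
  Complex.sqrt u⁻¹ * (u⁻¹) ^ 2 * cexp (a * u + b * u⁻¹)

/-- The integral of `u^{-5/2} exp(a u + b/u)` along the line `Re u = c`. -/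
def kernelIntegral (c a b : ℝ) : ℂ := ∫ t : ℝ, kernelFn a b (c + I * t)

theorem add_I_mul_re (c t : ℝ) : ((c : ℂ) + I * t).re = c := by simp

theorem norm_add_I_mul_ge {c t : ℝ} (hc : 0 < c) : (c + |t|) / 2 ≤ ‖(c : ℂ) + I * t‖ := by
  have h1 := Complex.abs_re_le_norm ((c : ℂ) + I * t)
  have h2 := Complex.abs_im_le_norm ((c : ℂ) + I * t)
  have e : ((c : ℂ) + I * t).im = t := by simp
  rw [add_I_mul_re, abs_of_pos hc] at h1
  rw [e] at h2
  linarith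

theorem continuous_kernelFn {c : ℝ} (hc : 0 < c) (a b : ℝ) :
    Continuous fun t : ℝ => kernelFn a b (c + I * t) := by
  have hne : ∀ t : ℝ, (c : ℂ) + I * t ≠ 0 := fun t =>
    ne_zero_of_re_pos' (by rw [add_I_mul_re]; exact hc)
  have h1 : Continuous fun t : ℝ => ((c : ℂ) + I * t)⁻¹ := by
    refine Continuous.inv₀ (by fun_prop) hne
  have h2 : Continuous fun t : ℝ => Complex.sqrt ((c : ℂ) + I * t)⁻¹ := by
    refine continuous_iff_continuousAt.2 fun t => ?_
    refine ContinuousAt.comp (f := fun t : ℝ => ((c : ℂ) + I * t)⁻¹) (g := Complex.sqrt) ?_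
      h1.continuousAt
    exact continuousAt_sqrt (Or.inl (inv_re_pos (by rw [add_I_mul_re]; exact hc)).le)
  unfold kernelFn
  fun_prop

/-- On the line |u| ≥ (c+|t|)/2 and Re(1/u) ≤ 1/c; the constant 8 bounds 2^(5/2). -/
theorem norm_kernelFn_le {c : ℝ} (hc : 0 < c) {a b : ℝ} (hb : 0 ≤ b) (t : ℝ) :
    ‖kernelFn a b (c + I * t)‖ ≤ 8 * rexp (a * c + b / c) * (c + |t|) ^ (-(5 / 2) : ℝ) := by
  set u : ℂ := c + I * t with hu
  have hre : u.re = c := add_I_mul_re c t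
  have hct : 0 < c + |t| := by positivity
  have hu0 : 0 < ‖u‖ := norm_pos_iff.2 (ne_zero_of_re_pos' (by rw [hre]; exact hc))
  have hge := norm_add_I_mul_ge (t := t) hc
  rw [← hu] at hge
  have h1 : ‖kernelFn a b u‖ = ‖u‖ ^ (-(5 / 2) : ℝ) * rexp (a * c + b * (u⁻¹).re) := by
    rw [kernelFn, norm_mul, norm_mul, norm_sqrt_complex, norm_pow, norm_inv, Complex.norm_exp,
      add_re, re_ofReal_mul, re_ofReal_mul, hre]
    congr 1
    rw [Real.sqrt_inv, Real.sqrt_eq_rpow, ← Real.rpow_neg hu0.le, inv_pow, ← Real.rpow_natCast,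
      ← Real.rpow_neg hu0.le, ← Real.rpow_add hu0]
    norm_num
  have h2 : (u⁻¹).re ≤ 1 / c := by
    rw [inv_re, hre, div_le_div_iff₀ (normSq_pos.2 (norm_pos_iff.1 hu0)) hc, normSq_apply, hre]
    nlinarith [mul_self_nonneg u.im]
  have h3 : ‖u‖ ^ (-(5 / 2) : ℝ) ≤ ((c + |t|) / 2) ^ (-(5 / 2) : ℝ) :=
    Real.rpow_le_rpow_of_nonpos (by positivity) hge (by norm_num)
  have h4 : ((c + |t|) / 2) ^ (-(5 / 2) : ℝ) ≤ 8 * (c + |t|) ^ (-(5 / 2) : ℝ) := by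
    rw [Real.div_rpow hct.le (by norm_num), div_eq_mul_inv, mul_comm]
    refine mul_le_mul_of_nonneg_right ?_ (by positivity)
    rw [Real.rpow_neg (by norm_num), inv_inv]
    calc (2 : ℝ) ^ (5 / 2 : ℝ) ≤ (2 : ℝ) ^ (3 : ℝ) :=
          Real.rpow_le_rpow_of_exponent_le (by norm_num) (by norm_num)
      _ = 8 := by norm_num
  have h5 : rexp (a * c + b * (u⁻¹).re) ≤ rexp (a * c + b / c) := by
    rw [Real.exp_le_exp]
    have := mul_le_mul_of_nonneg_left h2 hb
    rw [mul_one_div] at this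
    linarith
  rw [h1]
  calc _ ≤ (8 * (c + |t|) ^ (-(5 / 2) : ℝ)) * rexp (a * c + b / c) :=
        mul_le_mul (h3.trans h4) h5 (Real.exp_pos _).le (by positivity)
    _ = _ := by ring

open MeasureTheory Set

theorem integrableOn_add_rpow {c T : ℝ} (h : 0 < c + T) :
    IntegrableOn (fun t : ℝ => (c + t) ^ (-(5 / 2) : ℝ)) (Ioi T) := by
  have := integrableOn_Ioi_rpow_of_lt (show (-(5 / 2) : ℝ) < -1 by norm_num) h
  have h2 := (measurePreserving_add_left volume c).integrableOn_comp_preimage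
    (measurableEmbedding_addLeft c) (f := fun t : ℝ => t ^ (-(5 / 2) : ℝ)) (s := Ioi (c + T))
  have e : (fun x => c + x) ⁻¹' Ioi (c + T) = Ioi T := by ext x; simp
  rw [e] at h2
  exact h2.2 this

theorem integral_add_rpow {c T : ℝ} (h : 0 < c + T) :
    ∫ t in Ioi T, (c + t) ^ (-(5 / 2) : ℝ) = 2 / 3 * (c + T) ^ (-(3 / 2) : ℝ) := by
  have := integral_Ioi_rpow_of_lt (show (-(5 / 2) : ℝ) < -1 by norm_num) h
  have h2 := (measurePreserving_add_left volume c).setIntegral_preimage_emb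
    (measurableEmbedding_addLeft c) (fun t : ℝ => t ^ (-(5 / 2) : ℝ)) (Ioi (c + T))
  have e : (fun x => c + x) ⁻¹' Ioi (c + T) = Ioi T := by ext x; simp
  rw [e] at h2
  rw [h2, this]
  norm_num
  ring

theorem norm_integral_Ioi_le {F : ℝ → ℂ} {c T D : ℝ} (hc : 0 < c) (hT : 0 ≤ T)
    (hF : ∀ t, ‖F t‖ ≤ D * (c + |t|) ^ (-(5 / 2) : ℝ)) :
    ‖∫ t in Ioi T, F t‖ ≤ D * (2 / 3 * (c + T) ^ (-(3 / 2) : ℝ)) := by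
  have h0 : 0 < c + T := by linarith
  rw [← integral_add_rpow h0, ← integral_const_mul]
  refine norm_integral_le_of_norm_le ((integrableOn_add_rpow h0).const_mul D) ?_
  refine (ae_restrict_iff' measurableSet_Ioi).2 (Filter.Eventually.of_forall fun t ht => ?_)
  have := hF t
  rwa [abs_of_nonneg (hT.trans (le_of_lt ht))] at this

theorem integrable_of_norm_le {F : ℝ → ℂ} {c D : ℝ} (hc : 0 < c) (hcont : Continuous F)
    (hF : ∀ t, ‖F t‖ ≤ D * (c + |t|) ^ (-(5 / 2) : ℝ)) : Integrable F := by
  have h0 : 0 < c + 0 := by linarith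
  have key : ∀ {E : ℝ → ℂ}, Continuous E → (∀ t, ‖E t‖ ≤ D * (c + |t|) ^ (-(5 / 2) : ℝ)) →
      IntegrableOn E (Ioi 0) := by
    intro E hE hb
    refine Integrable.mono' ((integrableOn_add_rpow h0).const_mul D) hE.aestronglyMeasurable ?_
    refine (ae_restrict_iff' measurableSet_Ioi).2 (Filter.Eventually.of_forall fun t ht => ?_)
    have := hb t
    rwa [abs_of_pos ht] at this
  have h1 := key hcont hF
  have h2 := key (E := fun t => F (-t)) (hcont.comp continuous_neg) (fun t => by
    simpa using hF (-t))
  have h3 : IntegrableOn F (Iic 0) := by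
    rw [← neg_zero, ← integrableOn_Ici_iff_integrableOn_Ioi] at h2
    have := (Measure.measurePreserving_neg (volume : Measure ℝ)).integrableOn_comp_preimage
      (Homeomorph.neg ℝ).measurableEmbedding (f := F) (s := Iic 0)
    have e : (fun x : ℝ => -x) ⁻¹' Iic 0 = Ici 0 := by ext x; simp
    rw [neg_zero] at h2
    exact this.1 (by rw [show (Neg.neg : ℝ → ℝ) ⁻¹' Iic 0 = Ici 0 from e]; exact h2)
  have := h3.union h1
  rwa [Iic_union_Ioi, integrableOn_univ] at this

theorem norm_integral_sub_intervalIntegral_le {F : ℝ → ℂ} {c D t₁ t₂ : ℝ} (hc : 0 < c)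
    (hcont : Continuous F) (hF : ∀ t, ‖F t‖ ≤ D * (c + |t|) ^ (-(5 / 2) : ℝ)) (h1 : 0 ≤ t₁)
    (h2 : 0 ≤ t₂) : ‖(∫ t, F t) - ∫ t in (-t₁)..t₂, F t‖
      ≤ D * (2 / 3 * (c + t₁) ^ (-(3 / 2) : ℝ)) + D * (2 / 3 * (c + t₂) ^ (-(3 / 2) : ℝ)) := by
  have hint := integrable_of_norm_le hc hcont hF
  have e1 : ∫ t, F t = (∫ t in Iic (-t₁), F t) + (∫ t in (-t₁)..t₂, F t) + ∫ t in Ioi t₂, F t := by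
    rw [← intervalIntegral.integral_Iic_add_Ioi (b := t₂) hint.integrableOn hint.integrableOn,
      ← intervalIntegral.integral_Iic_sub_Iic hint.integrableOn hint.integrableOn]
    ring
  have e2 : ∫ t in Iic (-t₁), F t = ∫ t in Ioi t₁, F (-t) := by
    rw [integral_comp_neg_Ioi]
  rw [e1, e2]
  have b1 := norm_integral_Ioi_le (F := fun t => F (-t)) hc h1 (fun t => by simpa using hF (-t))
  have b2 := norm_integral_Ioi_le hc h2 hF
  refine le_trans (le_of_eq (congrArg norm ?_)) (norm_add_le_of_le b1 b2)
  ring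

end Rademacher

end

/-! ### The circle method. -/

noncomputable section

namespace Rademacher

open Complex Real

theorem mem_closedBall_ofReal_iff {ρ : ℝ} (hρ : 0 ≤ ρ) (w : ℂ) :
    w ∈ Metric.closedBall (ρ : ℂ) ρ ↔ normSq w ≤ 2 * ρ * w.re := by
  rw [Metric.mem_closedBall, dist_eq_norm, ← sq_le_sq₀ (norm_nonneg _) hρ, ← normSq_eq_norm_sq,
    normSq_apply, normSq_apply]
  simp only [sub_re, sub_im, ofReal_re, ofReal_im, sub_zero]
  constructor <;> intro h <;> nlinarith

theorem mem_ball_one_one {w : ℂ} (h0 : 0 < w.re) (h : normSq w ≤ w.re) :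
    w ∈ Metric.ball (1 : ℂ) 1 := by
  rw [Metric.mem_ball, dist_eq_norm, ← sq_lt_sq₀ (norm_nonneg _) zero_le_one, ← normSq_eq_norm_sq,
    normSq_apply]
  rw [normSq_apply] at h
  simp only [sub_re, sub_im, one_re, one_im, sub_zero]
  nlinarith

theorem re_pos_of_mem_ball_one_one {w : ℂ} (h : w ∈ Metric.ball (1 : ℂ) 1) : 0 < w.re := by
  rw [Metric.mem_ball, dist_eq_norm] at h
  have := (abs_re_le_norm (w - 1)).trans_lt h
  rw [abs_lt] at this
  simp at this
  linarith [this.1]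

theorem le_inv_re_iff {w : ℂ} (hw : 0 < w.re) (c : ℝ) : c ≤ (w⁻¹).re ↔ c * normSq w ≤ w.re := by
  rw [inv_re, le_div_iff₀ (normSq_pos.2 (ne_zero_of_re_pos' hw))]

/-- The function `√w exp(a/w + bw)`. -/
def segmentFn (a b : ℝ) (w : ℂ) : ℂ := Complex.sqrt w * cexp (a * w⁻¹ + b * w)

/-- The substitution w = 1/u, with dw = -du/u², which turns the Ford circle Re(1/w) = k² into the
line Re u = k². -/
theorem kernelFn_eq_segmentFn (a b : ℝ) (u : ℂ) :
    kernelFn a b u = segmentFn a b u⁻¹ * (u⁻¹) ^ 2 := by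
  rw [kernelFn, segmentFn, inv_inv]; ring

/-- The disc |w - 1| < 1 avoids 0 and the branch cut of √w, and contains every w with Re(1/w) ≥ 1,
hence all punctured Ford discs at once. -/
theorem exists_primitive_segmentFn (a b : ℝ) :
    ∃ M : ℂ → ℂ, ∀ w ∈ Metric.ball (1 : ℂ) 1, HasDerivAt M (segmentFn a b w) w := by
  have : DifferentiableOn ℂ (segmentFn a b) (Metric.ball 1 1) := by
    intro w hw
    have hre := re_pos_of_mem_ball_one_one hw
    have h1 := (differentiableAt_sqrt (z := w) (Or.inl hre))
    have h2 : DifferentiableAt ℂ (fun w : ℂ => cexp (a * w⁻¹ + b * w)) w := by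
      have : DifferentiableAt ℂ (fun w : ℂ => w⁻¹) w := differentiableAt_inv (ne_zero_of_re_pos' hre)
      fun_prop
    exact (h1.mul h2).differentiableWithinAt
  exact this.isExactOn_ball

theorem intervalIntegral_kernelFn {c : ℝ} (hc : 1 ≤ c) {a b : ℝ} {M : ℂ → ℂ}
    (hM : ∀ w ∈ Metric.ball (1 : ℂ) 1, HasDerivAt M (segmentFn a b w) w) (t₁ t₂ : ℝ) :
    ∫ t in t₁..t₂, kernelFn a b (c + I * t)
      = I * (M ((c : ℂ) + I * t₂)⁻¹ - M ((c : ℂ) + I * t₁)⁻¹) := by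
  have hc0 : 0 < c := by linarith
  have key : ∀ t : ℝ, HasDerivAt (fun t : ℝ => I * M ((c : ℂ) + I * t)⁻¹)
      (kernelFn a b (c + I * t)) t := by
    intro t
    set u : ℂ := (c : ℂ) + I * t with hu
    have hre : 0 < u.re := by rw [hu, add_I_mul_re]; exact hc0
    have hu0 := ne_zero_of_re_pos' hre
    have hball : u⁻¹ ∈ Metric.ball (1 : ℂ) 1 := by
      refine mem_ball_one_one (inv_re_pos hre) ?_
      rw [map_inv₀, inv_re, ← one_div, hu, add_I_mul_re]
      gcongr
      exact normSq_nonneg _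
    have h1 : HasDerivAt (fun t : ℝ => (c : ℂ) + I * t) I t := by
      have := ((Complex.ofRealCLM.hasDerivAt (x := t)).const_mul I).const_add (c : ℂ)
      simpa using this
    have h2 := h1.fun_inv hu0
    have h3 := ((hM _ hball).comp t h2).const_mul I
    refine h3.congr_deriv ?_
    rw [kernelFn_eq_segmentFn, ← hu, div_eq_mul_inv, inv_pow]
    linear_combination (-segmentFn a b u⁻¹ * (u ^ 2)⁻¹) * I_sq
  rw [intervalIntegral.integral_eq_sub_of_hasDerivAt (fun t _ => key t)
    ((continuous_kernelFn hc0 a b).intervalIntegrable _ _)]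
  ring

/-- Two errors. On the chord, |w| ≤ δ = 2/(kN) and the length is at most 2δ, so the mean value
inequality gives O(√k δ^(3/2)). Completing the line costs tails beyond k·k₁ and k·k₂, of size (k² +
k·kᵢ)^(-3/2) ≤ (kN)^(-3/2), because neighbouring denominators satisfy k + kᵢ > N. -/
theorem ford_arc_estimate {Φ B : ℂ → ℂ} (hΦ : ∀ τ : ℂ, 0 < τ.im → HasDerivAt Φ (B τ) τ)
    {h k N k₁ k₂ : ℕ} (hk : 0 < k) (hN : 1 ≤ N) (h1 : N < k₁ + k) (h2 : N < k₂ + k)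
    {A : ℂ} {α β K : ℝ} (hβ : 0 ≤ β) (hK : 0 ≤ K) (hA : ‖A‖ ≤ K * √k)
    (H : ∀ w : ℂ, 0 < w.re → (k : ℝ) ^ 2 ≤ (w⁻¹).re →
      ‖B (h / k + I * w) - A * segmentFn (α / k ^ 2) β w‖ ≤ K * (√k * √‖w‖)) :
    ‖Φ (fordPoint h k k₂) - Φ (fordPoint h k (-k₁)) - A * kernelIntegral (k ^ 2) (α / k ^ 2) β‖
      ≤ K * (16 + 11 * rexp (α + β)) * (√k * ((k : ℝ) * N) ^ (-(3 / 2) : ℝ)) := by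
  have hkR : (1 : ℝ) ≤ k := by exact_mod_cast hk
  have hk0 : (0 : ℝ) < k := by linarith
  have hNR : (1 : ℝ) ≤ N := by exact_mod_cast hN
  have hkN : (0 : ℝ) < k * N := by positivity
  have hc : (1 : ℝ) ≤ (k : ℝ) ^ 2 := one_le_pow₀ hkR
  have hc0 : (0 : ℝ) < (k : ℝ) ^ 2 := by positivity
  set X := ((k : ℝ) * N) ^ (-(3 / 2) : ℝ) with hX
  have hX0 : 0 < X := Real.rpow_pos_of_pos hkN _
  obtain ⟨M, hM⟩ := exists_primitive_segmentFn (α / k ^ 2) β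
  have hint := intervalIntegral_kernelFn hc hM (-((k : ℝ) * k₁)) ((k : ℝ) * k₂)
  -- the end points of the chord
  set w₁ : ℂ := (((k : ℝ) ^ 2 : ℝ) + I * (-((k : ℝ) * k₁) : ℝ) : ℂ)⁻¹ with hw₁
  set w₂ : ℂ := (((k : ℝ) ^ 2 : ℝ) + I * ((k : ℝ) * k₂ : ℝ) : ℂ)⁻¹ with hw₂
  have f1 : fordPoint h k (-k₁) = h / k + I * w₁ := by rw [fordPoint, hw₁]; push_cast; ring_nf
  have f2 : fordPoint h k k₂ = h / k + I * w₂ := by rw [fordPoint, hw₂]; push_cast; ring_nf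
  set δ : ℝ := 2 / (k * N) with hδ
  -- A convex set containing both end points: the punctured Ford disc, where the approximation
  -- holds, cut down to |w| ≤ δ.
  set S : Set ℂ := {w | 0 < w.re} ∩ Metric.closedBall (((1 / (2 * (k : ℝ) ^ 2) : ℝ)) : ℂ)
    (1 / (2 * (k : ℝ) ^ 2)) ∩ Metric.closedBall 0 δ with hS
  have hconv : Convex ℝ S :=
    ((convex_halfSpace_re_gt 0).inter (convex_closedBall _ _)).inter (convex_closedBall _ _)
  have hmem : ∀ (t : ℝ), k * N ≤ (k : ℝ) ^ 2 + |t| →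
      (((k : ℝ) ^ 2 : ℝ) + I * t : ℂ)⁻¹ ∈ S := by
    intro t ht
    have hre : 0 < ((((k : ℝ) ^ 2 : ℝ) : ℂ) + I * t).re := by rw [add_I_mul_re]; exact hc0
    have hpos := inv_re_pos hre
    refine ⟨⟨hpos, ?_⟩, ?_⟩
    · rw [mem_closedBall_ofReal_iff (by positivity), map_inv₀, inv_re, add_I_mul_re]
      apply le_of_eq
      field_simp
    · rw [mem_closedBall_zero_iff, norm_inv, hδ, ← inv_div]
      refine inv_anti₀ (by positivity) ?_
      have := norm_add_I_mul_ge (t := t) hc0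
      linarith
  have hm1 : w₁ ∈ S := by
    refine hmem _ ?_
    rw [abs_neg, abs_of_nonneg (by positivity)]
    have : (N : ℝ) ≤ k₁ + k := by exact_mod_cast h1.le
    nlinarith
  have hm2 : w₂ ∈ S := by
    refine hmem _ ?_
    rw [abs_of_nonneg (by positivity)]
    have : (N : ℝ) ≤ k₂ + k := by exact_mod_cast h2.le
    nlinarith
  have hSprop : ∀ w ∈ S, 0 < w.re ∧ (k : ℝ) ^ 2 ≤ (w⁻¹).re ∧ w ∈ Metric.ball (1 : ℂ) 1 ∧ ‖w‖ ≤ δ := by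
    rintro w ⟨⟨a1, a2⟩, a3⟩
    rw [mem_closedBall_ofReal_iff (by positivity)] at a2
    have a4 : (k : ℝ) ^ 2 * normSq w ≤ w.re := by
      have := mul_le_mul_of_nonneg_left a2 hc0.le
      have e : (k : ℝ) ^ 2 * (2 * (1 / (2 * (k : ℝ) ^ 2)) * w.re) = w.re := by field_simp
      rwa [e] at this
    refine ⟨a1, (le_inv_re_iff a1 _).2 a4, mem_ball_one_one a1 ?_, by simpa using a3⟩
    nlinarith [normSq_nonneg w]
  -- the error on the chord
  have hmv := hconv.norm_image_sub_le_of_norm_hasDerivWithin_le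
    (f := fun w => Φ (h / k + I * w) - A * I * M w)
    (f' := fun w => I * (B (h / k + I * w) - A * segmentFn (α / k ^ 2) β w))
    (C := K * (√k * √δ)) (fun w hw => by
      obtain ⟨a1, a2, a3, a4⟩ := hSprop w hw
      have him : 0 < ((h : ℂ) / k + I * w).im := by
        rw [show (h : ℂ) / k = ((h / k : ℝ) : ℂ) by push_cast; rfl, add_im, ofReal_im, zero_add,
          I_mul_im]
        exact a1
      have d1 : HasDerivAt (fun w : ℂ => (h : ℂ) / k + I * w) I w := by
        simpa using ((hasDerivAt_id w).const_mul I).const_add ((h : ℂ) / k)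
      have d2 := ((hΦ _ him).comp w d1).sub ((hM w a3).const_mul (A * I))
      refine (d2.congr_deriv ?_).hasDerivWithinAt
      ring) (fun w hw => by
      obtain ⟨a1, a2, a3, a4⟩ := hSprop w hw
      rw [norm_mul, norm_I, one_mul]
      refine (H w a1 a2).trans ?_
      gcongr) hm1 hm2
  have hδX : δ * √δ ≤ 4 * X := by
    have hδ0 : 0 < δ := by positivity
    have e1 : δ * √δ = δ ^ (3 / 2 : ℝ) := by
      rw [Real.sqrt_eq_rpow]
      nth_rewrite 1 [← Real.rpow_one δ]
      rw [← Real.rpow_add hδ0]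
      norm_num
    have e2 : δ ^ (3 / 2 : ℝ) = 2 ^ (3 / 2 : ℝ) * X := by
      rw [hδ, Real.div_rpow (by norm_num) hkN.le, hX, Real.rpow_neg hkN.le, div_eq_mul_inv]
    rw [e1, e2]
    refine mul_le_mul_of_nonneg_right ?_ hX0.le
    calc (2 : ℝ) ^ (3 / 2 : ℝ) ≤ 2 ^ (2 : ℝ) :=
          Real.rpow_le_rpow_of_exponent_le (by norm_num) (by norm_num)
      _ = 4 := by norm_num
  have hdist : ‖w₂ - w₁‖ ≤ 2 * δ := by
    have := norm_sub_le_of_le (hSprop _ hm2).2.2.2 (hSprop _ hm1).2.2.2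
    linarith
  have err1 : ‖Φ (h / k + I * w₂) - A * I * M w₂ - (Φ (h / k + I * w₁) - A * I * M w₁)‖
      ≤ K * 16 * (√k * X) := by
    refine hmv.trans ?_
    have hδ0 : 0 ≤ δ := by positivity
    calc K * (√k * √δ) * ‖w₂ - w₁‖ ≤ K * (√k * √δ) * (2 * δ) := by gcongr
      _ = K * √k * 2 * (δ * √δ) := by ring
      _ ≤ K * √k * 4 * (4 * X) := by
          have : 0 ≤ 4 * X := by positivity
          have : K * √k * 2 ≤ K * √k * 4 := by
            have : 0 ≤ K * √k := by positivity
            linarith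
          gcongr
      _ = _ := by ring
  -- the tails of the integral
  have hD := norm_kernelFn_le hc0 (a := α / k ^ 2) hβ
  have err2 := norm_integral_sub_intervalIntegral_le hc0
    (continuous_kernelFn hc0 (α / k ^ 2) β) hD (t₁ := (k : ℝ) * k₁) (t₂ := (k : ℝ) * k₂)
    (by positivity) (by positivity)
  have hexp : rexp (α / k ^ 2 * k ^ 2 + β / k ^ 2) ≤ rexp (α + β) := by
    rw [Real.exp_le_exp, div_mul_cancel₀ _ hc0.ne']
    have := div_le_self hβ hc
    linarith
  have hXle : ∀ {x : ℕ}, N < x + k → ((k : ℝ) ^ 2 + k * x) ^ (-(3 / 2) : ℝ) ≤ X := by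
    intro x hx
    refine Real.rpow_le_rpow_of_nonpos hkN ?_ (by norm_num)
    have : (N : ℝ) ≤ x + k := by exact_mod_cast hx.le
    nlinarith
  have err3 : ‖A * (kernelIntegral (k ^ 2) (α / k ^ 2) β
      - ∫ t in (-((k : ℝ) * k₁))..((k : ℝ) * k₂), kernelFn (α / k ^ 2) β (((k : ℝ) ^ 2 : ℝ) + I * t))‖
      ≤ K * (11 * rexp (α + β)) * (√k * X) := by
    rw [norm_mul]
    -- Two tails, each with constant 8 · 2/3, and 32/3 ≤ 11.
    have hb : ‖kernelIntegral (k ^ 2) (α / k ^ 2) β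
      - ∫ t in (-((k : ℝ) * k₁))..((k : ℝ) * k₂), kernelFn (α / k ^ 2) β (((k : ℝ) ^ 2 : ℝ) + I * t)‖
        ≤ 11 * rexp (α + β) * X := by
      refine err2.trans ?_
      have p := Real.exp_pos (α / k ^ 2 * k ^ 2 + β / k ^ 2)
      have q1 : 8 * rexp (α / k ^ 2 * k ^ 2 + β / k ^ 2)
          * (2 / 3 * ((k : ℝ) ^ 2 + k * k₁) ^ (-(3 / 2) : ℝ)) ≤ 8 * rexp (α + β) * (2 / 3 * X) := by
        have := hXle h1
        gcongr
      have q2 : 8 * rexp (α / k ^ 2 * k ^ 2 + β / k ^ 2)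
          * (2 / 3 * ((k : ℝ) ^ 2 + k * k₂) ^ (-(3 / 2) : ℝ)) ≤ 8 * rexp (α + β) * (2 / 3 * X) := by
        have := hXle h2
        gcongr
      have : 0 ≤ rexp (α + β) * X := by positivity
      nlinarith
    calc _ ≤ (K * √k) * (11 * rexp (α + β) * X) := mul_le_mul hA hb (norm_nonneg _) (by positivity)
      _ = _ := by ring
  rw [hint] at err3
  rw [f1, f2]
  refine le_trans (le_of_eq (congrArg norm ?_)) ((norm_sub_le_of_le err1 err3).trans (le_of_eq ?_))
  · ring
  · ring

open Filter Topology in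
/-- The circle method: the `n`-th coefficient of a power series whose sum is well approximated on the
Ford circles. -/
theorem tendsto_sum_kernelIntegral {a : PowerSeries ℂ} {g : ℂ → ℂ} (ha : IsSumOnDisc a g) (n : ℕ)
    {A : ℕ → ℕ → ℂ} {α : ℕ → ℝ} {β K : ℝ} (hβ : 0 ≤ β) (hK : 0 ≤ K) (hα : ∀ k, α k ≤ K)
    (hA : ∀ h k, ‖A h k‖ ≤ K * √k)
    (H : ∀ (k h : ℕ) (w : ℂ), 0 < k → Nat.Coprime h k → 0 < w.re → (k : ℝ) ^ 2 ≤ (w⁻¹).re →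
      ‖g (cexp (2 * π * I * (h / k + I * w))) * cexp (-(2 * π * I * n * (h / k + I * w)))
        - A h k * segmentFn (α k / k ^ 2) β w‖ ≤ K * (√k * √‖w‖)) :
    Tendsto (fun N : ℕ => ∑ k ∈ Finset.Icc 1 N,
        (∑ h ∈ reduced k, A h k) * kernelIntegral (k ^ 2) (α k / k ^ 2) β)
      atTop (𝓝 (PowerSeries.coeff n a)) := by
  obtain ⟨Φ, hΦ, hper⟩ := ha.exists_primitive n
  set C : ℝ := K * (16 + 11 * rexp (K + β)) with hC
  have hbound : ∀ N : ℕ, 1 ≤ N → ‖(∑ k ∈ Finset.Icc 1 N,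
      (∑ h ∈ reduced k, A h k) * kernelIntegral (k ^ 2) (α k / k ^ 2) β)
      - PowerSeries.coeff n a‖ ≤ C * (N : ℝ) ^ (-(1 / 2) : ℝ) := by
    intro N hN
    have hNR : (0 : ℝ) < N := by exact_mod_cast hN
    rw [← sum_fordPoint_sub (fun τ _ => hper τ) hN, ← Finset.sum_sub_distrib]
    have hk : ∀ k ∈ Finset.Icc 1 N, ‖(∑ h ∈ reduced k, A h k)
        * kernelIntegral (k ^ 2) (α k / k ^ 2) β
        - ∑ h ∈ reduced k, (Φ (fordPoint h k (fareyNeighbour N h k (-1)))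
          - Φ (fordPoint h k (-(fareyNeighbour N h k 1 : ℤ))))‖ ≤ C * (N : ℝ) ^ (-(3 / 2) : ℝ) := by
      intro k hk
      rw [Finset.mem_Icc] at hk
      have hk0 : (0 : ℝ) < k := by exact_mod_cast hk.1
      rw [Finset.sum_mul, ← Finset.sum_sub_distrib]
      have hone : ∀ h ∈ reduced k, ‖A h k * kernelIntegral (k ^ 2) (α k / k ^ 2) β
          - (Φ (fordPoint h k (fareyNeighbour N h k (-1)))
          - Φ (fordPoint h k (-(fareyNeighbour N h k 1 : ℤ))))‖
          ≤ C * (√k * ((k : ℝ) * N) ^ (-(3 / 2) : ℝ)) := by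
        intro h hh
        have hc : Nat.Coprime h k := by
          rw [reduced, Finset.mem_filter] at hh; exact hh.2
        obtain ⟨s1, -, -⟩ := fareyNeighbour_spec hk.1 hk.2 hc (-1)
        obtain ⟨s2, -, -⟩ := fareyNeighbour_spec hk.1 hk.2 hc 1
        rw [norm_sub_rev]
        refine (ford_arc_estimate hΦ hk.1 hN s2 s1 hβ hK (hA h k)
          (fun w hw1 hw2 => H k h w hk.1 hc hw1 hw2)).trans ?_
        have := hα k
        rw [hC]
        gcongr
      refine (norm_sum_le_of_le _ hone).trans ?_
      rw [Finset.sum_const, nsmul_eq_mul]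
      have hcard : ((reduced k).card : ℝ) ≤ k := by
        have := Finset.card_filter_le (Finset.range k) (fun h => Nat.gcd h k = 1)
        rw [Finset.card_range] at this
        exact_mod_cast this
      have hC0 : 0 ≤ C := by positivity
      -- There are at most k numerators and k · √k · k^(-3/2) = 1, so the bound N^(-3/2) does not
      -- depend on k; the N denominators then give N^(-1/2).
      calc _ ≤ (k : ℝ) * (C * (√k * ((k : ℝ) * N) ^ (-(3 / 2) : ℝ))) := by gcongr
        _ = C * (N : ℝ) ^ (-(3 / 2) : ℝ) * ((k : ℝ) * √k * (k : ℝ) ^ (-(3 / 2) : ℝ)) := by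
            rw [Real.mul_rpow hk0.le hNR.le]; ring
        _ = _ := by
            have : (k : ℝ) * √k * (k : ℝ) ^ (-(3 / 2) : ℝ) = 1 := by
              rw [Real.sqrt_eq_rpow]
              nth_rewrite 1 [← Real.rpow_one (k : ℝ)]
              rw [← Real.rpow_add hk0, ← Real.rpow_add hk0]
              norm_num
            rw [this, mul_one]
    refine (norm_sum_le_of_le _ hk).trans (le_of_eq ?_)
    rw [Finset.sum_const, nsmul_eq_mul, Nat.card_Icc, Nat.add_sub_cancel]
    have : (N : ℝ) * (N : ℝ) ^ (-(3 / 2) : ℝ) = (N : ℝ) ^ (-(1 / 2) : ℝ) := by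
      nth_rewrite 1 [← Real.rpow_one (N : ℝ)]
      rw [← Real.rpow_add hNR]
      norm_num
    rw [← this]; ring
  rw [tendsto_iff_norm_sub_tendsto_zero]
  have hlim : Tendsto (fun N : ℕ => C * (N : ℝ) ^ (-(1 / 2) : ℝ)) atTop (𝓝 0) := by
    have := ((tendsto_rpow_neg_atTop (show (0 : ℝ) < 1 / 2 by norm_num)).comp
      tendsto_natCast_atTop_atTop).const_mul C
    simpa using this
  refine squeeze_zero' (Eventually.of_forall fun N => norm_nonneg _) ?_ hlim
  filter_upwards [eventually_ge_atTop 1] with N hN using hbound N hN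

end Rademacher

end

/-! ### Evaluation of the kernel integral in elementary terms. -/

noncomputable section

namespace Rademacher

open Complex Real MeasureTheory Set Filter Topology

theorem integrableOn_rpow_mul_cexp {p : ℝ} (hp : -1 < p) {u : ℂ} (hu : 0 < u.re) :
    IntegrableOn (fun x : ℝ => ((x ^ p : ℝ) : ℂ) * cexp (-(u * x))) (Ioi 0) := by
  have h := integrableOn_rpow_mul_exp_neg_mul_rpow hp one_pos hu
  refine Integrable.mono' h ?_ ?_
  · exact (by fun_prop : Measurable fun x : ℝ =>
      ((x ^ p : ℝ) : ℂ) * cexp (-(u * x))).aestronglyMeasurable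
  · refine (ae_restrict_iff' measurableSet_Ioi).2 (Eventually.of_forall fun x hx => ?_)
    have hx0 : (0 : ℝ) < x := hx
    rw [norm_mul, Complex.norm_real, Real.norm_of_nonneg (by positivity), Complex.norm_exp,
      Real.rpow_one]
    simp

theorem differentiableOn_laplace_rpow {p : ℝ} (hp : -1 < p) :
    DifferentiableOn ℂ (fun u : ℂ => ∫ x in Ioi (0 : ℝ), ((x ^ p : ℝ) : ℂ) * cexp (-(u * x)))
      {u | 0 < u.re} := by
  intro u hu
  have hu : 0 < u.re := hu
  refine DifferentiableAt.differentiableWithinAt (HasDerivAt.differentiableAt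
    (hasDerivAt_integral_of_dominated_loc_of_deriv_le (μ := volume.restrict (Ioi 0))
      (s := {z : ℂ | u.re / 2 < z.re})
      (F := fun z x => ((x ^ p : ℝ) : ℂ) * cexp (-(z * x)))
      (F' := fun z x => ((x ^ p : ℝ) : ℂ) * (cexp (-(z * x)) * (-x)))
      (bound := fun x => x ^ (p + 1) * rexp (-(u.re / 2) * x ^ (1 : ℝ)))
      ?_ ?_ (integrableOn_rpow_mul_cexp hp hu) ?_ ?_ ?_ ?_).2)
  · exact (isOpen_lt continuous_const continuous_re).mem_nhds (by simpa using by linarith)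
  · exact Eventually.of_forall fun z => (by fun_prop : Measurable fun x : ℝ =>
      ((x ^ p : ℝ) : ℂ) * cexp (-(z * x))).aestronglyMeasurable
  · exact (by fun_prop : Measurable fun x : ℝ =>
      ((x ^ p : ℝ) : ℂ) * (cexp (-(u * x)) * (-x))).aestronglyMeasurable
  · refine (ae_restrict_iff' measurableSet_Ioi).2 (Eventually.of_forall fun x hx z hz => ?_)
    have hx0 : (0 : ℝ) < x := hx
    have hz : u.re / 2 < z.re := hz
    rw [norm_mul, norm_mul, norm_neg, Complex.norm_real, Complex.norm_real,
      Real.norm_of_nonneg (by positivity), Real.norm_of_nonneg hx0.le, Complex.norm_exp,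
      Real.rpow_one, Real.rpow_add hx0, Real.rpow_one, mul_assoc, mul_comm x]
    have : rexp (-(z * x)).re ≤ rexp (-(u.re / 2) * x) := by
      rw [Real.exp_le_exp]
      simp
      nlinarith
    gcongr
  · exact integrableOn_rpow_mul_exp_neg_mul_rpow (by linarith) one_pos (by linarith)
  · refine Eventually.of_forall fun x z _ => HasDerivAt.const_mul _ ?_
    have := ((hasDerivAt_id z).mul_const (x : ℂ)).neg.cexp
    simpa using this

/-- For real u this is the Gamma integral; both sides are holomorphic in the right half plane, so
the identity theorem extends it. -/
theorem integral_rpow_mul_cexp {p : ℝ} (hp : -1 < p) {u : ℂ} (hu : 0 < u.re) :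
    ∫ x in Ioi (0 : ℝ), ((x ^ p : ℝ) : ℂ) * cexp (-(u * x))
      = (u⁻¹) ^ ((p : ℂ) + 1) * Real.Gamma (p + 1) := by
  have hopen : IsOpen {u : ℂ | 0 < u.re} := isOpen_lt continuous_const continuous_re
  have hconn : IsPreconnected {u : ℂ | 0 < u.re} := (convex_halfSpace_re_gt 0).isPreconnected
  have hd : DifferentiableOn ℂ (fun u : ℂ => (u⁻¹) ^ ((p : ℂ) + 1) * Real.Gamma (p + 1))
      {u | 0 < u.re} := by
    intro z hz
    have hz0 := ne_zero_of_re_pos' hz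
    refine DifferentiableAt.differentiableWithinAt (DifferentiableAt.mul_const ?_ _)
    exact (differentiableAt_inv hz0).cpow_const (Or.inl (inv_re_pos hz))
  refine ((differentiableOn_laplace_rpow hp).analyticOnNhd hopen)
    |>.eqOn_of_preconnected_of_frequently_eq (hd.analyticOnNhd hopen) hconn
    (z₀ := 1) (by simp) ?_ hu
  have hreal : ∀ r : ℝ, 0 < r → ∫ x in Ioi (0 : ℝ), ((x ^ p : ℝ) : ℂ) * cexp (-((r : ℂ) * x))
      = ((r : ℂ)⁻¹) ^ ((p : ℂ) + 1) * Real.Gamma (p + 1) := by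
    intro r hr
    have := Complex.integral_cpow_mul_exp_neg_mul_Ioi (a := (p : ℂ) + 1)
      (by simp; linarith) hr
    rw [← one_div, ← Complex.Gamma_ofReal, ofReal_add, ofReal_one, ← this]
    refine setIntegral_congr_fun measurableSet_Ioi fun x hx => ?_
    have hx0 : (0 : ℝ) < x := hx
    rw [add_sub_cancel_right, ofReal_cpow hx0.le]
  have ht : Tendsto (fun r : ℝ => (r : ℂ)) (𝓝[≠] 1) (𝓝[≠] 1) := by
    refine tendsto_nhdsWithin_iff.2 ⟨?_, ?_⟩
    · have : Tendsto (fun r : ℝ => (r : ℂ)) (𝓝 1) (𝓝 ((1 : ℝ) : ℂ)) :=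
        continuous_ofReal.continuousAt
      rw [ofReal_one] at this
      exact this.mono_left nhdsWithin_le_nhds
    · filter_upwards [self_mem_nhdsWithin] with r hr
      simpa using hr
  refine ht.frequently (Eventually.frequently ?_)
  have : ∀ᶠ r : ℝ in 𝓝[≠] 1, 0 < r := nhdsWithin_le_nhds (lt_mem_nhds one_pos)
  filter_upwards [this] with r hr using hreal r hr

theorem inv_cpow_add_five_halves {u : ℂ} (hu : u ≠ 0) (m : ℕ) :
    (u⁻¹) ^ ((((m : ℝ) + 3 / 2 : ℝ) : ℂ) + 1) = Complex.sqrt u⁻¹ * (u⁻¹) ^ (m + 2) := by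
  rw [Complex.sqrt, ← Complex.cpow_natCast, ← Complex.cpow_add _ _ (inv_ne_zero hu)]
  congr 1
  push_cast
  ring

theorem norm_inv_add_I_mul_pow_le {c : ℝ} (hc : 0 < c) (t : ℝ) (m : ℕ) :
    ‖((c + I * t : ℂ)⁻¹) ^ m‖ ≤ (c⁻¹) ^ m := by
  rw [norm_pow, norm_inv]
  have h := Complex.abs_re_le_norm ((c : ℂ) + I * t)
  rw [add_I_mul_re, abs_of_pos hc] at h
  gcongr

/-- The inverse Laplace transform of `u^{-m-5/2}`. -/
theorem integral_kernelFn_mul_inv_pow {c a : ℝ} (hc : 0 < c) (ha : 0 < a) (m : ℕ) :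
    ∫ t : ℝ, kernelFn a 0 (c + I * t) * ((c + I * t : ℂ)⁻¹) ^ m
      = ((2 * π * a ^ ((m : ℝ) + 3 / 2) / Real.Gamma (m + 5 / 2) : ℝ) : ℂ) := by
  set p : ℝ := m + 3 / 2 with hp
  have hp0 : 0 < p := by positivity
  have hp1 : -1 < p := by linarith
  -- On Re u = c the Laplace transform of x^p is the Fourier transform of this function, so the
  -- integral is Fourier inversion at the point `a`.
  set f : ℝ → ℂ := (Ioi (0 : ℝ)).indicator fun x : ℝ => ((x ^ p : ℝ) : ℂ) * cexp (-((c : ℂ) * x))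
    with hf
  have hfint : Integrable f :=
    (integrable_indicator_iff measurableSet_Ioi).2 (integrableOn_rpow_mul_cexp hp1 (by simpa))
  set Kf : ℝ → ℂ := fun t => Complex.sqrt (c + I * t : ℂ)⁻¹ * ((c + I * t : ℂ)⁻¹) ^ (m + 2) with hKf
  have hΓ : Real.Gamma (p + 1) ≠ 0 := (Real.Gamma_pos_of_pos (by linarith)).ne'
  have hF : ∀ ξ : ℝ, FourierTransform.fourier f ξ = Kf (2 * π * ξ) * Real.Gamma (p + 1) := by
    intro ξ
    rw [Real.fourier_real_eq_integral_exp_smul]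
    have hre : 0 < ((c : ℂ) + I * (2 * π * ξ : ℝ)).re := by rw [add_I_mul_re]; exact hc
    have h := integral_rpow_mul_cexp hp1 hre
    rw [hp, inv_cpow_add_five_halves (ne_zero_of_re_pos' hre), ← hp] at h
    rw [hKf]
    simp only
    rw [← h, ← integral_indicator measurableSet_Ioi]
    congr 1
    ext x
    by_cases hx : x ∈ Ioi (0 : ℝ)
    · simp only [hf, indicator_of_mem hx, smul_eq_mul]
      rw [mul_left_comm, ← Complex.exp_add]
      congr 2
      push_cast
      ring
    · simp [hf, indicator_of_notMem hx]
  have hKcont : Continuous Kf := by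
    have h := (continuous_kernelFn hc 0 0).mul ((Continuous.inv₀ (f := fun t : ℝ => (c : ℂ) + I * t)
      (by fun_prop) (fun t => ne_zero_of_re_pos' (by rw [add_I_mul_re]; exact hc))).pow m)
    refine h.congr fun t => ?_
    simp only [hKf, kernelFn, ofReal_zero, zero_mul, add_zero, Complex.exp_zero, Pi.mul_apply,
      Pi.pow_apply, Pi.inv_apply]
    ring
  have hKint : Integrable Kf := by
    refine integrable_of_norm_le hc hKcont (D := 8 * (c⁻¹) ^ m) fun t => ?_
    have h := norm_kernelFn_le hc (a := 0) (b := 0) le_rfl t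
    have e : Kf t = kernelFn 0 0 (c + I * t) * ((c + I * t : ℂ)⁻¹) ^ m := by
      simp only [hKf, kernelFn, ofReal_zero, zero_mul, add_zero, Complex.exp_zero]
      ring
    have h2 := norm_inv_add_I_mul_pow_le hc t m
    rw [e, norm_mul]
    refine (mul_le_mul h h2 (norm_nonneg _) (by positivity)).trans (le_of_eq ?_)
    simp
    ring
  have hFint : Integrable (FourierTransform.fourier f) := by
    have := (hKint.comp_mul_left' (R := 2 * π) (by positivity)).mul_const (Real.Gamma (p + 1) : ℂ)
    exact this.congr (Eventually.of_forall fun ξ => (hF ξ).symm)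
  have hcontf : ContinuousAt f a := by
    have : (fun x : ℝ => ((x ^ p : ℝ) : ℂ) * cexp (-((c : ℂ) * x))) =ᶠ[𝓝 a] f := by
      filter_upwards [lt_mem_nhds ha] with x hx
      rw [hf, indicator_of_mem (show x ∈ Ioi (0 : ℝ) from hx)]
    refine ContinuousAt.congr ?_ this
    have h1 : ContinuousAt (fun x : ℝ => x ^ p) a :=
      Real.continuousAt_rpow_const a p (Or.inl ha.ne')
    have h2 : ContinuousAt (fun x : ℝ => ((x ^ p : ℝ) : ℂ)) a :=
      continuous_ofReal.continuousAt.comp h1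
    exact h2.mul (by fun_prop)
  have hinv := hfint.fourierInv_fourier_eq hFint hcontf
  rw [Real.fourierInv_eq'] at hinv
  have h1 : ∫ ξ : ℝ, cexp (((2 * π * inner ℝ ξ a : ℝ) : ℂ) * I) • FourierTransform.fourier f ξ
      = ∫ ξ : ℝ, (fun t : ℝ => cexp (I * a * t) * (Kf t * Real.Gamma (p + 1))) (2 * π * ξ) := by
    congr 1
    ext ξ
    rw [hF, smul_eq_mul]
    congr 2
    simp
    ring
  rw [h1, Measure.integral_comp_mul_left
    (fun t : ℝ => cexp (I * a * t) * (Kf t * Real.Gamma (p + 1))) (2 * π), hf, indicator_of_mem (show a ∈ Ioi (0 : ℝ) from ha)]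
    at hinv
  have h2 : ∫ t : ℝ, kernelFn a 0 (c + I * t) * ((c + I * t : ℂ)⁻¹) ^ m
      = ∫ t : ℝ, (cexp (a * c) / Real.Gamma (p + 1))
        * (cexp (I * a * t) * (Kf t * Real.Gamma (p + 1))) := by
    congr 1
    ext t
    have hΓ' : (Real.Gamma (p + 1) : ℂ) ≠ 0 := by exact_mod_cast hΓ
    have : cexp (a * (c + I * t) + ((0 : ℝ) : ℂ) * (c + I * t : ℂ)⁻¹)
        = cexp (a * c) * cexp (I * a * t) := by
      rw [← Complex.exp_add]
      congr 1
      push_cast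
      ring
    rw [kernelFn, this, hKf]
    simp only
    generalize (c + I * t : ℂ)⁻¹ = v
    field_simp
    ring
  rw [h2, integral_const_mul]
  rw [abs_of_pos (by positivity), real_smul, ofReal_inv] at hinv
  have hpi : ((2 * π : ℝ) : ℂ) ≠ 0 := by exact_mod_cast (by positivity : 2 * π ≠ 0)
  rw [inv_mul_eq_iff_eq_mul₀ hpi] at hinv
  rw [hinv, Complex.exp_neg, show (m : ℝ) + 5 / 2 = p + 1 by rw [hp]; ring]
  have := Complex.exp_ne_zero ((c : ℂ) * a)
  rw [mul_comm (a : ℂ) c]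
  push_cast
  field_simp

open scoped Nat

/-- The power series of the Bessel type integral `kernelIntegral`. -/
theorem hasSum_kernelIntegral {c a b : ℝ} (hc : 0 < c) (ha : 0 < a) (hb : 0 ≤ b) :
    HasSum (fun m : ℕ => ((b ^ m / m ! * (2 * π * a ^ ((m : ℝ) + 3 / 2)
      / Real.Gamma (m + 5 / 2)) : ℝ) : ℂ)) (kernelIntegral c a b) := by
  have hint : Integrable fun t : ℝ => kernelFn a 0 (c + I * t) :=
    integrable_of_norm_le hc (continuous_kernelFn hc a 0) (norm_kernelFn_le hc le_rfl)
  have hinv : Continuous fun t : ℝ => ((c : ℂ) + I * t)⁻¹ :=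
    Continuous.inv₀ (by fun_prop) fun t => ne_zero_of_re_pos' (by rw [add_I_mul_re]; exact hc)
  set F : ℕ → ℝ → ℂ := fun m t =>
    ((b ^ m / m ! : ℝ) : ℂ) * (kernelFn a 0 (c + I * t) * ((c + I * t : ℂ)⁻¹) ^ m) with hF
  have hle : ∀ m t, ‖F m t‖ ≤ (b / c) ^ m / m ! * ‖kernelFn a 0 (c + I * t)‖ := by
    intro m t
    rw [hF]
    simp only
    rw [norm_mul, norm_mul, Complex.norm_real, Real.norm_of_nonneg (by positivity)]
    calc _ ≤ b ^ m / m ! * (‖kernelFn a 0 (c + I * t)‖ * (c⁻¹) ^ m) := by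
          gcongr
          exact norm_inv_add_I_mul_pow_le hc t m
      _ = _ := by rw [div_eq_mul_inv b c, mul_pow]; ring
  have hFint : ∀ m, Integrable (F m) := by
    intro m
    refine (hint.norm.const_mul ((b / c) ^ m / m !)).mono' ?_ (Eventually.of_forall (hle m))
    have h1 := continuous_kernelFn hc a 0
    exact (by fun_prop : Continuous (F m)).aestronglyMeasurable
  -- Since |1/u| ≤ 1/c on the line, the series e^(b/c) dominates and justifies termwise integration.
  have hsum : Summable fun m => ∫ t, ‖F m t‖ := by
    refine Summable.of_nonneg_of_le (fun m => integral_nonneg fun t => norm_nonneg _)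
      (fun m => ?_) ((Real.summable_pow_div_factorial (b / c)).mul_right
        (∫ t : ℝ, ‖kernelFn a 0 (c + I * t)‖))
    rw [← integral_const_mul]
    exact integral_mono (hFint m).norm (hint.norm.const_mul _) (hle m)
  have h := hasSum_integral_of_summable_integral_norm hFint hsum
  have e1 : ∀ m, ∫ t, F m t = ((b ^ m / m ! * (2 * π * a ^ ((m : ℝ) + 3 / 2)
      / Real.Gamma (m + 5 / 2)) : ℝ) : ℂ) := by
    intro m
    rw [hF, integral_const_mul, integral_kernelFn_mul_inv_pow hc ha, ← ofReal_mul]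
  have e2 : ∫ t, ∑' m, F m t = kernelIntegral c a b := by
    rw [kernelIntegral]
    congr 1
    ext t
    have h1 := (NormedSpace.expSeries_div_hasSum_exp ((b : ℂ) * (c + I * t : ℂ)⁻¹)).mul_left
      (kernelFn a 0 (c + I * t))
    rw [← Complex.exp_eq_exp_ℂ] at h1
    have h2 : kernelFn a b (c + I * t)
        = kernelFn a 0 (c + I * t) * cexp ((b : ℂ) * (c + I * t : ℂ)⁻¹) := by
      rw [kernelFn, kernelFn, Complex.exp_add, ofReal_zero, zero_mul, add_zero]
      ring
    rw [h2, ← h1.tsum_eq]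
    refine tsum_congr fun m => ?_
    rw [hF, mul_pow]
    push_cast
    ring
  rw [e2] at h
  exact h.congr_fun fun m => (e1 m).symm

/-- A form of the duplication formula; the odd factorial is the one in the series of
`hasSum_mul_cosh_sub_sinh`. -/
theorem Gamma_add_five_halves (m : ℕ) :
    Real.Gamma (m + 5 / 2) * (2 ^ (2 * m + 3) * (m + 1)!) = √π * (2 * m + 3)! := by
  induction m with
  | zero =>
    have h1 : Real.Gamma (5 / 2) = 3 / 2 * (1 / 2 * √π) := by
      rw [← Real.Gamma_one_half_eq, ← Real.Gamma_add_one (by norm_num),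
        show (1 / 2 + 1 : ℝ) = 3 / 2 by norm_num, ← Real.Gamma_add_one (by norm_num)]
      norm_num
    simp [h1, Nat.factorial]
    ring
  | succ m ih =>
    have h1 : Real.Gamma ((m + 1 : ℕ) + 5 / 2) = (m + 5 / 2) * Real.Gamma (m + 5 / 2) := by
      rw [← Real.Gamma_add_one (by positivity)]
      push_cast
      ring_nf
    have h2 : (2 * (m + 1) + 3)! = (2 * m + 5) * ((2 * m + 4) * (2 * m + 3)!) := rfl
    have h3 : (m + 1 + 1)! = (m + 2) * (m + 1)! := rfl
    rw [h1, h2, h3]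
    push_cast
    rw [show 2 * (m + 1) + 3 = 2 * m + 3 + 2 by ring, pow_add]
    linear_combination (2 * m + 5 : ℝ) * (2 * m + 4) * ih

/-- The linear terms cancel, and 1/(2m+2)! - 1/(2m+3)! = 2(m+1)/(2m+3)!. -/
theorem hasSum_mul_cosh_sub_sinh (y : ℝ) :
    HasSum (fun m : ℕ => (m + 1) * y ^ (2 * m + 3) / (2 * m + 3)!)
      ((y * Real.cosh y - Real.sinh y) / 2) := by
  have h := (((Real.hasSum_cosh y).mul_left y).sub (Real.hasSum_sinh y)).div_const 2
  rw [← hasSum_nat_add_iff' 1] at h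
  simp only [Finset.sum_range_one, mul_zero, pow_zero, Nat.factorial_zero, Nat.cast_one, div_one,
    mul_one, zero_add, pow_one, Nat.factorial_one, sub_self, zero_div, sub_zero] at h
  refine h.congr_fun fun m => ?_
  have h1 : (2 * m + 3)! = (2 * m + 3) * (2 * (m + 1))! := rfl
  have h2 : (2 * (m + 1) + 1)! = (2 * m + 3) * (2 * (m + 1))! := rfl
  rw [h1, h2]
  have : ((2 * (m + 1))! : ℝ) ≠ 0 := by positivity
  push_cast
  field_simp
  ring

theorem hasDerivAt_sinh_sqrt_div_sqrt (γ : ℝ) {X : ℝ} (hX : 0 < X) :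
    HasDerivAt (fun X => Real.sinh (γ * √X) / √X)
      ((γ * √X * Real.cosh (γ * √X) - Real.sinh (γ * √X)) / 2 / (X * √X)) X := by
  have hs := Real.hasDerivAt_sqrt hX.ne'
  have h0 : √X ≠ 0 := (Real.sqrt_pos.2 hX).ne'
  refine ((hs.const_mul γ).sinh.div hs h0).congr_deriv ?_
  have hsq : √X ^ 2 = X := Real.sq_sqrt hX.le
  rw [← hsq, Real.sqrt_sq (Real.sqrt_nonneg _)]
  field_simp

/-- The derivative is (y cosh y - sinh y)/(2X√X) with y = γ√X. As y² = 4ab, its series agrees term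
by term with that of the kernel integral; in particular the value does not depend on c. -/
theorem kernelIntegral_eq_deriv_sinh {c a b γ X : ℝ} (hc : 0 < c) (ha : 0 < a) (hb : 0 ≤ b)
    (hγ : 0 < γ) (hX : 0 < X) (h : γ ^ 2 * X = 4 * a * b) :
    kernelIntegral c a b = ((16 * √π * a ^ (3 / 2 : ℝ) / γ ^ 3
      * deriv (fun X => Real.sinh (γ * √X) / √X) X : ℝ) : ℂ) := by
  rw [(hasDerivAt_sinh_sqrt_div_sqrt γ hX).deriv]
  refine (hasSum_kernelIntegral hc ha hb).unique ?_
  have h0 : 0 < √X := Real.sqrt_pos.2 hX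
  have h1 := ((hasSum_mul_cosh_sub_sinh (γ * √X)).div_const (X * √X)).mul_left
    (16 * √π * a ^ (3 / 2 : ℝ) / γ ^ 3)
  refine (Complex.hasSum_ofReal.2 h1).congr_fun fun m => ?_
  congr 1
  have hΓ := Gamma_add_five_halves m
  have hΓ0 : 0 < Real.Gamma (m + 5 / 2) := Real.Gamma_pos_of_pos (by positivity)
  have hpi : 0 < √π := Real.sqrt_pos.2 Real.pi_pos
  have hpi2 : √π ^ 2 = π := Real.sq_sqrt Real.pi_pos.le
  have e1 : (γ * √X) ^ (2 * m + 3) = γ ^ 3 * (X * √X) * (4 * a * b) ^ m := by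
    have hsq : √X ^ 2 = X := Real.sq_sqrt hX.le
    rw [← h, pow_add, pow_mul, mul_pow γ, hsq, mul_pow γ, pow_succ (√X), hsq]
    ring
  have e2 : a ^ ((m : ℝ) + 3 / 2) = a ^ m * a ^ (3 / 2 : ℝ) := by
    rw [Real.rpow_add ha, Real.rpow_natCast]
  have e3 : ((m + 1)! : ℝ) = (m + 1) * m ! := by rw [Nat.factorial_succ]; push_cast; ring
  have e4 : Real.Gamma (m + 5 / 2) = √π * (2 * m + 3)! / (2 ^ (2 * m + 3) * ((m + 1) * m !)) := by
    rw [eq_div_iff (by positivity), ← e3, hΓ]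
  have e5 : (2 : ℝ) ^ (2 * m + 3) = 8 * 4 ^ m := by
    rw [pow_add, pow_mul]; norm_num; ring
  rw [e1, e2, e4, e5, mul_pow, mul_pow]
  generalize a ^ (3 / 2 : ℝ) = α
  rw [← hpi2]
  rw [Real.sqrt_sq hpi.le]
  field_simp
  ring

theorem kernelIntegral_eq_deriv {c A κ d x : ℝ} (hc : 0 < c) (hA : 0 < A) (hκ : 0 < κ)
    (hx : 0 < 24 * x + d) :
    kernelIntegral c (π * A / 12 / κ ^ 2) (π * (24 * x + d) / 12)
      = ((2 * √3 / π * deriv (fun y : ℝ => Real.sinh (π * √((24 * y + d) * A) / (6 * κ))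
          / √(24 * y + d)) x : ℝ) : ℂ) := by
  have hpi := Real.pi_pos
  set γ : ℝ := π * √A / (6 * κ) with hγ
  have hγ0 : 0 < γ := by positivity
  have hsA : √A ^ 2 = A := Real.sq_sqrt hA.le
  rw [kernelIntegral_eq_deriv_sinh hc (by positivity) (by positivity) hγ0 hx (by
    rw [hγ, div_pow, mul_pow, hsA]; field_simp; ring)]
  congr 1
  have e1 : deriv (fun y : ℝ => Real.sinh (π * √((24 * y + d) * A) / (6 * κ)) / √(24 * y + d)) x
      = deriv (fun X => Real.sinh (γ * √X) / √X) (24 * x + d) * 24 := by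
    have h1 : HasDerivAt (fun y : ℝ => 24 * y + d) 24 x := by
      simpa using ((hasDerivAt_id x).const_mul (24 : ℝ)).add_const d
    have h2 := (hasDerivAt_sinh_sqrt_div_sqrt γ hx).differentiableAt.hasDerivAt
    rw [← (h2.comp x h1).deriv]
    congr 1
    ext y
    simp only [Function.comp_apply]
    rw [Real.sqrt_mul' _ hA.le, hγ]
    congr 2
    ring
  have e2 : (π * A / 12 / κ ^ 2) ^ (3 / 2 : ℝ) = (√π * √A / (√12 * κ)) ^ 3 := by
    have : π * A / 12 / κ ^ 2 = (√π * √A / (√12 * κ)) ^ 2 := by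
      rw [div_pow, mul_pow, mul_pow, Real.sq_sqrt hpi.le, hsA, Real.sq_sqrt (by norm_num)]
      field_simp
    rw [this, ← Real.rpow_natCast, ← Real.rpow_natCast, ← Real.rpow_mul (by positivity)]
    norm_num
  have e3 : √(12 : ℝ) = 2 * √3 := by
    rw [show (12 : ℝ) = 2 ^ 2 * 3 by norm_num, Real.sqrt_mul (by positivity),
      Real.sqrt_sq (by norm_num)]
  have h3 : √(3 : ℝ) ^ 2 = 3 := Real.sq_sqrt (by norm_num)
  have hp2 : √π ^ 2 = π := Real.sq_sqrt hpi.le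
  rw [e1, e2, e3, hγ]
  generalize deriv (fun X => Real.sinh (π * √A / (6 * κ) * √X) / √X) (24 * x + d) = D
  have hs3 : 0 < √(3 : ℝ) := by positivity
  have hsp : 0 < √π := by positivity
  have hsA0 : 0 < √A := by positivity
  generalize hP : √π = P at *
  rw [← hp2]
  generalize √(3 : ℝ) = T at *
  field_simp
  rw [show T ^ 4 = (T ^ 2) ^ 2 by ring, h3]
  ring

end Rademacher

end

/-! ### The absolutely convergent series for p_r(n). -/

noncomputable section

namespace Rademacher

open Complex Real Filter Topology

/-- The tail estimate with both cut points at 0; the line Re u = k² gives (k²)^(-3/2) = k^(-3). -/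
theorem norm_kernelIntegral_le {k : ℕ} (hk : 0 < k) {α β K : ℝ} (hβ : 0 ≤ β) (hα : α ≤ K) :
    ‖kernelIntegral (k ^ 2) (α / k ^ 2) β‖ ≤ 11 * rexp (K + β) * (k : ℝ) ^ (-3 : ℝ) := by
  have hk1 : (1 : ℝ) ≤ k := by exact_mod_cast hk
  have hc : (0 : ℝ) < (k : ℝ) ^ 2 := by positivity
  have h := norm_integral_sub_intervalIntegral_le hc (continuous_kernelFn hc (α / k ^ 2) β)
    (norm_kernelFn_le hc hβ) le_rfl le_rfl
  rw [neg_zero, intervalIntegral.integral_same, sub_zero, add_zero] at h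
  have e1 : ((k : ℝ) ^ 2) ^ (-(3 / 2) : ℝ) = (k : ℝ) ^ (-3 : ℝ) := by
    rw [← Real.rpow_natCast, ← Real.rpow_mul (by positivity)]
    norm_num
  have e2 : rexp (α / k ^ 2 * k ^ 2 + β / k ^ 2) ≤ rexp (K + β) := by
    rw [Real.exp_le_exp, div_mul_cancel₀ _ hc.ne']
    exact add_le_add hα (div_le_self hβ (one_le_pow₀ hk1))
  rw [e1] at h
  rw [kernelIntegral, ofReal_pow, ofReal_natCast] at *
  refine h.trans ?_
  have h3 : (0 : ℝ) ≤ (k : ℝ) ^ (-3 : ℝ) := by positivity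
  have h4 := mul_le_mul_of_nonneg_right e2 h3
  have h5 : 0 ≤ rexp (K + β) * (k : ℝ) ^ (-3 : ℝ) := by positivity
  nlinarith

/-- The circle method, with the absolute convergence of the resulting series. -/
theorem hasSum_kernelIntegral_of_approx {a : PowerSeries ℂ} {g : ℂ → ℂ} (ha : IsSumOnDisc a g)
    (n : ℕ) {A : ℕ → ℕ → ℂ} {α : ℕ → ℝ} {β K : ℝ} (hβ : 0 ≤ β) (hK : 0 ≤ K) (hα : ∀ k, α k ≤ K)
    (hA : ∀ h k, ‖A h k‖ ≤ K * √k)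
    (H : ∀ (k h : ℕ) (w : ℂ), 0 < k → Nat.Coprime h k → 0 < w.re → (k : ℝ) ^ 2 ≤ (w⁻¹).re →
      ‖g (cexp (2 * π * I * (h / k + I * w))) * cexp (-(2 * π * I * n * (h / k + I * w)))
        - A h k * segmentFn (α k / k ^ 2) β w‖ ≤ K * (√k * √‖w‖)) :
    HasSum (fun k : ℕ => (∑ h ∈ reduced k, A h k) * kernelIntegral (k ^ 2) (α k / k ^ 2) β)
      (PowerSeries.coeff n a) := by
  have hlim := tendsto_sum_kernelIntegral ha n hβ hK hα hA H
  set T : ℕ → ℂ := fun k => (∑ h ∈ reduced k, A h k) * kernelIntegral (k ^ 2) (α k / k ^ 2) β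
    with hT
  have hT0 : T 0 = 0 := by simp [hT, reduced]
  -- At most k numerators of size O(√k), times k^(-3), make k^(-3/2).
  have hsum : Summable T := by
    refine Summable.of_norm_bounded ((Real.summable_nat_rpow.2
      (show (-(3 / 2) : ℝ) < -1 by norm_num)).mul_left (K * (11 * rexp (K + β)))) fun k => ?_
    rcases Nat.eq_zero_or_pos k with rfl | hk
    · rw [hT0, norm_zero]; positivity
    · have hkR : (0 : ℝ) < k := by exact_mod_cast hk
      have h1 : ‖∑ h ∈ reduced k, A h k‖ ≤ k * (K * √k) := by
        refine (norm_sum_le_of_le _ fun h _ => hA h k).trans ?_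
        rw [Finset.sum_const, nsmul_eq_mul]
        refine mul_le_mul_of_nonneg_right ?_ (by positivity)
        exact_mod_cast (Finset.card_filter_le _ _).trans (Finset.card_range k).le
      rw [hT]
      simp only
      rw [norm_mul]
      refine (mul_le_mul h1 (norm_kernelIntegral_le hk hβ (hα k)) (norm_nonneg _)
        (by positivity)).trans (le_of_eq ?_)
      have : (k : ℝ) ^ (-(3 / 2) : ℝ) = k * √k * (k : ℝ) ^ (-3 : ℝ) := by
        rw [Real.sqrt_eq_rpow]
        nth_rewrite 2 [← Real.rpow_one (k : ℝ)]
        rw [← Real.rpow_add hkR, ← Real.rpow_add hkR]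
        norm_num
      rw [this]
      ring
  have h1 := (hsum.hasSum.tendsto_sum_nat).comp (tendsto_add_atTop_nat 1)
  have h2 : (fun N => ∑ k ∈ Finset.Icc 1 N, T k) = (fun N => ∑ k ∈ Finset.range N, T k) ∘ (· + 1) := by
    ext N
    simp only [Function.comp_apply]
    rw [Finset.sum_range_succ', hT0, add_zero, Finset.range_eq_Ico, Finset.sum_Ico_add' T 0 N 1]
    rfl
  rw [h2] at hlim
  rw [tendsto_nhds_unique hlim h1]
  exact hsum.hasSum

/-- The derivative occurring in the term with denominator `k` of the series for `p_r(n)`. -/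
def derivFactor (r : ℕ) (A : ℝ) (k n : ℕ) : ℝ :=
  deriv (fun x : ℝ => Real.sinh (π * √((24 * x - 2 ^ r + 1) * A) / (6 * k))
    / √(24 * x - 2 ^ r + 1)) (n : ℝ)

open Classical in
/-- The term with denominator `k` of the series for `p_r(n)`. -/
def seriesTerm (r n k : ℕ) : ℂ :=
  if 0 < polarCoeff r k then
    ((2 * √3 / π * scaleFactor r k : ℝ) : ℂ) * ((√k : ℝ)
      * (∑ h ∈ reduced k, phase n h k * multiplier r h k) * derivFactor r (polarCoeff r k) k n)
  else 0

theorem seriesTerm_zero (r n : ℕ) : seriesTerm r n 0 = 0 := by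
  simp [seriesTerm]

theorem norm_phase (n h k : ℕ) : ‖phase n h k‖ = 1 := by
  rw [phase, show (-2 * π * I * n * h / k : ℂ) = ((-2 * π * n * h / k : ℝ) : ℂ) * I by
    push_cast; ring, Complex.norm_exp_ofReal_mul_I]

/-- The factor e^(-2πinτ) contributes the phase and adds 2πn to the coefficient -π(2^r-1)/12 of w.
The hypothesis on n says that the sum β is positive. -/
theorem hasSum_seriesTerm {r : ℕ} (hr : r ≤ 4) {n : ℕ} (hn : ((2 : ℝ) ^ r - 1) / 24 < n) :
    HasSum (seriesTerm r n) (pr r n) := by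
  classical
  have hpi := Real.pi_pos
  have hX : 0 < 24 * (n : ℝ) + (1 - 2 ^ r) := by linarith
  obtain ⟨K, hK, HK⟩ := exists_frFn_approx hr
  set A : ℕ → ℕ → ℂ := fun h k => if 0 < polarCoeff r k then
    multiplier r h k * scaleFactor r k * (√k : ℝ) * phase n h k else 0 with hAdef
  set β : ℝ := π * (24 * n + (1 - 2 ^ r)) / 12 with hβ
  have hβ0 : 0 ≤ β := by positivity
  -- One constant for three bounds: the approximation error times |e^(-2πinτ)| ≤ e^(2πn) (as Re w ≤
  -- 1), `scaleFactor` ≤ 4, and π · `polarCoeff` / 12 ≤ 2π.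
  set L : ℝ := K * rexp (2 * π * n) + 4 + 2 * π with hL
  have hKe : 0 ≤ K * rexp (2 * π * n) := by positivity
  have key := hasSum_kernelIntegral_of_approx (isSumOnDisc_fr r) n (A := A)
    (α := fun k => π * polarCoeff r k / 12) (β := β) (K := L) hβ0 (by positivity)
    (fun k => by
      have := (polarCoeff_le hr k).1
      nlinarith)
    (fun h k => by
      simp only [hAdef]
      split_ifs
      · rw [norm_mul, norm_mul, norm_mul, norm_multiplier, norm_phase, Complex.norm_real,
          Complex.norm_real, Real.norm_of_nonneg (scaleFactor_nonneg r k),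
          Real.norm_of_nonneg (Real.sqrt_nonneg _), one_mul, mul_one]
        refine mul_le_mul_of_nonneg_right ?_ (Real.sqrt_nonneg _)
        have := scaleFactor_le hr k
        linarith
      · rw [norm_zero]; positivity)
    (fun k h w hk hc hw hwk => by
      have hkR : (1 : ℝ) ≤ k := by exact_mod_cast hk
      have hw1 : w.re ≤ 1 := by
        have h0 : 0 < ‖w‖ := norm_pos_iff.2 (ne_zero_of_re_pos' hw)
        have h1 : 1 ≤ (w⁻¹).re := (one_le_pow₀ hkR).trans hwk
        have h2 := h1.trans (Complex.re_le_norm w⁻¹)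
        rw [norm_inv, one_le_inv₀ h0] at h2
        exact (Complex.re_le_norm w).trans h2
      have e1 : A h k * segmentFn (π * polarCoeff r k / 12 / k ^ 2) β w
          = leadingTerm r h k w * cexp (-(2 * π * I * n * (h / k + I * w))) := by
        simp only [hAdef, leadingTerm]
        split_ifs
        · have e2 : cexp (((π * polarCoeff r k / 12 / k ^ 2 : ℝ) : ℂ) * w⁻¹ + β * w) * phase n h k
              = cexp (π * polarCoeff r k / 12 / k ^ 2 * w⁻¹ - π * (2 ^ r - 1) / 12 * w)
                * cexp (-(2 * π * I * n * (h / k + I * w))) := by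
            rw [phase, ← Complex.exp_add, ← Complex.exp_add]
            congr 1
            rw [hβ]
            push_cast
            linear_combination (2 * π * n * w : ℂ) * I_sq
          rw [segmentFn]
          linear_combination (multiplier r h k * scaleFactor r k * (√k : ℝ) * Complex.sqrt w) * e2
        · simp
      simp only [e1]
      rw [← sub_mul, norm_mul]
      have e3 : ‖cexp (-(2 * π * I * n * (h / k + I * w)))‖ ≤ rexp (2 * π * n) := by
        rw [Complex.norm_exp, Real.exp_le_exp]
        have : (-(2 * π * I * n * (h / k + I * w)) : ℂ)
            = ((2 * π * n : ℝ) : ℂ) * w + ((-(2 * π * n * (h / k)) : ℝ) : ℂ) * I := by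
          push_cast
          linear_combination (-2 * π * n * w : ℂ) * I_sq
        rw [this, add_re, re_ofReal_mul, re_ofReal_mul, I_re, mul_zero, add_zero]
        exact mul_le_of_le_one_right (by positivity) hw1
      refine (mul_le_mul (HK k h w hk hc hw hwk) e3 (norm_nonneg _) (by positivity)).trans ?_
      have : 0 ≤ √k * √‖w‖ := by positivity
      rw [hL]
      nlinarith)
  refine key.congr_fun fun k => ?_
  rcases Nat.eq_zero_or_pos k with rfl | hk
  · rw [seriesTerm_zero]; simp [reduced]
  have hkR : (0 : ℝ) < k := by exact_mod_cast hk
  simp only [seriesTerm, hAdef]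
  split_ifs with hp
  · rw [hβ, kernelIntegral_eq_deriv (by positivity) hp hkR hX]
    have e : ∀ x : ℝ, 24 * x + (1 - 2 ^ r) = 24 * x - 2 ^ r + 1 := fun x => by ring
    simp only [e]
    rw [derivFactor, Finset.mul_sum, Finset.sum_mul, Finset.sum_mul, Finset.mul_sum]
    refine Finset.sum_congr rfl fun h _ => ?_
    push_cast
    ring
  · simp

end Rademacher

end

/-! ### Sorting the denominators by their power of 2. -/

noncomputable section

namespace Rademacher

open Complex Real

theorem multiplier_of_coprime {r k : ℕ} (h1 : Nat.gcd (2 ^ r) k = 1) (h2 : Nat.gcd 2 k = 1)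
    (h : ℕ) : multiplier r h k = omega h k * omega (2 ^ r * h) k / omega (2 * h) k := by
  simp [multiplier, h1, h2]

theorem gcd_two_pow_eq_one {k : ℕ} (hk : Nat.gcd 2 k = 1) (r : ℕ) : Nat.gcd (2 ^ r) k = 1 :=
  Nat.Coprime.pow_left r hk

theorem polarCoeff_of_odd {k : ℕ} (hk : Nat.gcd 2 k = 1) (r : ℕ) :
    polarCoeff r k = (1 + (2 : ℝ) ^ ((r : ℤ) - 1)) / 2 ^ r := by
  rw [polarCoeff, hk, gcd_two_pow_eq_one hk, zpow_sub₀ two_ne_zero]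
  simp
  field_simp
  ring

theorem polarCoeff_of_even {r j k : ℕ} (hk : Nat.gcd 2 k = 2) (hj : Nat.gcd (2 ^ r) k = 2 ^ j) :
    polarCoeff r k = -1 + (2 : ℝ) ^ (2 * (j : ℤ) - r) := by
  rw [polarCoeff, hk, hj, zpow_sub₀ two_ne_zero, zpow_mul, zpow_natCast, zpow_natCast]
  push_cast
  rw [← pow_mul, mul_comm j 2, pow_mul]
  norm_num
  ring

theorem sqrt_two_pow (r : ℕ) : √((2 : ℝ) ^ r) = (2 : ℝ) ^ ((r : ℝ) / 2) := by
  rw [Real.sqrt_eq_rpow, ← Real.rpow_natCast, ← Real.rpow_mul (by norm_num)]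
  congr 1
  ring

/-- The polar coefficient (1+2^(r-1))/2^r is always positive; its denominator becomes the 2^(r/2)
under the sinh, and 2 · `scaleFactor` = 2^((r+1)/2). -/
theorem seriesTerm_of_odd {k : ℕ} (hk : Nat.gcd 2 k = 1) (r n : ℕ) :
    seriesTerm r n k
      = (((2 : ℝ) ^ (((r : ℝ) + 1) / 2) * √3 / π : ℝ) : ℂ) * mainTerm r n k := by
  have hp := polarCoeff_of_odd hk r
  have hpos : 0 < polarCoeff r k := by rw [hp]; positivity
  have h1 := gcd_two_pow_eq_one hk r
  have e1 : derivFactor r (polarCoeff r k) k n = deriv (fun x : ℝ =>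
        Real.sinh (π * √((24 * x - 2 ^ r + 1) * (1 + (2 : ℝ) ^ ((r : ℤ) - 1)))
            / ((2 : ℝ) ^ ((r : ℝ) / 2) * (6 * k))) / √(24 * x - 2 ^ r + 1)) (n : ℝ) := by
    rw [derivFactor, hp]
    congr 1
    ext x
    rw [← mul_div_assoc, Real.sqrt_div' _ (by positivity), sqrt_two_pow, ← mul_div_assoc, div_div]
  have e2 : 2 * √3 / π * scaleFactor r k = (2 : ℝ) ^ (((r : ℝ) + 1) / 2) * √3 / π := by
    have h2 : √(2 : ℝ) * √2 = 2 := Real.mul_self_sqrt (by norm_num)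
    have h3 : (2 : ℝ) ^ (((r : ℝ) + 1) / 2) = (2 : ℝ) ^ ((r : ℝ) / 2) * √2 := by
      rw [Real.sqrt_eq_rpow, ← Real.rpow_add (by norm_num)]
      congr 1
      ring
    rw [scaleFactor, h1, hk, Nat.cast_one, div_one, div_one, sqrt_two_pow, h3]
    have : √(2 : ℝ) ≠ 0 := by positivity
    field_simp
    linear_combination -h2
  rw [seriesTerm, if_pos hpos, e1, e2, mainTerm]
  simp only [multiplier_of_coprime h1 hk]

/-- The polar coefficient -1 + 2^(2j-r) is positive exactly when 2j > r, that is, j ≥ 1 + ⌊r/2⌋. -/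
theorem seriesTerm_of_even {r j k : ℕ} (hk : Nat.gcd 2 k = 2) (hj : Nat.gcd (2 ^ r) k = 2 ^ j)
    (hjr : j ≤ r) (hr : 1 + r / 2 ≤ j) (n : ℕ) :
    seriesTerm r n k = ((√3 / π : ℝ) : ℂ)
      * ((((2 : ℝ) ^ ((2 - (j : ℝ) + (r : ℝ)) / 2) : ℝ) : ℂ) * extraTerm r j n k) := by
  have hp := polarCoeff_of_even hk hj
  have hpos : 0 < polarCoeff r k := by
    have := one_lt_zpow₀ (one_lt_two (α := ℝ)) (show 0 < 2 * (j : ℤ) - r by omega)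
    rw [hp]
    linarith
  have e2 : 2 * √3 / π * scaleFactor r k
      = √3 / π * (2 : ℝ) ^ ((2 - (j : ℝ) + (r : ℝ)) / 2) := by
    have h3 : (2 : ℝ) ^ ((2 - (j : ℝ) + (r : ℝ)) / 2) = 2 * √((2 : ℝ) ^ r / 2 ^ j) := by
      have : (2 - (j : ℝ) + (r : ℝ)) / 2 = 1 + ((r - j : ℕ) : ℝ) / 2 := by
        rw [Nat.cast_sub hjr]; ring
      rw [this, Real.rpow_add (by norm_num), Real.rpow_one, ← sqrt_two_pow,
        pow_sub₀ _ two_ne_zero hjr, div_eq_mul_inv]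
    rw [scaleFactor, hj, hk, h3]
    norm_num
    ring
  have e3 : ∀ h, multiplier r h k
      = omega h k * omega (2 ^ (r - j) * h) (k / 2 ^ j) / omega h (k / 2) := by
    intro h
    rw [multiplier, hj, hk, Nat.pow_div hjr (by norm_num)]
    simp
  rw [seriesTerm, if_pos hpos, e2, extraTerm, derivFactor, hp]
  simp only [e3]
  push_cast
  ring

theorem seriesTerm_eq_zero {r j k : ℕ} (hk : Nat.gcd 2 k = 2) (hj : Nat.gcd (2 ^ r) k = 2 ^ j)
    (hr : j < 1 + r / 2) (n : ℕ) : seriesTerm r n k = 0 := by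
  rw [seriesTerm, if_neg]
  rw [polarCoeff_of_even hk hj, not_lt]
  have := zpow_le_zpow_right₀ (one_le_two (α := ℝ)) (show 2 * (j : ℤ) - r ≤ 0 by omega)
  rw [zpow_zero] at this
  linarith

theorem gcd_two_eq_one_or_two (k : ℕ) : Nat.gcd 2 k = 1 ∨ Nat.gcd 2 k = 2 :=
  (Nat.dvd_prime Nat.prime_two).1 (Nat.gcd_dvd_left 2 k)

theorem gcd_two_pow_max_eq_one_iff {r k : ℕ} :
    Nat.gcd k (2 ^ max r 1) = 1 ↔ Nat.gcd 2 k = 1 := by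
  rw [Nat.gcd_comm]
  exact Nat.coprime_pow_left_iff (by simp) 2 k

theorem gcd_two_eq_two_of_gcd_two_pow {r j k : ℕ} (hj : 1 ≤ j) (h : Nat.gcd (2 ^ r) k = 2 ^ j) :
    Nat.gcd 2 k = 2 :=
  Nat.gcd_eq_left ((dvd_pow_self 2 (by omega)).trans (h ▸ Nat.gcd_dvd_right (2 ^ r) k))

/-- The odd denominators. -/
def mainSet (r : ℕ) : Set ℕ := {k | 1 ≤ k ∧ Nat.gcd k (2 ^ max r 1) = 1}

/-- The denominators whose greatest common divisor with `2^r` is `2^j`. -/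
def extraSet (r j : ℕ) : Set ℕ := {k | 1 ≤ k ∧ Nat.gcd k (2 ^ r) = 2 ^ j}

/-- The supports are disjoint, and the denominators outside all of them are 0 and the even k with 2j
≤ r, whose terms vanish. -/
theorem seriesTerm_eq_indicator (r n k : ℕ) :
    seriesTerm r n k = (mainSet r).indicator (seriesTerm r n) k
      + ∑ j ∈ Finset.Icc (1 + r / 2) r, (extraSet r j).indicator (seriesTerm r n) k := by
  classical
  rcases Nat.eq_zero_or_pos k with rfl | hk
  · simp [Set.indicator_apply, seriesTerm_zero]
  rcases gcd_two_eq_one_or_two k with h2 | h2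
  · rw [Set.indicator_of_mem (show k ∈ mainSet r from ⟨hk, gcd_two_pow_max_eq_one_iff.2 h2⟩),
      Finset.sum_eq_zero, add_zero]
    intro j hj
    refine Set.indicator_of_notMem ?_ _
    rintro ⟨-, h⟩
    rw [Nat.gcd_comm] at h
    have := gcd_two_eq_two_of_gcd_two_pow (by have := (Finset.mem_Icc.1 hj).1; omega) h
    omega
  · rw [Set.indicator_of_notMem (show k ∉ mainSet r from fun h => by
      have := gcd_two_pow_max_eq_one_iff.1 h.2; omega), zero_add]
    obtain ⟨j, hjr, hj⟩ := (Nat.dvd_prime_pow Nat.prime_two).1 (Nat.gcd_dvd_left (2 ^ r) k)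
    by_cases hr : 1 + r / 2 ≤ j
    · rw [Finset.sum_eq_single_of_mem j (Finset.mem_Icc.2 ⟨hr, hjr⟩)]
      · rw [Set.indicator_of_mem]
        exact ⟨hk, by rw [Nat.gcd_comm, hj]⟩
      · intro i _ hi
        refine Set.indicator_of_notMem ?_ _
        rintro ⟨-, h⟩
        rw [Nat.gcd_comm, hj] at h
        exact hi (Nat.pow_right_injective le_rfl h).symm
    · have h0 := seriesTerm_eq_zero h2 hj (not_le.1 hr) n
      rw [h0, Finset.sum_eq_zero]
      intro i _
      rw [Set.indicator_apply, h0, ite_self]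

theorem exact_formula {r : ℕ} (hr : r ≤ 4) {n : ℕ} (hn : ((2 : ℝ) ^ r - 1) / 24 < n) :
    Summable (fun k : mainSet r => mainTerm r n k) ∧
    (∀ j ∈ Finset.Icc (1 + r / 2) r, Summable (fun k : extraSet r j => extraTerm r j n k)) ∧
    pr r n = (((2 : ℝ) ^ (((r : ℝ) + 1) / 2) * √3 / π : ℝ) : ℂ) * ∑' k : mainSet r, mainTerm r n k
      + ((√3 / π : ℝ) : ℂ) * ∑ j ∈ Finset.Icc (1 + r / 2) r,
          (((2 : ℝ) ^ ((2 - (j : ℝ) + (r : ℝ)) / 2) : ℝ) : ℂ)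
            * ∑' k : extraSet r j, extraTerm r j n k := by
  have hs := hasSum_seriesTerm hr hn
  have hpi := Real.pi_pos
  have hmain : ∀ k : mainSet r, seriesTerm r n k
      = (((2 : ℝ) ^ (((r : ℝ) + 1) / 2) * √3 / π : ℝ) : ℂ) * mainTerm r n k :=
    fun k => seriesTerm_of_odd (gcd_two_pow_max_eq_one_iff.1 k.2.2) r n
  have hextra : ∀ j ∈ Finset.Icc (1 + r / 2) r, ∀ k : extraSet r j, seriesTerm r n k
      = ((√3 / π : ℝ) : ℂ)
        * ((((2 : ℝ) ^ ((2 - (j : ℝ) + (r : ℝ)) / 2) : ℝ) : ℂ) * extraTerm r j n k) := by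
    intro j hj k
    obtain ⟨hj1, hj2⟩ := Finset.mem_Icc.1 hj
    have hk := k.2.2
    rw [Nat.gcd_comm] at hk
    exact seriesTerm_of_even (gcd_two_eq_two_of_gcd_two_pow (by omega) hk) hk hj2 hj1 n
  have c1 : (((2 : ℝ) ^ (((r : ℝ) + 1) / 2) * √3 / π : ℝ) : ℂ) ≠ 0 := by
    rw [ofReal_ne_zero]; positivity
  have c2 : ((√3 / π : ℝ) : ℂ) ≠ 0 := by
    rw [ofReal_ne_zero]; positivity
  have c3 : ∀ j : ℕ, (((2 : ℝ) ^ ((2 - (j : ℝ) + (r : ℝ)) / 2) : ℝ) : ℂ) ≠ 0 := by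
    intro j; rw [ofReal_ne_zero]; positivity
  refine ⟨?_, fun j hj => ?_, ?_⟩
  · have := hs.summable.subtype (mainSet r)
    simp only [Function.comp_def, hmain] at this
    exact (summable_mul_left_iff c1).1 this
  · have := hs.summable.subtype (extraSet r j)
    simp only [Function.comp_def, hextra j hj] at this
    exact (summable_mul_left_iff (c3 j)).1 ((summable_mul_left_iff c2).1 this)
  · have h1 : ∀ s : Set ℕ, Summable (s.indicator (seriesTerm r n)) :=
      fun s => hs.summable.indicator s
    rw [← hs.tsum_eq, tsum_congr (seriesTerm_eq_indicator r n),
      (h1 _).tsum_add (summable_sum fun j _ => h1 _), Summable.tsum_finsetSum fun j _ => h1 _,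
      ← tsum_subtype, tsum_congr hmain, tsum_mul_left, Finset.mul_sum]
    congr 1
    refine Finset.sum_congr rfl fun j hj => ?_
    rw [← tsum_subtype, tsum_congr (hextra j hj), tsum_mul_left, tsum_mul_left]

end Rademacher

end

/-! ### The formulas for overpartitions, partitions and pod. -/

noncomputable section

namespace Rademacher

open Complex Real

theorem sqrt_twenty_four : √(24 : ℝ) = 2 * (√2 * √3) := by
  rw [← Real.sqrt_mul (by norm_num), show (24 : ℝ) = 2 ^ 2 * (2 * 3) by norm_num,
    Real.sqrt_mul (by positivity), Real.sqrt_sq (by norm_num)]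

theorem derivFactor_eq_mul {r k n : ℕ} {A c : ℝ} {g : ℝ → ℝ}
    (h : ∀ x : ℝ, Real.sinh (π * √((24 * x - 2 ^ r + 1) * A) / (6 * k)) / √(24 * x - 2 ^ r + 1)
      = c * g x) : derivFactor r A k n = c * deriv g n := by
  rw [derivFactor, funext h, deriv_const_mul_field]

theorem seriesTerm_zero_left_of_odd {k : ℕ} (hk : Nat.gcd 2 k = 1) (n : ℕ) :
    seriesTerm 0 n k = ((1 / (2 * π) : ℝ) : ℂ) * overTerm n k := by
  have hpi := Real.pi_pos
  have hp : polarCoeff 0 k = 3 / 2 := by rw [polarCoeff, hk]; norm_num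
  have hm : ∀ h, multiplier 0 h k = omega h k ^ 2 / omega (2 * h) k := fun h => by
    rw [multiplier_of_coprime (by simp) hk, pow_zero, one_mul, sq]
  have hs : scaleFactor 0 k = 1 / √2 := by simp [scaleFactor, hk]
  have hd : derivFactor 0 (3 / 2) k n = 1 / √24
      * deriv (fun x : ℝ => Real.sinh (π * √x / k) / √x) n := by
    refine derivFactor_eq_mul fun x => ?_
    have e1 : (24 * x - 2 ^ 0 + 1) * (3 / 2) = 6 ^ 2 * x := by ring
    have e2 : 24 * x - 2 ^ 0 + 1 = 24 * x := by ring
    rw [e1, e2, Real.sqrt_mul (by norm_num), Real.sqrt_sq (by norm_num),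
      Real.sqrt_mul (by norm_num), show π * (6 * √x) / (6 * k) = π * √x / k by
        rw [mul_left_comm, mul_div_mul_left _ _ (by norm_num)],
      one_div, inv_mul_eq_div, div_div, mul_comm √x]
  have hc : 2 * √3 / π * (1 / √2) * (1 / √24) = 1 / (2 * π) := by
    have h2 : √(2 : ℝ) ^ 2 = 2 := Real.sq_sqrt (by norm_num)
    rw [sqrt_twenty_four]
    have h2' : √(2 : ℝ) ≠ 0 := by positivity
    have h3' : √(3 : ℝ) ≠ 0 := by positivity
    field_simp
    linear_combination -h2
  rw [seriesTerm, if_pos (by rw [hp]; norm_num), hp, hd, hs, ← hc, overTerm]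
  simp only [hm, mul_comm (phase _ _ _)]
  push_cast
  ring

/-- For r = 1 the factors belonging to x² and x^(2^r) cancel, so all k behave alike, with polar
coefficient 1. -/
theorem seriesTerm_one_left (n k : ℕ) :
    seriesTerm 1 n k = ((1 / (π * √2) : ℝ) : ℂ) * partTerm n k := by
  have hpi := Real.pi_pos
  have hp : polarCoeff 1 k = 1 := by
    rw [polarCoeff]
    rcases gcd_two_eq_one_or_two k with h | h <;> rw [pow_one, h] <;> norm_num
  have hm : ∀ h, multiplier 1 h k = omega h k := fun h => by
    have : ‖omega (2 / Nat.gcd 2 k * h) (k / Nat.gcd 2 k)‖ ≠ 0 := by rw [norm_omega]; norm_num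
    rw [multiplier, pow_one, mul_div_assoc, div_self (norm_ne_zero_iff.1 this), mul_one]
  have hs : scaleFactor 1 k = 1 := by
    have : (0 : ℝ) < Nat.gcd 2 k := by linarith [(gcd_two_bounds k).1]
    rw [scaleFactor, pow_one, pow_one, div_self (Real.sqrt_ne_zero'.2 (by positivity))]
  have hd : derivFactor 1 1 k n = 1 / √24
      * deriv (fun x : ℝ => Real.sinh (π / k * √(2 / 3 * (x - 1 / 24))) / √(x - 1 / 24)) n := by
    refine derivFactor_eq_mul fun x => ?_
    have e1 : (24 * x - 2 ^ 1 + 1) * 1 = 6 ^ 2 * (2 / 3 * (x - 1 / 24)) := by ring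
    have e2 : 24 * x - 2 ^ 1 + 1 = 24 * (x - 1 / 24) := by ring
    rw [e1, e2, Real.sqrt_mul (by norm_num), Real.sqrt_sq (by norm_num),
      Real.sqrt_mul (show (0 : ℝ) ≤ 24 by norm_num), mul_left_comm,
      mul_div_mul_left _ _ (by norm_num : (6 : ℝ) ≠ 0), mul_div_right_comm, div_mul_div_comm,
      one_mul]
  have hc : 2 * √3 / π * 1 * (1 / √24) = 1 / (π * √2) := by
    rw [sqrt_twenty_four]
    have h2' : √(2 : ℝ) ≠ 0 := by positivity
    have h3' : √(3 : ℝ) ≠ 0 := by positivity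
    field_simp
  rw [seriesTerm, if_pos (by rw [hp]; norm_num), hp, hd, hs, ← hc, partTerm]
  simp only [hm, mul_comm (phase _ _ _)]
  push_cast
  ring

/-- The polar coefficient is 3/4 for odd k, 3 for 4 ∣ k and 0 for k ≡ 2 mod 4. The radicand in
`podTerm` is 2k, k and 0 respectively, so it carries both the scale factor and the vanishing of the
last class. -/
theorem seriesTerm_two_left (n k : ℕ) :
    seriesTerm 2 n k = ((2 / π : ℝ) : ℂ) * podTerm n k := by
  have hpi := Real.pi_pos
  have h3' : √(3 : ℝ) ≠ 0 := by positivity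
  rcases gcd_two_eq_one_or_two k with h2 | h2
  · have h4 : Nat.gcd k 4 = 1 := by
      rw [Nat.gcd_comm]; exact gcd_two_pow_eq_one h2 2
    have h4' : Nat.gcd (2 ^ 2) k = 1 := gcd_two_pow_eq_one h2 2
    have h2' : Nat.gcd k 2 = 1 := by rwa [Nat.gcd_comm]
    have hodd : Odd k := Nat.coprime_two_left.1 h2
    have hp : polarCoeff 2 k = 3 / 4 := by rw [polarCoeff, h2, h4']; norm_num
    have hs : scaleFactor 2 k = √2 := by
      have h5 : √(2 : ℝ) * √2 = 2 := Real.mul_self_sqrt (by norm_num)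
      rw [scaleFactor, h2, h4', Nat.cast_one, div_one, div_one, Real.sqrt_sq (by norm_num),
        div_eq_iff (by positivity), h5]
    have hdf : derivFactor 2 (3 / 4) k n = 1 / √3
        * deriv (fun x : ℝ => Real.sinh (π * √(((1 : ℕ) : ℝ) * (8 * x - 1)) / (4 * k))
          / √(8 * x - 1)) n := by
      refine derivFactor_eq_mul fun x => ?_
      have e1 : (24 * x - 2 ^ 2 + 1) * (3 / 4) = (3 / 2) ^ 2 * (8 * x - 1) := by ring
      have e2 : 24 * x - 2 ^ 2 + 1 = 3 * (8 * x - 1) := by ring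
      rw [e1, e2, Real.sqrt_mul (by norm_num), Real.sqrt_sq (by norm_num),
        Real.sqrt_mul (show (0 : ℝ) ≤ 3 by norm_num), Nat.cast_one, one_mul,
        show π * (3 / 2 * √(8 * x - 1)) / (6 * k) = π * √(8 * x - 1) / (4 * k) by
          rw [show (6 * k : ℝ) = 3 / 2 * (4 * k) by ring, mul_left_comm,
            mul_div_mul_left _ _ (by norm_num)],
        one_div, inv_mul_eq_div, div_div, mul_comm √3]
    have hk : √(k * (1 - (-1) ^ k + ((1 / 4 : ℕ) : ℝ))) = √2 * √k := by
      rw [hodd.neg_one_pow, ← Real.sqrt_mul (by norm_num)]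
      norm_num
      ring_nf
    have hc : 2 * √3 / π * (1 / √3) = 2 / π := by field_simp
    rw [seriesTerm, if_pos (by rw [hp]; norm_num), hp, hdf, hs, ← hc, podTerm, h4, h2', hk]
    simp only [multiplier_of_coprime h4' h2, mul_comm (phase _ _ _), Nat.div_one]
    push_cast
    ring
  · have heven : Even k := even_iff_two_dvd.2 (h2 ▸ Nat.gcd_dvd_right 2 k)
    have h2' : Nat.gcd k 2 = 2 := by rwa [Nat.gcd_comm]
    by_cases h4 : 4 ∣ k
    · have hg : Nat.gcd k 4 = 4 := Nat.gcd_eq_right h4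
      have hg' : Nat.gcd (2 ^ 2) k = 4 := by rw [Nat.gcd_comm]; exact hg
      have hp : polarCoeff 2 k = 3 := by rw [polarCoeff, h2, hg']; norm_num
      have hs : scaleFactor 2 k = 1 := by rw [scaleFactor, h2, hg']; norm_num
      have hm : ∀ h, multiplier 2 h k = omega h k * omega (4 * h / 4) (k / 4)
          / omega (2 * h / 2) (k / 2) := fun h => by
        rw [multiplier, h2, hg']
        simp
      have hdf : derivFactor 2 3 k n = 1 / √3
          * deriv (fun x : ℝ => Real.sinh (π * √(((4 : ℕ) : ℝ) * (8 * x - 1)) / (4 * k))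
            / √(8 * x - 1)) n := by
        refine derivFactor_eq_mul fun x => ?_
        have e1 : (24 * x - 2 ^ 2 + 1) * 3 = (3 / 2) ^ 2 * (((4 : ℕ) : ℝ) * (8 * x - 1)) := by
          push_cast; ring
        have e2 : 24 * x - 2 ^ 2 + 1 = 3 * (8 * x - 1) := by ring
        rw [e1, e2, Real.sqrt_mul (by norm_num), Real.sqrt_sq (by norm_num),
          Real.sqrt_mul (show (0 : ℝ) ≤ 3 by norm_num),
          show (6 * k : ℝ) = 3 / 2 * (4 * k) by ring, mul_left_comm,
          mul_div_mul_left _ _ (by norm_num : (3 / 2 : ℝ) ≠ 0), one_div, inv_mul_eq_div, div_div,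
          mul_comm √3]
      have hk : √(k * (1 - (-1) ^ k + ((4 / 4 : ℕ) : ℝ))) = √k := by
        rw [heven.neg_one_pow]
        norm_num
      have hc : 2 * √3 / π * (1 / √3) = 2 / π := by field_simp
      rw [seriesTerm, if_pos (by rw [hp]; norm_num), hp, hdf, hs, ← hc, podTerm, hg, h2', hk]
      simp only [hm, mul_comm (phase _ _ _)]
      push_cast
      ring
    · obtain ⟨j, hj2, hj⟩ := (Nat.dvd_prime_pow Nat.prime_two).1 (Nat.gcd_dvd_left (2 ^ 2) k)
      have hj1 : j < 2 := by
        rcases hj2.lt_or_eq with h | rfl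
        · exact h
        · exact absurd (Nat.gcd_eq_left_iff_dvd.1 hj) h4
      have hg : Nat.gcd k 4 / 4 = 0 := by
        rw [Nat.gcd_comm, show 4 = 2 ^ 2 from rfl, hj, Nat.div_eq_zero_iff]
        exact Or.inr (Nat.pow_lt_pow_right (by norm_num) hj1)
      rw [seriesTerm_eq_zero h2 hj hj1, podTerm, hg, heven.neg_one_pow]
      simp

theorem hasSum_overTerm {n : ℕ} (hn : 1 ≤ n) :
    HasSum (fun k : {k : ℕ | 1 ≤ k ∧ ¬ 2 ∣ k} => ((1 / (2 * π) : ℝ) : ℂ) * overTerm n k)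
      (numOverpartitions n : ℂ) := by
  have hn' : (0 : ℝ) < n := by exact_mod_cast hn
  have h := hasSum_seriesTerm (show 0 ≤ 4 by norm_num) (n := n) (by simpa using hn')
  rw [pr_zero, ← hasSum_subtype_iff_of_support_subset (s := {k : ℕ | 1 ≤ k ∧ ¬ 2 ∣ k})] at h
  · refine h.congr_fun fun k => (seriesTerm_zero_left_of_odd ?_ n).symm
    exact (Nat.Prime.coprime_iff_not_dvd Nat.prime_two).2 k.2.2
  · intro k hk
    rw [Function.mem_support] at hk
    refine ⟨Nat.one_le_iff_ne_zero.2 fun h0 => hk (h0 ▸ seriesTerm_zero 0 n), fun h2 => hk ?_⟩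
    -- For r = 0 and even k the polar coefficient is 1 + 1 - 2 = 0.
    exact seriesTerm_eq_zero (r := 0) (j := 0) (Nat.gcd_eq_left h2) (by simp) (by norm_num) n

theorem hasSum_seriesTerm_pos {r n : ℕ} (hr : r ≤ 2) (hn : 1 ≤ n) :
    HasSum (fun k : {k : ℕ | 1 ≤ k} => seriesTerm r n k) (pr r n) := by
  have hn' : (1 : ℝ) ≤ n := by exact_mod_cast hn
  have h2 : (2 : ℝ) ^ r ≤ 2 ^ 2 := pow_le_pow_right₀ (by norm_num) hr
  have h := hasSum_seriesTerm (show r ≤ 4 by omega) (n := n) (by linarith)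
  rw [← hasSum_subtype_iff_of_support_subset (s := {k : ℕ | 1 ≤ k})] at h
  · exact h
  · intro k hk
    exact Nat.one_le_iff_ne_zero.2 fun h0 => hk (h0 ▸ seriesTerm_zero r n)

end Rademacher

end
open Rademacher in
theorem theorem1 :
    (∀ r : ℕ, r ≤ 4 → ∀ n : ℕ, ((2 : ℝ) ^ r - 1) / 24 < n →
      Summable (fun k : {k : ℕ // 1 ≤ k ∧ Nat.gcd k (2 ^ max r 1) = 1} => mainTerm r n k) ∧
      (∀ j ∈ Finset.Icc (1 + r / 2) r,
        Summable (fun k : {k : ℕ // 1 ≤ k ∧ Nat.gcd k (2 ^ r) = 2 ^ j} => extraTerm r j n k)) ∧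
      pr r n =
        (((2 : ℝ) ^ (((r : ℝ) + 1) / 2) * Real.sqrt 3 / Real.pi : ℝ) : ℂ)
            * ∑' k : {k : ℕ // 1 ≤ k ∧ Nat.gcd k (2 ^ max r 1) = 1}, mainTerm r n k
          + ((Real.sqrt 3 / Real.pi : ℝ) : ℂ)
            * ∑ j ∈ Finset.Icc (1 + r / 2) r,
                (((2 : ℝ) ^ ((2 - (j : ℝ) + (r : ℝ)) / 2) : ℝ) : ℂ)
                  * ∑' k : {k : ℕ // 1 ≤ k ∧ Nat.gcd k (2 ^ r) = 2 ^ j}, extraTerm r j n k) ∧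
    (∀ n : ℕ, pr 0 n = numOverpartitions n ∧ pr 1 n = numPartitions n ∧ pr 2 n = pod n) ∧
    (∀ n : ℕ, 1 ≤ n →
      HasSum (fun k : {k : ℕ // 1 ≤ k ∧ ¬ 2 ∣ k} =>
        ((1 / (2 * Real.pi) : ℝ) : ℂ) * overTerm n k) (numOverpartitions n : ℂ) ∧
      HasSum (fun k : {k : ℕ // 1 ≤ k} =>
        ((1 / (Real.pi * Real.sqrt 2) : ℝ) : ℂ) * partTerm n k) (numPartitions n : ℂ) ∧
      HasSum (fun k : {k : ℕ // 1 ≤ k} =>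
        ((2 / Real.pi : ℝ) : ℂ) * podTerm n k) (pod n : ℂ)) := by
  refine ⟨fun r hr n hn => exact_formula hr hn, fun n => ⟨pr_zero n, pr_one n, pr_two n⟩,
    fun n hn => ⟨hasSum_overTerm hn, ?_, ?_⟩⟩
  · have h := hasSum_seriesTerm_pos (r := 1) (by norm_num) hn
    rw [pr_one] at h
    exact h.congr_fun fun k => (seriesTerm_one_left n k).symm
  · have h := hasSum_seriesTerm_pos (r := 2) (by norm_num) hn
    rw [pr_two] at h
    exact h.congr_fun fun k => (seriesTerm_two_left n k).symm
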